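/- **Resolvent identity.** Let $\Omega\subset\mathbb R^2$ be an open set such that 1. $\partial\Omega$ is of class $C^{2,1}$ (so that $\Omega$ lies locally on one side of $\partial\Omega$), with outward unit normal $\mathbf n=\mathbf n_\Omega$; 2. the curvature of $\partial\Omega$ belongs to $L^\infty(\partial\Omega)$; 3. there are $\delta_0>0$ and $C_0>0$ such that $\Psi(t,s)=s-t\,\mathbf n(s)$ is a $C^1$-diffeomorphism from $]-\delta_0,\delta_0[\,\times\partial\Omega$ onto its (open) range, $\partial\Omega=\Psi(\{0\}\times\partial\Omega)$, $\Psi(]0,\delta_0[\,\times\partial\Omega)=\Omega\cap\operatorname{range}\Psi$, and $C_0^{-1}<|\det J_\Psi|<C_0$ on $]-\delta_0,\delta_0[\,\times\partial\Omega$, where $J_\Psi$ is taken with respect to $t$ and arc length on $\partial\Omega$. Put $\tilde\Omega=\mathbb R^2\setminus\Omega$. For $O\in\{\Omega,\tilde\Omega\}$ let $H^1(O)=H^1(O,\mathbb C^2)$ be the Sobolev space and $\mathrm{tr}_O:H^1(O)\to L^2(\partial\Omega,\mathbb C^2)$ the trace operator, i.e. the continuous extension of the restriction to $\partial\Omega$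 of compactly supported smooth functions on $\mathbb R^2$; $L^2(\partial\Omega,\mathbb C^2)$ is taken with respect to arc length. For $\psi$ defined on $\mathbb R^2$, $\mathrm{tr}_O\psi$ means $\mathrm{tr}_O(\psi|_O)$. All scalar products are antilinear in the first argument; $\langle\cdot,\cdot\rangle$ is that of $L^2(\mathbb R^2,\mathbb C^2)$ and $\langle\cdot,\cdot\rangle_{\partial\Omega}$ that of $L^2(\partial\Omega,\mathbb C^2)$. With the Pauli matrices $$\sigma_1=\begin{pmatrix}0&1\\1&0\end{pmatrix},\quad \sigma_2=\begin{pmatrix}0&-i\\i&0\end{pmatrix},\quad \sigma_3=\begin{pmatrix}1&0\\0&-1\end{pmatrix},$$ set $T=-i(\sigma_1\partial_1+\sigma_2\partial_2)$, $B=-i\sigma_3(n_1\sigma_1+n_2\sigma_2)$ on $\partial\Omega$, and $P_\pm=\tfrac12(1\pm B)$. For $m>0$ consider the operators - $H_m=T+m\mathbf 1_{\tilde\Omega}\sigma_3$ in $L^2(\mathbb R^2,\mathbb C^2)$ with domain $H^1(\mathbb R^2,\mathbb C^2)$; - $H_\Omega=T$ in $L^2(\Omega,\mathbb C^2)$ with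 domain $\{\varphi\in H^1(\Omega): P_-\mathrm{tr}_\Omega\varphi=0\}$; - $H^{(m)}_{\tilde\Omega}=T+m\sigma_3$ in $L^2(\tilde\Omega,\mathbb C^2)$ with domain $\{\varphi\in H^1(\tilde\Omega): P_+\mathrm{tr}_{\tilde\Omega}\varphi=0\}$. Let $z\in\mathbb C$ belong to the resolvent sets of all three operators and write $R_m=(H_m-z)^{-1}$, $R_\Omega=(H_\Omega-z)^{-1}$, $R^{(m)}_{\tilde\Omega}=(H^{(m)}_{\tilde\Omega}-z)^{-1}$. Then for all $f\in L^2(\mathbb R^2,\mathbb C^2)$ and all $g=h\oplus\tilde h\in L^2(\Omega,\mathbb C^2)\oplus L^2(\tilde\Omega,\mathbb C^2)\cong L^2(\mathbb R^2,\mathbb C^2)$ the traces below are well defined and $$\langle f,R_m g\rangle=\langle f,(R_\Omega\oplus R^{(m)}_{\tilde\Omega})g\rangle+\langle P_-\mathrm{tr}_\Omega R_m^*f,\ \sigma_3\,\mathrm{tr}_\Omega R_\Omega h\rangle_{\partial\Omega}+\langle P_+\mathrm{tr}_{\tilde\Omega}R_m^*f,\ \sigma_3\,\mathrm{tr}_{\tilde\Omega}R^{(m)}_{\tilde\Omega}\tilde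 h\rangle_{\partial\Omega}.$$ -/

import Mathlib

open MeasureTheory Filter Topology Set
open scoped ContDiff ENNReal

noncomputable section

namespace InfiniteMass

/-! ### Spaces -/

/-- The Euclidean plane `ℝ²`. -/
abbrev Plane : Type := EuclideanSpace ℝ (Fin 2)

/-- The spinor space `ℂ²` with its Euclidean scalar product (antilinear in the first slot). -/
abbrev Spinor : Type := EuclideanSpace ℂ (Fin 2)

/-- `L²(O, ℂ²)` with respect to Lebesgue measure. -/
abbrev L2 (O : Set Plane) : Type := Lp Spinor 2 ((volume : Measure Plane).restrict O)

/-- Arc length on the boundary of `Ω`: the one-dimensional Hausdorff measure on `∂Ω`. -/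
abbrev bdMeasure (Ω : Set Plane) : Measure Plane :=
  (Measure.hausdorffMeasure 1 : Measure Plane).restrict (frontier Ω)

/-- `L²(∂Ω, ℂ²)` with respect to arc length. -/
abbrev L2bd (Ω : Set Plane) : Type := Lp Spinor 2 (bdMeasure Ω)

/-- The scalar product of `L²(∂Ω, ℂ²)`, written on representatives. -/
def bdInner (Ω : Set Plane) (u v : Plane → Spinor) : ℂ :=
  ∫ p, inner ℂ (u p) (v p) ∂(bdMeasure Ω)

/-- Restriction `L²(ℝ²) → L²(O)`. -/
def restr (O : Set Plane) (f : L2 univ) : L2 O :=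
  MemLp.toLp (f : Plane → Spinor)
    ((Lp.memLp f).mono_measure (Measure.restrict_mono (subset_univ O) le_rfl))

open scoped Classical in
lemma memLp_glue {Ω : Set Plane} (hΩ : IsOpen Ω) (h : L2 Ω) (k : L2 Ωᶜ) :
    MemLp (Ω.piecewise (h : Plane → Spinor) (k : Plane → Spinor)) 2
      ((volume : Measure Plane).restrict univ) := by
  rw [Measure.restrict_univ]
  exact MemLp.piecewise hΩ.measurableSet (Lp.memLp h) (Lp.memLp k)

open scoped Classical in
/-- The element `h ⊕ k` of `L²(ℝ²)` under `L²(ℝ²) ≅ L²(Ω) ⊕ L²(ℝ² ∖ Ω)`: it equals `h` on `Ω` and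
`k` on the complement. -/
def glue {Ω : Set Plane} (hΩ : IsOpen Ω) (h : L2 Ω) (k : L2 Ωᶜ) : L2 univ :=
  (memLp_glue hΩ h k).toLp _

/-! ### Geometry of the domain -/

/-- `(e, f)` is a `C^{2,1}` graph representation of `Ω` near the point `p`: in the orthonormal
coordinates given by `e`, and in a neighbourhood `U` of `p`, the set `Ω` is the region below the
graph of a `C²` function `f` with Lipschitz second derivative. -/
def IsGraphChart (Ω : Set Plane) (p : Plane) (e : Plane ≃ₗᵢ[ℝ] Plane) (f : ℝ → ℝ) : Prop :=
  ContDiff ℝ 2 f ∧ (∃ K, LipschitzWith K (deriv (deriv f))) ∧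
    ∃ U : Set Plane, IsOpen U ∧ p ∈ U ∧ ∀ x ∈ U, (x ∈ Ω ↔ (e x) 1 < f ((e x) 0))

/-- The boundary of `Ω` is of class `C^{2,1}`. -/
def HasC21Boundary (Ω : Set Plane) : Prop :=
  ∀ p ∈ frontier Ω, ∃ e f, IsGraphChart Ω p e f

/-- `κ` is the curvature of `∂Ω` at `p`, with the sign fixed by `(t · ∇) t = -κ n` for the outward
normal `n` and the tangent `t`; it is positive for a disc. -/
def IsCurvature (Ω : Set Plane) (p : Plane) (κ : ℝ) : Prop :=
  ∃ e f, IsGraphChart Ω p e f ∧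
    κ = -(deriv (deriv f) ((e p) 0)) / (Real.sqrt (1 + deriv f ((e p) 0) ^ 2)) ^ 3

open scoped Classical in
/-- The curvature of `∂Ω` (zero off `∂Ω`). -/
def curvature (Ω : Set Plane) (p : Plane) : ℝ :=
  if h : p ∈ frontier Ω ∧ ∃ κ, IsCurvature Ω p κ then h.2.choose else 0

/-- `n` is the unit normal of `∂Ω` at `p` pointing out of `Ω`: rays from `p` that make an obtuse
angle with `n` start inside `Ω`, those that make an acute angle with `n` start outside. At most one
vector has this property. -/
def IsOuterNormal (Ω : Set Plane) (p n : Plane) : Prop :=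
  ‖n‖ = 1 ∧
    (∀ v : Plane, inner ℝ v n < 0 → ∀ᶠ t : ℝ in 𝓝[>] 0, p + t • v ∈ Ω) ∧
    (∀ v : Plane, 0 < inner ℝ v n → ∀ᶠ t : ℝ in 𝓝[>] 0, p + t • v ∉ Ω)

open scoped Classical in
/-- The outward unit normal of `Ω` on `∂Ω` (zero where there is none). -/
def outerNormal (Ω : Set Plane) (p : Plane) : Plane :=
  if h : p ∈ frontier Ω ∧ ∃ n, IsOuterNormal Ω p n then h.2.choose else 0

/-- The unit tangent `t = (-n₂, n₁)`. -/
def bdTangent (Ω : Set Plane) (p : Plane) : Plane :=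
  !₂[-(outerNormal Ω p) 1, (outerNormal Ω p) 0]

/-- The tubular map `Ψ(t, s) = s - t n(s)`. -/
def tubular (Ω : Set Plane) (q : ℝ × Plane) : Plane := q.2 - q.1 • outerNormal Ω q.2

/-- The set `]-δ, δ[ × ∂Ω`. -/
def tubeSource (Ω : Set Plane) (δ : ℝ) : Set (ℝ × Plane) := Ioo (-δ) δ ×ˢ frontier Ω

/-- The Jacobian determinant of the tubular map with respect to `t` and arc length on `∂Ω`: the
determinant whose columns are the derivatives of `Ψ` in the direction `∂_t` and along the unit
tangent. (Both directions are tangent to `]-δ, δ[ × ∂Ω`, so these values of the derivative within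
that set are determined.) -/
def tubularJacobian (Ω : Set Plane) (δ : ℝ) (q : ℝ × Plane) : ℝ :=
  let D := fderivWithin ℝ (tubular Ω) (tubeSource Ω δ) q
  let a := D (1, 0)
  let b := D (0, bdTangent Ω q.2)
  a 0 * b 1 - a 1 * b 0

/-- Global tubular coordinates of width `δ` near `∂Ω`, with constant `C` in the Jacobian bounds. -/
structure HasTubularCoordinates (Ω : Set Plane) (δ C : ℝ) : Prop where
  /-- `Ψ` is a `C¹`-diffeomorphism from `]-δ, δ[ × ∂Ω` onto its (open) range. -/
  contDiffOn : ContDiffOn ℝ 1 (tubular Ω) (tubeSource Ω δ)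
  isOpen_range : IsOpen (tubular Ω '' tubeSource Ω δ)
  exists_inverse : ∃ Φ : Plane → ℝ × Plane,
    ContDiffOn ℝ 1 Φ (tubular Ω '' tubeSource Ω δ) ∧ LeftInvOn Φ (tubular Ω) (tubeSource Ω δ)
  boundary_eq : frontier Ω = tubular Ω '' ({0} ×ˢ frontier Ω)
  inside_eq : tubular Ω '' (Ioo 0 δ ×ˢ frontier Ω) = Ω ∩ tubular Ω '' tubeSource Ω δ
  jacobian_lt : ∀ q ∈ tubeSource Ω δ, |tubularJacobian Ω δ q| < C
  lt_jacobian : ∀ q ∈ tubeSource Ω δ, C⁻¹ < |tubularJacobian Ω δ q|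

/-- The standing assumptions on `Ω`. -/
structure IsAdmissible (Ω : Set Plane) : Prop where
  isOpen : IsOpen Ω
  boundary : HasC21Boundary Ω
  curvature_bounded : MemLp (curvature Ω) ∞ (bdMeasure Ω)
  tubularCoordinates : ∃ δ > 0, ∃ C > 0, HasTubularCoordinates Ω δ C

/-! ### Sobolev space and trace -/

/-- `v` is the distributional partial derivative `∂_j u` on `O`. Test functions are supported in the
interior of `O`, so for a closed `O` this is the derivative on the interior. -/
def HasWeakPartial (O : Set Plane) (j : Fin 2) (u v : L2 O) : Prop :=
  ∀ φ : Plane → ℝ, ContDiff ℝ ∞ φ → HasCompactSupport φ → tsupport φ ⊆ interior O →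
    ∫ x in O, (fderiv ℝ φ x (EuclideanSpace.single j 1)) • u x = -∫ x in O, φ x • v x

/-- Test functions times `L²` functions are integrable. -/
lemma integrable_smul {O : Set Plane} (u : L2 O) {φ : Plane → ℝ} (hφ : Continuous φ)
    (hc : HasCompactSupport φ) :
    Integrable (fun x => φ x • u x) ((volume : Measure Plane).restrict O) :=
  memLp_one_iff_integrable.mp
    (MemLp.smul (p := 2) (q := 2) (r := 1) (Lp.memLp u) (hφ.memLp_of_hasCompactSupport hc))

lemma integrable_partial_smul {O : Set Plane} (u : L2 O) {φ : Plane → ℝ} (hφ : ContDiff ℝ ∞ φ)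
    (hc : HasCompactSupport φ) (w : Plane) :
    Integrable (fun x => (fderiv ℝ φ x w) • u x) ((volume : Measure Plane).restrict O) :=
  integrable_smul u
    (((hφ.continuous_fderiv (by simp)).clm_apply continuous_const))
    (hc.fderiv_apply (𝕜 := ℝ) w)

lemma HasWeakPartial.zero (O : Set Plane) (j : Fin 2) : HasWeakPartial O j 0 0 := by
  intro φ _ _ _
  have h0 : ((0 : L2 O) : Plane → Spinor) =ᵐ[(volume : Measure Plane).restrict O] 0 :=
    Lp.coeFn_zero _ _ _
  have h1 : ∀ ψ : Plane → ℝ, ∫ x in O, ψ x • (0 : L2 O) x = 0 := by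
    intro ψ
    apply integral_eq_zero_of_ae
    filter_upwards [h0] with x hx
    rw [hx]
    simp
  rw [h1, h1, neg_zero]

lemma HasWeakPartial.add {O : Set Plane} {j : Fin 2} {u v u' v' : L2 O}
    (h : HasWeakPartial O j u v) (h' : HasWeakPartial O j u' v') :
    HasWeakPartial O j (u + u') (v + v') := by
  intro φ hφ hc hs
  have key : ∀ (ψ : Plane → ℝ) (a b : L2 O),
      Integrable (fun x => ψ x • a x) ((volume : Measure Plane).restrict O) →
      Integrable (fun x => ψ x • b x) ((volume : Measure Plane).restrict O) →
      ∫ x in O, ψ x • (a + b) x = (∫ x in O, ψ x • a x) + ∫ x in O, ψ x • b x := by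
    intro ψ a b ha hb
    rw [← integral_add ha hb]
    apply integral_congr_ae
    filter_upwards [Lp.coeFn_add a b] with x hx
    rw [hx, Pi.add_apply, smul_add]
  rw [key _ _ _ (integrable_partial_smul u hφ hc _) (integrable_partial_smul u' hφ hc _),
    key _ _ _ (integrable_smul v hφ.continuous hc) (integrable_smul v' hφ.continuous hc),
    h φ hφ hc hs, h' φ hφ hc hs, neg_add]

lemma HasWeakPartial.smul {O : Set Plane} {j : Fin 2} {u v : L2 O} (c : ℂ)
    (h : HasWeakPartial O j u v) : HasWeakPartial O j (c • u) (c • v) := by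
  intro φ hφ hc hs
  have key : ∀ (ψ : Plane → ℝ) (a : L2 O),
      ∫ x in O, ψ x • (c • a) x = c • ∫ x in O, ψ x • a x := by
    intro ψ a
    rw [← integral_smul]
    apply integral_congr_ae
    filter_upwards [Lp.coeFn_smul c a] with x hx
    rw [hx, Pi.smul_apply, smul_comm]
  rw [key, key, h φ hφ hc hs, smul_neg]

/-- The Sobolev space `H¹(O, ℂ²)`. -/
def H1 (O : Set Plane) : Submodule ℂ (L2 O) where
  carrier := {u | ∃ d : Fin 2 → L2 O, ∀ j, HasWeakPartial O j u (d j)}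
  zero_mem' := ⟨0, fun j => HasWeakPartial.zero O j⟩
  add_mem' := by
    rintro u v ⟨d, hd⟩ ⟨d', hd'⟩
    exact ⟨d + d', fun j => (hd j).add (hd' j)⟩
  smul_mem' := by
    rintro c u ⟨d, hd⟩
    exact ⟨c • d, fun j => (hd j).smul c⟩

/-- `τ = tr_O u`, where `O` is `Ω` or its complement and `u ∈ H¹(O)`. The trace operator is the
continuous extension to `H¹(O)`, with values in `L²(∂Ω)`, of the restriction to `∂Ω` of functions
smooth up to the boundary: there are compactly supported smooth functions on the plane which
converge to `u` in `H¹(O)` and whose restrictions to `∂Ω` converge to `τ` in `L²(∂Ω)`. -/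
def HasTrace (Ω O : Set Plane) (u : L2 O) (τ : L2bd Ω) : Prop :=
  ∃ d : Fin 2 → L2 O, (∀ j, HasWeakPartial O j u (d j)) ∧
    ∃ φ : ℕ → Plane → Spinor,
      (∀ n, ContDiff ℝ ∞ (φ n) ∧ HasCompactSupport (φ n)) ∧
      Tendsto (fun n => eLpNorm (fun x => φ n x - u x) 2 ((volume : Measure Plane).restrict O))
        atTop (𝓝 0) ∧
      (∀ j, Tendsto (fun n => eLpNorm
          (fun x => fderiv ℝ (φ n) x (EuclideanSpace.single j 1) - d j x) 2
          ((volume : Measure Plane).restrict O)) atTop (𝓝 0)) ∧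
      Tendsto (fun n => eLpNorm (fun p => φ n p - τ p) 2 (bdMeasure Ω)) atTop (𝓝 0)

open scoped Classical in
/-- The trace `tr_O u ∈ L²(∂Ω)` of `u ∈ H¹(O)`, for `O` equal to `Ω` or to its complement. -/
def bdTrace (Ω O : Set Plane) (u : L2 O) : L2bd Ω :=
  if h : ∃ τ, HasTrace Ω O u τ then h.choose else 0

section TraceLinear

variable {μ : Measure Plane}

lemma tendsto_eLpNorm_add {φ φ' : ℕ → Plane → Spinor} {u u' : Lp Spinor 2 μ}
    (hφ : ∀ n, AEStronglyMeasurable (φ n) μ) (hφ' : ∀ n, AEStronglyMeasurable (φ' n) μ)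
    (h : Tendsto (fun n => eLpNorm (fun x => φ n x - u x) 2 μ) atTop (𝓝 0))
    (h' : Tendsto (fun n => eLpNorm (fun x => φ' n x - u' x) 2 μ) atTop (𝓝 0)) :
    Tendsto (fun n => eLpNorm (fun x => (φ n x + φ' n x) - (u + u' : Lp Spinor 2 μ) x) 2 μ)
      atTop (𝓝 0) := by
  have hs := h.add h'
  rw [add_zero] at hs
  refine tendsto_of_tendsto_of_tendsto_of_le_of_le tendsto_const_nhds hs (fun _ => zero_le) ?_
  intro n
  have e : (fun x => (φ n x + φ' n x) - (u + u' : Lp Spinor 2 μ) x) =ᵐ[μ]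
      (fun x => φ n x - u x) + (fun x => φ' n x - u' x) := by
    filter_upwards [Lp.coeFn_add u u'] with x hx
    rw [hx]
    simp only [Pi.add_apply]
    abel
  simp only
  rw [eLpNorm_congr_ae e]
  exact eLpNorm_add_le ((hφ n).sub (Lp.aestronglyMeasurable u))
    ((hφ' n).sub (Lp.aestronglyMeasurable u')) (by norm_num)

lemma tendsto_eLpNorm_smul {φ : ℕ → Plane → Spinor} {u : Lp Spinor 2 μ} (c : ℂ)
    (h : Tendsto (fun n => eLpNorm (fun x => φ n x - u x) 2 μ) atTop (𝓝 0)) :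
    Tendsto (fun n => eLpNorm (fun x => c • φ n x - (c • u : Lp Spinor 2 μ) x) 2 μ)
      atTop (𝓝 0) := by
  have e : ∀ n, eLpNorm (fun x => c • φ n x - (c • u : Lp Spinor 2 μ) x) 2 μ =
      ‖c‖ₑ * eLpNorm (fun x => φ n x - u x) 2 μ := by
    intro n
    rw [← eLpNorm_const_smul]
    apply eLpNorm_congr_ae
    filter_upwards [Lp.coeFn_smul c u] with x hx
    rw [hx]
    simp only [Pi.smul_apply, smul_sub]
  simp_rw [e]
  have := ENNReal.Tendsto.const_mul h (Or.inr (enorm_ne_top (x := c)))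
  simpa using this

lemma aesm_of_smooth {φ : Plane → Spinor} (h : ContDiff ℝ ∞ φ) : AEStronglyMeasurable φ μ :=
  h.continuous.aestronglyMeasurable

lemma aesm_partial_of_smooth {φ : Plane → Spinor} (h : ContDiff ℝ ∞ φ) (w : Plane) :
    AEStronglyMeasurable (fun x => fderiv ℝ φ x w) μ :=
  ((h.continuous_fderiv (by simp)).clm_apply continuous_const).aestronglyMeasurable

end TraceLinear

lemma HasTrace.zero (Ω O : Set Plane) : HasTrace Ω O 0 0 := by
  have hz : ∀ μ : Measure Plane,
      Tendsto (fun _ : ℕ => eLpNorm (fun x => (0 : Spinor) - (0 : Lp Spinor 2 μ) x) 2 μ)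
        atTop (𝓝 0) := by
    intro μ
    have : eLpNorm (fun x => (0 : Spinor) - (0 : Lp Spinor 2 μ) x) 2 μ = 0 := by
      rw [← eLpNorm_zero (p := 2) (μ := μ) (ε := Spinor)]
      apply eLpNorm_congr_ae
      filter_upwards [Lp.coeFn_zero Spinor 2 μ] with x hx
      rw [hx]
      simp
    rw [this]
    exact tendsto_const_nhds
  refine ⟨0, fun j => HasWeakPartial.zero O j, fun _ _ => 0,
    fun _ => ⟨contDiff_const, HasCompactSupport.zero⟩, hz _, ?_, hz _⟩
  intro j
  simpa using hz ((volume : Measure Plane).restrict O)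

lemma HasTrace.add {Ω O : Set Plane} {u u' : L2 O} {τ τ' : L2bd Ω}
    (h : HasTrace Ω O u τ) (h' : HasTrace Ω O u' τ') : HasTrace Ω O (u + u') (τ + τ') := by
  obtain ⟨d, hd, φ, hφ, h1, h2, h3⟩ := h
  obtain ⟨d', hd', φ', hφ', h1', h2', h3'⟩ := h'
  refine ⟨d + d', fun j => (hd j).add (hd' j), fun n x => φ n x + φ' n x,
    fun n => ⟨(hφ n).1.add (hφ' n).1, (hφ n).2.add (hφ' n).2⟩,
    tendsto_eLpNorm_add (fun n => aesm_of_smooth (hφ n).1) (fun n => aesm_of_smooth (hφ' n).1)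
      h1 h1', ?_,
    tendsto_eLpNorm_add (fun n => aesm_of_smooth (hφ n).1) (fun n => aesm_of_smooth (hφ' n).1)
      h3 h3'⟩
  intro j
  have := tendsto_eLpNorm_add (fun n => aesm_partial_of_smooth (hφ n).1 _)
    (fun n => aesm_partial_of_smooth (hφ' n).1 _) (h2 j) (h2' j)
  refine this.congr ?_
  intro n
  congr 1
  funext x
  rw [fderiv_fun_add ((hφ n).1.differentiable (by simp) x) ((hφ' n).1.differentiable (by simp) x)]
  rfl

lemma HasTrace.smul {Ω O : Set Plane} {u : L2 O} {τ : L2bd Ω} (c : ℂ)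
    (h : HasTrace Ω O u τ) : HasTrace Ω O (c • u) (c • τ) := by
  obtain ⟨d, hd, φ, hφ, h1, h2, h3⟩ := h
  refine ⟨c • d, fun j => (hd j).smul c, fun n x => c • φ n x,
    fun n => ⟨(hφ n).1.const_smul c, (hφ n).2.smul_left (f := fun _ => c)⟩,
    tendsto_eLpNorm_smul c h1, ?_, tendsto_eLpNorm_smul c h3⟩
  intro j
  refine (tendsto_eLpNorm_smul c (h2 j)).congr ?_
  intro n
  congr 1
  funext x
  rw [fderiv_fun_const_smul ((hφ n).1.differentiable (by simp) x)]
  rfl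

/-! ### Dirac matrices and boundary conditions -/

/-- A complex `2 × 2` matrix acting on spinors. -/
def act (M : Matrix (Fin 2) (Fin 2) ℂ) : Spinor →L[ℂ] Spinor := Matrix.toEuclideanCLM (𝕜 := ℂ) M

def sigma1 : Matrix (Fin 2) (Fin 2) ℂ := !![0, 1; 1, 0]

def sigma2 : Matrix (Fin 2) (Fin 2) ℂ := !![0, -Complex.I; Complex.I, 0]

def sigma3 : Matrix (Fin 2) (Fin 2) ℂ := !![1, 0; 0, -1]

/-- The boundary matrix `B_Ω = -i σ₃ (σ · n_Ω)`. -/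
def boundaryMatrix (Ω : Set Plane) (p : Plane) : Matrix (Fin 2) (Fin 2) ℂ :=
  (-Complex.I) • (sigma3 *
    (((outerNormal Ω p 0 : ℝ) : ℂ) • sigma1 + ((outerNormal Ω p 1 : ℝ) : ℂ) • sigma2))

/-- `P₊ = (1 + B_Ω) / 2`. -/
def Pplus (Ω : Set Plane) (p : Plane) : Spinor →L[ℂ] Spinor :=
  act ((1 / 2 : ℂ) • (1 + boundaryMatrix Ω p))

/-- `P₋ = (1 - B_Ω) / 2`. -/
def Pminus (Ω : Set Plane) (p : Plane) : Spinor →L[ℂ] Spinor :=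
  act ((1 / 2 : ℂ) • (1 - boundaryMatrix Ω p))

/-- `{u ∈ H¹(O) : P tr_O u = 0}`. -/
def bcDomain (Ω O : Set Plane) (P : Plane → Spinor →L[ℂ] Spinor) : Submodule ℂ (L2 O) where
  carrier := {u | u ∈ H1 O ∧ ∃ τ, HasTrace Ω O u τ ∧ ∀ᵐ p ∂(bdMeasure Ω), P p (τ p) = 0}
  zero_mem' := by
    refine ⟨(H1 O).zero_mem, 0, HasTrace.zero Ω O, ?_⟩
    filter_upwards [Lp.coeFn_zero Spinor 2 (bdMeasure Ω)] with p hp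
    rw [hp]
    simp
  add_mem' := by
    rintro u v ⟨hu, τ, h, hP⟩ ⟨hv, τ', h', hP'⟩
    refine ⟨(H1 O).add_mem hu hv, τ + τ', h.add h', ?_⟩
    filter_upwards [hP, hP', Lp.coeFn_add τ τ'] with p h1 h2 h3
    rw [h3, Pi.add_apply, map_add, h1, h2, add_zero]
  smul_mem' := by
    rintro c u ⟨hu, τ, h, hP⟩
    refine ⟨(H1 O).smul_mem c hu, c • τ, h.smul c, ?_⟩
    filter_upwards [hP, Lp.coeFn_smul c τ] with p h1 h3
    rw [h3, Pi.smul_apply, map_smul, h1, smul_zero]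

/-! ### Dirac operators and resolvents -/

/-- The graph of the operator `T + M σ₃` in `L²(O)` with domain `D ∩ H¹(O)`, where
`T = -i (σ₁ ∂₁ + σ₂ ∂₂)` and `M` is a real function (the mass). -/
def diracGraph (O : Set Plane) (M : Plane → ℝ) (D : Submodule ℂ (L2 O)) :
    Submodule ℂ (L2 O × L2 O) where
  carrier := {q | q.1 ∈ D ∧ ∃ d : Fin 2 → L2 O, (∀ j, HasWeakPartial O j q.1 (d j)) ∧
    ∀ᵐ x ∂((volume : Measure Plane).restrict O),
      q.2 x = (-Complex.I) • (act sigma1 (d 0 x) + act sigma2 (d 1 x))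
        + ((M x : ℝ) : ℂ) • act sigma3 (q.1 x)}
  zero_mem' := by
    refine ⟨D.zero_mem, 0, fun j => HasWeakPartial.zero O j, ?_⟩
    filter_upwards [Lp.coeFn_zero Spinor 2 ((volume : Measure Plane).restrict O)] with x hx
    change ((0 : L2 O) : Plane → Spinor) x = (-Complex.I) • (act sigma1 ((0 : L2 O) x) +
      act sigma2 ((0 : L2 O) x)) + ((M x : ℝ) : ℂ) • act sigma3 ((0 : L2 O) x)
    rw [hx]
    simp
  add_mem' := by
    rintro ⟨u, w⟩ ⟨u', w'⟩ ⟨hu, d, hd, h⟩ ⟨hu', d', hd', h'⟩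
    refine ⟨D.add_mem hu hu', d + d', fun j => (hd j).add (hd' j), ?_⟩
    filter_upwards [h, h', Lp.coeFn_add w w', Lp.coeFn_add u u', Lp.coeFn_add (d 0) (d' 0),
      Lp.coeFn_add (d 1) (d' 1)] with x e1 e2 e3 e4 e5 e6
    simp only [Prod.mk_add_mk, Pi.add_apply] at e1 e2 e3 e4 e5 e6 ⊢
    rw [e3, e4, e5, e6, e1, e2]
    simp only [map_add, smul_add]
    abel
  smul_mem' := by
    rintro c ⟨u, w⟩ ⟨hu, d, hd, h⟩
    refine ⟨D.smul_mem c hu, c • d, fun j => (hd j).smul c, ?_⟩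
    filter_upwards [h, Lp.coeFn_smul c w, Lp.coeFn_smul c u, Lp.coeFn_smul c (d 0),
      Lp.coeFn_smul c (d 1)] with x e1 e2 e3 e4 e5
    simp only [Prod.smul_mk, Pi.smul_apply] at e1 e2 e3 e4 e5 ⊢
    rw [e2, e3, e4, e5, e1]
    simp only [map_smul, smul_add]
    simp only [smul_smul, mul_comm c]

/-- The operator `T + M σ₃` in `L²(O)` with domain `D ∩ H¹(O)`. (Its graph is single-valued as soon
as the boundary of `O` is a null set, since weak derivatives are then unique.) -/
def dirac (O : Set Plane) (M : Plane → ℝ) (D : Submodule ℂ (L2 O)) : L2 O →ₗ.[ℂ] L2 O :=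
  (diracGraph O M D).toLinearPMap

/-- `H_m = T + m 1_{ℝ² ∖ Ω} σ₃` in `L²(ℝ²)`, with domain `H¹(ℝ²)`. -/
def Hm (Ω : Set Plane) (m : ℝ) : L2 univ →ₗ.[ℂ] L2 univ :=
  dirac univ (Ωᶜ.indicator fun _ => m) (H1 univ)

/-- `H_Ω = T` in `L²(Ω)`, with boundary condition `P₋ tr_Ω φ = 0`. -/
def HOmega (Ω : Set Plane) : L2 Ω →ₗ.[ℂ] L2 Ω :=
  dirac Ω (fun _ => 0) (bcDomain Ω Ω (Pminus Ω))

/-- `T + m σ₃` in `L²(ℝ² ∖ Ω)`, with boundary condition `P₊ tr φ = 0`. -/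
def HCompl (Ω : Set Plane) (m : ℝ) : L2 Ωᶜ →ₗ.[ℂ] L2 Ωᶜ :=
  dirac Ωᶜ (fun _ => m) (bcDomain Ω Ωᶜ (Pplus Ω))

section Resolvent

variable {H : Type*} [NormedAddCommGroup H] [InnerProductSpace ℂ H]

/-- `R` is a bounded, everywhere defined two-sided inverse of `A - z`. -/
def IsResolventAt (A : H →ₗ.[ℂ] H) (z : ℂ) (R : H →L[ℂ] H) : Prop :=
  (∀ g : H, ∃ u : A.domain, (u : H) = R g ∧ A u - z • (u : H) = g) ∧
    ∀ u : A.domain, R (A u - z • (u : H)) = u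

/-- The resolvent set `ϱ(A)` of an unbounded operator. -/
def opResolventSet (A : H →ₗ.[ℂ] H) : Set ℂ := {z | ∃ R, IsResolventAt A z R}

open scoped Classical in
/-- The resolvent `(A - z)⁻¹` for `z ∈ ϱ(A)`. -/
def opResolvent (A : H →ₗ.[ℂ] H) (z : ℂ) : H →L[ℂ] H :=
  if h : ∃ R, IsResolventAt A z R then h.choose else 0

lemma opResolvent_spec {A : H →ₗ.[ℂ] H} {z : ℂ} (hz : z ∈ opResolventSet A) :
    IsResolventAt A z (opResolvent A z) := by
  have h : ∃ R, IsResolventAt A z R := hz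
  rw [opResolvent, dif_pos h]
  exact h.choose_spec

end Resolvent

end InfiniteMass

end

open InfiniteMass

namespace InfiniteMass

open scoped NNReal Manifold

noncomputable section

/-! ### One-dimensional Hausdorff measure on curves -/

/-! The identity is Green's formula for `T`, applied on each side of the boundary to `ψ = R_m^* f`
and the one-sided resolvent. Put `u = R_Ω h`, with traces `ρ` of `ψ` and `τ` of `u`. Since `T u = h
+ z u` and `T ψ = f - m 1_{Ωᶜ} σ₃ ψ + z̄ ψ`, the terms in `z` cancel and `⟨ψ, h⟩ = ⟨f, u⟩ + ⟨ρ,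
-i(σ·n) τ⟩` on `Ω`. On the complement the mass terms cancel as well (`σ₃` is hermitian, `m` is
real), and the boundary term changes sign with the normal. Now `-i(σ·n) = σ₃ B`, where `B` is
hermitian and anticommutes with `σ₃`. Hence `B τ = τ` gives `⟨ρ, σ₃ B τ⟩ = ⟨P₋ ρ, σ₃ τ⟩`, while `B
τ' = -τ'` gives `-⟨ρ, σ₃ B τ'⟩ = ⟨P₊ ρ, σ₃ τ'⟩`. Adding the two sides yields the claim
(`HasTraceData.inner_resolvent`, `bdInner_Pminus`, `bdInner_Pplus`).

The analysis behind this has three ingredients.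

Green's formula. Arc length is a Hausdorff measure, so its expression along a graph is needed first
(`hausdorffMeasure_restrict_range_eq`). Flattening graphs by a shear and localizing then gives the
divergence theorem (`integral_fderiv_eq_boundary`). Green's formula passes to `H¹` limits of test
functions whose boundary values converge, and tested against smooth functions it also shows that
traces are unique.

Regularity of `ψ`. A priori `ψ` is only an `L²` function satisfying a weak equation on the plane. On
test functions `‖Tφ‖² = ‖∂₁φ‖² + ‖∂₂φ‖²` and `‖(T + i)φ‖² = ‖Tφ‖² + ‖φ‖²`, and the range of `T + i`
is dense because `T` has no weak `L²` eigenfunction at `±i` (a Liouville theorem,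
`eq_zero_of_dirac_eq`). So `ψ` is an `H¹` limit of test functions
(`exists_tendsto_of_inner_diracOp`).

Trace inequality. The tubular coordinates, with the lower bound on their Jacobian, control boundary
values by the `H¹` norm (`exists_lintegral_boundary_le`). The sequence approximating `ψ` therefore
has convergent boundary values, and its limit is the trace of `ψ` from both sides. -/

/-- An inequality between measures may be checked locally. -/
lemma measure_le_of_forall_nhds {X : Type*} [TopologicalSpace X] [SecondCountableTopology X]
    [MeasurableSpace X] [OpensMeasurableSpace X] {μ ν : Measure X}
    (h : ∀ x, ∃ U, IsOpen U ∧ x ∈ U ∧ ∀ A, MeasurableSet A → A ⊆ U → μ A ≤ ν A) : μ ≤ ν := by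
  choose U hU hxU hA using h
  obtain ⟨s, hs, hcov⟩ := TopologicalSpace.countable_cover_nhds fun x => (hU x).mem_nhds (hxU x)
  rcases isEmpty_or_nonempty X with hX | hX
  · rw [Measure.eq_zero_of_isEmpty μ]
    exact Measure.zero_le _
  obtain ⟨x₀⟩ := hX
  have hne : s.Nonempty := by
    by_contra hne
    rw [not_nonempty_iff_eq_empty] at hne
    have : x₀ ∈ (⋃ x ∈ s, U x) := hcov ▸ mem_univ x₀
    simp [hne] at this
  obtain ⟨w, hw⟩ := hs.exists_eq_range hne
  have hcov' : ⋃ n, U (w n) = univ := by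
    rw [← hcov, hw, biUnion_range]
  rw [Measure.le_iff]
  intro A hAm
  -- Disjointing the countable cover splits `A` into measurable pieces, each inside one of the good
  -- neighbourhoods.
  have hm : ∀ n, MeasurableSet (disjointed (fun n => U (w n)) n) :=
    MeasurableSet.disjointed fun n => (hU _).measurableSet
  have e : A = ⋃ n, A ∩ disjointed (fun n => U (w n)) n := by
    rw [← inter_iUnion, iUnion_disjointed, hcov', inter_univ]
  have hd : Pairwise (Function.onFun Disjoint fun n => A ∩ disjointed (fun n => U (w n)) n) :=
    fun i j hij => (disjoint_disjointed _ hij).mono inter_subset_right inter_subset_right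
  rw [e, measure_iUnion hd fun n => hAm.inter (hm n), measure_iUnion hd fun n => hAm.inter (hm n)]
  exact ENNReal.tsum_le_tsum fun n => hA _ _ (hAm.inter (hm n))
    (inter_subset_right.trans (disjointed_subset _ _))

section Curve

variable {E : Type*} [NormedAddCommGroup E] [NormedSpace ℝ E] [MeasurableSpace E] [BorelSpace E]
  {γ : ℝ → E}

/-- By strict differentiability, near `x₀` the curve differs from its linearization by at most `ε
‖γ'(x₀)‖ |x - y|`, so it is bi-Lipschitz with constants `(1 ± ε) ‖γ'(x₀)‖`; continuity of `‖γ'‖`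
gives the length integral the same bounds. Sharing these bounds is what makes the two measures
comparable. -/
lemma exists_isOpen_curve_bounds (hγ : ContDiff ℝ 1 γ) {x₀ : ℝ} (h0 : deriv γ x₀ ≠ 0)
    (hinj : Function.Injective γ) {ε : ℝ} (hε : 0 < ε) (hε1 : ε < 1) :
    ∃ N, IsOpen N ∧ x₀ ∈ N ∧ ∀ A ⊆ N, MeasurableSet A →
      (μH[1] (γ '' A) ≤ ENNReal.ofReal ((1 + ε) * ‖deriv γ x₀‖) * volume A ∧
      ENNReal.ofReal ((1 - ε) * ‖deriv γ x₀‖) * volume A ≤ μH[1] (γ '' A)) ∧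
      (∫⁻ x in A, ‖deriv γ x‖ₑ ≤ ENNReal.ofReal ((1 + ε) * ‖deriv γ x₀‖) * volume A ∧
      ENNReal.ofReal ((1 - ε) * ‖deriv γ x₀‖) * volume A ≤ ∫⁻ x in A, ‖deriv γ x‖ₑ) := by
  set c := ‖deriv γ x₀‖ with hc
  have hc0 : 0 < c := norm_pos_iff.2 h0
  have hstrict := (hγ.hasStrictDerivAt (x := x₀) one_ne_zero).hasStrictFDerivAt.isLittleO.def
    (mul_pos hε hc0)
  rw [nhds_prod_eq, eventually_prod_self_iff'] at hstrict
  obtain ⟨V, hV, hVs⟩ := hstrict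
  have hcont : Continuous fun x => ‖deriv γ x‖ := (hγ.continuous_deriv le_rfl).norm
  have hW : ∀ᶠ x in 𝓝 x₀, dist ‖deriv γ x‖ c < ε * c :=
    hcont.continuousAt.eventually (Metric.ball_mem_nhds _ (mul_pos hε hc0))
  obtain ⟨N, hN, hNo, hxN⟩ := mem_nhds_iff.1 (inter_mem hV hW)
  have key : ∀ x ∈ N, ∀ y ∈ N, ‖γ x - γ y - (x - y) • deriv γ x₀‖ ≤ ε * c * |x - y| := by
    intro x hx y hy
    simpa using hVs x (hN hx).1 y (hN hy).1
  have hder : ∀ x ∈ N, |‖deriv γ x‖ - c| < ε * c := fun x hx => (hN hx).2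
  have hns : ∀ x y : ℝ, ‖(x - y) • deriv γ x₀‖ = c * |x - y| := by
    intro x y
    rw [norm_smul, Real.norm_eq_abs, mul_comm]
  refine ⟨N, hNo, hxN, fun A hA hAm => ⟨⟨?_, ?_⟩, ?_, ?_⟩⟩
  · have hL : LipschitzOnWith ((1 + ε) * c).toNNReal γ A := by
      apply LipschitzOnWith.of_dist_le_mul
      intro x hx y hy
      rw [Real.coe_toNNReal _ (by positivity), dist_eq_norm, Real.dist_eq]
      have h1 := key x (hA hx) y (hA hy)
      have h2 := norm_le_norm_add_norm_sub' (γ x - γ y) ((x - y) • deriv γ x₀)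
      rw [hns] at h2
      linarith
    have := hL.hausdorffMeasure_image_le zero_le_one
    rw [hausdorffMeasure_real, ENNReal.rpow_one] at this
    exact this
  -- The lower bound is the Lipschitz estimate for the inverse of `γ` on `γ '' A`.
  · have hL : LipschitzOnWith ((1 - ε) * c)⁻¹.toNNReal (Function.invFun γ) (γ '' A) := by
      apply LipschitzOnWith.of_dist_le_mul
      rintro _ ⟨x, hx, rfl⟩ _ ⟨y, hy, rfl⟩
      have hp : 0 < (1 - ε) * c := mul_pos (by linarith) hc0
      rw [Real.coe_toNNReal _ (by positivity), Function.leftInverse_invFun hinj,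
        Function.leftInverse_invFun hinj, dist_eq_norm (γ x), Real.dist_eq, inv_mul_eq_div,
        le_div_iff₀ hp]
      have h1 := key x (hA hx) y (hA hy)
      have h2 := norm_le_norm_add_norm_sub' ((x - y) • deriv γ x₀) (γ x - γ y)
      rw [hns, norm_sub_rev _ (γ x - γ y)] at h2
      linarith
    have := hL.hausdorffMeasure_image_le zero_le_one
    rw [hausdorffMeasure_real, ENNReal.rpow_one, image_image] at this
    simp only [Function.leftInverse_invFun hinj _, image_id'] at this
    have hp : 0 < (1 - ε) * c := mul_pos (by linarith) hc0
    calc ENNReal.ofReal ((1 - ε) * c) * volume A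
        ≤ ENNReal.ofReal ((1 - ε) * c) * (ENNReal.ofReal ((1 - ε) * c)⁻¹ * μH[1] (γ '' A)) := by
          gcongr
          exact this
      _ = μH[1] (γ '' A) := by
          rw [← mul_assoc, ← ENNReal.ofReal_mul hp.le, mul_inv_cancel₀ hp.ne', ENNReal.ofReal_one,
            one_mul]
  · calc ∫⁻ x in A, ‖deriv γ x‖ₑ ≤ ∫⁻ _ in A, ENNReal.ofReal ((1 + ε) * c) := by
          refine setLIntegral_mono' hAm fun x hx => ?_
          rw [← ofReal_norm]
          apply ENNReal.ofReal_le_ofReal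
          have := (abs_lt.1 (hder x (hA hx))).2
          linarith
      _ = _ := by rw [setLIntegral_const]
  · calc ENNReal.ofReal ((1 - ε) * c) * volume A = ∫⁻ _ in A, ENNReal.ofReal ((1 - ε) * c) := by
          rw [setLIntegral_const]
      _ ≤ _ := by
          refine setLIntegral_mono' hAm fun x hx => ?_
          rw [← ofReal_norm]
          apply ENNReal.ofReal_le_ofReal
          have := (abs_lt.1 (hder x (hA hx))).1
          linarith

/-- The factor `(1 + ε) / (1 - ε)` tends to `1`; it is the ratio of the two constants in
`exists_isOpen_curve_bounds`. -/
lemma le_of_forall_le_ofReal_div_mul {a b : ℝ≥0∞}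
    (h : ∀ ε : ℝ, 0 < ε → ε < 1 → a ≤ ENNReal.ofReal ((1 + ε) / (1 - ε)) * b) : a ≤ b := by
  have ht : Tendsto (fun ε : ℝ => ENNReal.ofReal ((1 + ε) / (1 - ε)) * b) (𝓝[>] 0) (𝓝 (1 * b)) := by
    apply ENNReal.Tendsto.mul_const _ (Or.inl one_ne_zero)
    rw [← ENNReal.ofReal_one]
    apply ENNReal.tendsto_ofReal
    have : ContinuousAt (fun ε : ℝ => (1 + ε) / (1 - ε)) 0 := by
      apply ContinuousAt.div (by fun_prop) (by fun_prop) (by norm_num)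
    simpa using this.tendsto.mono_left (nhdsWithin_le_nhds (s := Ioi 0))
  rw [one_mul] at ht
  refine ge_of_tendsto ht ?_
  filter_upwards [Ioo_mem_nhdsGT (zero_lt_one (α := ℝ))] with ε hε
  exact h ε hε.1 hε.2

/-- Arc length: the one-dimensional Hausdorff measure on a regular `C¹` curve is the length
element of its parametrization. -/
theorem hausdorffMeasure_restrict_range_eq (hγ : ContDiff ℝ 1 γ) (h0 : ∀ x, deriv γ x ≠ 0)
    (hemb : MeasurableEmbedding γ) :
    (μH[1] : Measure E).restrict (range γ) =
      Measure.map γ (volume.withDensity fun x => ‖deriv γ x‖ₑ) := by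
  rw [← hemb.map_comap]
  congr 1
  -- The local bounds depend on the point through `‖γ'(x₀)‖`, but their ratio does not, so the
  -- comparison of the two measures globalizes.
  have bounds : ∀ ε : ℝ, 0 < ε → ε < 1 →
      (μH[1] : Measure E).comap γ ≤
        ENNReal.ofReal ((1 + ε) / (1 - ε)) • (volume.withDensity fun x => ‖deriv γ x‖ₑ) ∧
      (volume.withDensity fun x => ‖deriv γ x‖ₑ) ≤
        ENNReal.ofReal ((1 + ε) / (1 - ε)) • (μH[1] : Measure E).comap γ := by
    intro ε hε hε1
    have hr : ∀ c : ℝ, ENNReal.ofReal ((1 + ε) * c) =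
        ENNReal.ofReal ((1 + ε) / (1 - ε)) * ENNReal.ofReal ((1 - ε) * c) := by
      intro c
      rw [← ENNReal.ofReal_mul (div_nonneg (by linarith) (by linarith))]
      congr 1
      have : (1 - ε) ≠ 0 := by linarith
      field_simp
    constructor
    · refine measure_le_of_forall_nhds fun x => ?_
      obtain ⟨N, hNo, hxN, hN⟩ := exists_isOpen_curve_bounds hγ (h0 x) hemb.injective hε hε1
      refine ⟨N, hNo, hxN, fun A hA hAN => ?_⟩
      obtain ⟨⟨h1, h2⟩, h3, h4⟩ := hN A hAN hA
      rw [hemb.comap_apply, Measure.smul_apply, withDensity_apply _ hA, smul_eq_mul]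
      refine h1.trans ?_
      rw [hr, mul_assoc]
      gcongr
    · refine measure_le_of_forall_nhds fun x => ?_
      obtain ⟨N, hNo, hxN, hN⟩ := exists_isOpen_curve_bounds hγ (h0 x) hemb.injective hε hε1
      refine ⟨N, hNo, hxN, fun A hA hAN => ?_⟩
      obtain ⟨⟨h1, h2⟩, h3, h4⟩ := hN A hAN hA
      rw [Measure.smul_apply, hemb.comap_apply, withDensity_apply _ hA, smul_eq_mul]
      refine h3.trans ?_
      rw [hr, mul_assoc]
      gcongr
  apply le_antisymm
  · rw [Measure.le_iff]
    intro A _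
    exact le_of_forall_le_ofReal_div_mul fun ε h1 h2 => (bounds ε h1 h2).1 A
  · rw [Measure.le_iff]
    intro A _
    exact le_of_forall_le_ofReal_div_mul fun ε h1 h2 => (bounds ε h1 h2).2 A

end Curve

/-! ### Graph charts of the boundary -/

/-- The orthonormal frame of the plane attached to the coordinates `e`. -/
def frame (e : Plane ≃ₗᵢ[ℝ] Plane) (j : Fin 2) : Plane := e.symm (EuclideanSpace.single j 1)

/-- The boundary curve `x ↦ (x, f x)` in the coordinates `e`. -/
def graphCurve (e : Plane ≃ₗᵢ[ℝ] Plane) (f : ℝ → ℝ) (x : ℝ) : Plane :=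
  x • frame e 0 + f x • frame e 1

section Frame

variable (e : Plane ≃ₗᵢ[ℝ] Plane)

lemma apply_frame (j : Fin 2) : e (frame e j) = EuclideanSpace.single j 1 := by simp [frame]

lemma apply_combination_zero (a b : ℝ) : e (a • frame e 0 + b • frame e 1) 0 = a := by
  simp [apply_frame]

lemma apply_combination_one (a b : ℝ) : e (a • frame e 0 + b • frame e 1) 1 = b := by
  simp [apply_frame]

lemma eq_combination (p : Plane) : p = (e p) 0 • frame e 0 + (e p) 1 • frame e 1 := by
  apply e.injective
  ext j
  fin_cases j
  · exact (apply_combination_zero e _ _).symm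
  · exact (apply_combination_one e _ _).symm

lemma inner_combination (p : Plane) (a b : ℝ) :
    inner ℝ p (a • frame e 0 + b • frame e 1) = (e p) 0 * a + (e p) 1 * b := by
  rw [← e.inner_map_map, map_add, map_smul, map_smul, apply_frame, apply_frame, inner_add_right,
    inner_smul_right, inner_smul_right, EuclideanSpace.inner_single_right,
    EuclideanSpace.inner_single_right]
  simp
  ring

lemma norm_combination (a b : ℝ) : ‖a • frame e 0 + b • frame e 1‖ = Real.sqrt (a ^ 2 + b ^ 2) := by
  rw [← Real.sqrt_sq (norm_nonneg _), ← real_inner_self_eq_norm_sq, inner_combination,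
    apply_combination_zero, apply_combination_one]
  congr 1
  ring

end Frame

/-! ### Arc length and unit normal along a graph -/

section GraphCurve

variable {e : Plane ≃ₗᵢ[ℝ] Plane} {f : ℝ → ℝ}

lemma apply_graphCurve_zero (x : ℝ) : e (graphCurve e f x) 0 = x := apply_combination_zero e _ _

lemma apply_graphCurve_one (x : ℝ) : e (graphCurve e f x) 1 = f x := apply_combination_one e _ _

lemma graphCurve_injective : Function.Injective (graphCurve e f) := fun x y h => by
  rw [← apply_graphCurve_zero (e := e) (f := f) x, h, apply_graphCurve_zero]

lemma mem_range_graphCurve {p : Plane} :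
    p ∈ range (graphCurve e f) ↔ (e p) 1 = f ((e p) 0) := by
  constructor
  · rintro ⟨x, rfl⟩
    rw [apply_graphCurve_zero, apply_graphCurve_one]
  · intro h
    refine ⟨(e p) 0, ?_⟩
    rw [graphCurve, ← h]
    exact (eq_combination e p).symm

lemma contDiff_graphCurve {n : ℕ∞ω} (hf : ContDiff ℝ n f) : ContDiff ℝ n (graphCurve e f) :=
  (contDiff_id.smul contDiff_const).add (hf.smul contDiff_const)

lemma hasDerivAt_graphCurve {f' x : ℝ} (hf : HasDerivAt f f' x) :
    HasDerivAt (graphCurve e f) (frame e 0 + f' • frame e 1) x := by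
  have := ((hasDerivAt_id x).smul_const (frame e 0)).add (hf.smul_const (frame e 1))
  rwa [one_smul] at this

lemma deriv_graphCurve (hf : Differentiable ℝ f) (x : ℝ) :
    deriv (graphCurve e f) x = frame e 0 + deriv f x • frame e 1 :=
  (hasDerivAt_graphCurve (hf x).hasDerivAt).deriv

lemma norm_deriv_graphCurve (hf : Differentiable ℝ f) (x : ℝ) :
    ‖deriv (graphCurve e f) x‖ = Real.sqrt (1 + deriv f x ^ 2) := by
  have := norm_combination e 1 (deriv f x)
  rw [one_smul, one_pow] at this
  rw [deriv_graphCurve hf, this]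

lemma measurableEmbedding_graphCurve (hf : Continuous f) : MeasurableEmbedding (graphCurve e f) := by
  have : Continuous (graphCurve e f) := by
    unfold graphCurve
    fun_prop
  exact this.measurableEmbedding graphCurve_injective

lemma hausdorffMeasure_restrict_range_graphCurve (hf : ContDiff ℝ 1 f) :
    (μH[1] : Measure Plane).restrict (range (graphCurve e f)) =
      Measure.map (graphCurve e f)
        (volume.withDensity fun x => ENNReal.ofReal (Real.sqrt (1 + deriv f x ^ 2))) := by
  have hd := hf.differentiable one_ne_zero
  rw [hausdorffMeasure_restrict_range_eq (contDiff_graphCurve hf) _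
    (measurableEmbedding_graphCurve hf.continuous)]
  · simp_rw [← ofReal_norm, norm_deriv_graphCurve hd]
  · intro x
    rw [← norm_pos_iff, norm_deriv_graphCurve hd]
    positivity

/-- The upward unit normal of the graph of `f`. -/
def graphNormal (e : Plane ≃ₗᵢ[ℝ] Plane) (f : ℝ → ℝ) (x : ℝ) : Plane :=
  (Real.sqrt (1 + deriv f x ^ 2))⁻¹ • ((-deriv f x) • frame e 0 + (1 : ℝ) • frame e 1)

lemma norm_graphNormal (x : ℝ) : ‖graphNormal e f x‖ = 1 := by
  rw [graphNormal, norm_smul, norm_combination, norm_inv, Real.norm_of_nonneg (Real.sqrt_nonneg _)]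
  have : Real.sqrt (1 + deriv f x ^ 2) ≠ 0 := by positivity
  rw [neg_sq, one_pow, add_comm (deriv f x ^ 2), inv_mul_cancel₀ this]

lemma inner_graphNormal (v : Plane) (x : ℝ) :
    inner ℝ v (graphNormal e f x) =
      (Real.sqrt (1 + deriv f x ^ 2))⁻¹ * ((e v) 1 - deriv f x * (e v) 0) := by
  rw [graphNormal, inner_smul_right, inner_combination]
  ring

end GraphCurve

/-- For distinct unit vectors, `n' - n` makes an obtuse angle with `n` and an acute one with `n'`,
so a short ray in this direction would lie both inside and outside `Ω`. -/
lemma IsOuterNormal.eq {Ω : Set Plane} {p n n' : Plane} (h : IsOuterNormal Ω p n)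
    (h' : IsOuterNormal Ω p n') : n = n' := by
  by_contra hne
  have hlt : inner ℝ n' n < 1 := (inner_lt_one_iff_real_of_norm_eq_one h'.1 h.1).2 (Ne.symm hne)
  have h1 : inner ℝ (n' - n) n < 0 := by
    rw [inner_sub_left, real_inner_self_eq_norm_sq, h.1]
    linarith
  have h2 : 0 < inner ℝ (n' - n) n' := by
    rw [inner_sub_left, real_inner_self_eq_norm_sq, h'.1, real_inner_comm]
    linarith
  obtain ⟨t, ht1, ht2⟩ := ((h.2.1 _ h1).and (h'.2.2 _ h2)).exists
  exact ht2 ht1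

lemma outerNormal_eq {Ω : Set Plane} {p n : Plane} (hp : p ∈ frontier Ω)
    (h : IsOuterNormal Ω p n) : outerNormal Ω p = n := by
  have hex : p ∈ frontier Ω ∧ ∃ n, IsOuterNormal Ω p n := ⟨hp, n, h⟩
  rw [outerNormal, dif_pos hex]
  exact hex.2.choose_spec.eq h

/-! ### The domain, its boundary and its normal inside a chart -/

section Chart

variable {Ω U : Set Plane} {e : Plane ≃ₗᵢ[ℝ] Plane} {f : ℝ → ℝ}

/-- Along a ray in direction `v` the defining function `e₁ - f(e₀)` starts at `0` with derivative
`v₁ - f' v₀` (components in the frame of `e`), a positive multiple of the scalar product of `v` with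
the normal. Its sign decides the side. -/
lemma isOuterNormal_graphNormal (hU : IsOpen U)
    (hΩ : ∀ x ∈ U, (x ∈ Ω ↔ (e x) 1 < f ((e x) 0))) (hf : Differentiable ℝ f) {x : ℝ}
    (hx : graphCurve e f x ∈ U) : IsOuterNormal Ω (graphCurve e f x) (graphNormal e f x) := by
  have hs : 0 < (Real.sqrt (1 + deriv f x ^ 2))⁻¹ := by positivity
  have hin : ∀ v : Plane, ∀ᶠ t : ℝ in 𝓝[>] 0, graphCurve e f x + t • v ∈ U := by
    intro v
    have hc : ContinuousAt (fun t : ℝ => graphCurve e f x + t • v) 0 := by fun_prop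
    apply (hc.eventually (hU.mem_nhds (by simpa using hx))).filter_mono nhdsWithin_le_nhds
  have hd : ∀ v : Plane, HasDerivAt (fun t : ℝ => (e (graphCurve e f x + t • v)) 1 -
      f ((e (graphCurve e f x + t • v)) 0)) ((e v) 1 - deriv f x * (e v) 0) 0 := by
    intro v
    have e1 : ∀ t : ℝ, (e (graphCurve e f x + t • v)) 1 = f x + t * (e v) 1 := by
      intro t
      rw [map_add, map_smul, PiLp.add_apply, PiLp.smul_apply, apply_graphCurve_one, smul_eq_mul]
    have e0 : ∀ t : ℝ, (e (graphCurve e f x + t • v)) 0 = x + t * (e v) 0 := by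
      intro t
      rw [map_add, map_smul, PiLp.add_apply, PiLp.smul_apply, apply_graphCurve_zero, smul_eq_mul]
    simp_rw [e1, e0]
    have h1 : HasDerivAt (fun t : ℝ => f x + t * (e v) 1) ((e v) 1) 0 := by
      simpa using ((hasDerivAt_id (0 : ℝ)).mul_const ((e v) 1)).const_add (f x)
    have h0 : HasDerivAt (fun t : ℝ => x + t * (e v) 0) ((e v) 0) 0 := by
      simpa using ((hasDerivAt_id (0 : ℝ)).mul_const ((e v) 0)).const_add x
    have h2 : HasDerivAt f (deriv f x) (x + 0 * (e v) 0) := by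
      rw [zero_mul, add_zero]
      exact (hf x).hasDerivAt
    exact h1.sub (h2.comp (0 : ℝ) h0)
  have hz : ∀ v : Plane, (e (graphCurve e f x + (0 : ℝ) • v)) 1 -
      f ((e (graphCurve e f x + (0 : ℝ) • v)) 0) = 0 := by
    intro v
    rw [zero_smul, add_zero, apply_graphCurve_zero, apply_graphCurve_one, sub_self]
  have slope_pos : ∀ (g : ℝ → ℝ) (g' : ℝ), HasDerivAt g g' 0 → g 0 = 0 → 0 < g' →
      ∀ᶠ t in 𝓝[>] 0, 0 < g t := by
    intro g g' hg hg0 hpos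
    have ht := (hasDerivAt_iff_tendsto_slope.1 hg).mono_left
      (nhdsWithin_mono (0 : ℝ) (fun t (ht : 0 < t) => ht.ne'))
    filter_upwards [ht.eventually (lt_mem_nhds hpos), self_mem_nhdsWithin] with t h1 h2
    rw [slope_def_field, hg0, sub_zero, sub_zero] at h1
    exact (div_pos_iff_of_pos_right h2).1 h1
  refine ⟨norm_graphNormal x, fun v hv => ?_, fun v hv => ?_⟩
  · rw [inner_graphNormal] at hv
    have hv' := neg_of_mul_neg_right hv hs.le
    filter_upwards [hin v, slope_pos _ _ (hd v).neg (by simpa using congrArg Neg.neg (hz v))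
      (neg_pos.2 hv')] with t h1 h2
    rw [hΩ _ h1]
    simp only [Pi.neg_apply] at h2
    linarith
  · rw [inner_graphNormal] at hv
    have hv' := pos_of_mul_pos_right hv hs.le
    filter_upwards [hin v, slope_pos _ _ (hd v) (hz v) hv'] with t h1 h2
    rw [hΩ _ h1]
    linarith

/-- Off the graph the sign of `e₁ - f(e₀)` is locally constant, which excludes boundary points. A
point of the graph is not in `Ω`, but is approached from `Ω` along the inward normal. -/
lemma mem_frontier_iff_of_chart (hU : IsOpen U)
    (hΩ : ∀ x ∈ U, (x ∈ Ω ↔ (e x) 1 < f ((e x) 0))) (hf : Differentiable ℝ f) {p : Plane}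
    (hp : p ∈ U) : p ∈ frontier Ω ↔ (e p) 1 = f ((e p) 0) := by
  have hfc := hf.continuous
  have hF : Continuous fun x => (e x) 1 - f ((e x) 0) := by fun_prop
  constructor
  · intro h
    by_contra hne
    rcases lt_or_gt_of_ne hne with hlt | hgt
    · refine h.2 (mem_interior_iff_mem_nhds.2 ?_)
      filter_upwards [hU.mem_nhds hp, hF.continuousAt.eventually (gt_mem_nhds (sub_neg.2 hlt))]
        with y h1 h2
      exact (hΩ y h1).2 (sub_neg.1 h2)
    · refine mem_closure_iff_nhds.1 h.1 _ (inter_mem (hU.mem_nhds hp)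
        (hF.continuousAt.eventually (lt_mem_nhds (sub_pos.2 hgt)))) |>.ne_empty ?_
      ext y
      simp only [mem_inter_iff, mem_empty_iff_false, iff_false]
      rintro ⟨⟨h1, h2⟩, h3⟩
      have h2' : 0 < (e y) 1 - f ((e y) 0) := h2
      have := (hΩ y h1).1 h3
      linarith
  · intro h
    obtain ⟨x, rfl⟩ := mem_range_graphCurve.2 h
    have hn := isOuterNormal_graphNormal hU hΩ hf hp
    refine ⟨?_, fun hi => ?_⟩
    · have hneg : inner ℝ (-graphNormal e f x) (graphNormal e f x) < 0 := by
        rw [inner_neg_left, real_inner_self_eq_norm_sq, norm_graphNormal]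
        norm_num
      refine mem_closure_of_tendsto (f := fun t : ℝ => graphCurve e f x + t • -graphNormal e f x)
        (b := 𝓝[>] 0) ?_ (hn.2.1 _ hneg)
      have hc : ContinuousAt (fun t : ℝ => graphCurve e f x + t • -graphNormal e f x) 0 := by
        fun_prop
      simpa using hc.tendsto.mono_left (nhdsWithin_le_nhds (s := Ioi 0))
    · have := (hΩ _ hp).1 (interior_subset hi)
      linarith

lemma frontier_inter_eq_of_chart (hU : IsOpen U)
    (hΩ : ∀ x ∈ U, (x ∈ Ω ↔ (e x) 1 < f ((e x) 0))) (hf : Differentiable ℝ f) :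
    frontier Ω ∩ U = range (graphCurve e f) ∩ U := by
  ext p
  constructor
  · rintro ⟨h1, h2⟩
    exact ⟨mem_range_graphCurve.2 ((mem_frontier_iff_of_chart hU hΩ hf h2).1 h1), h2⟩
  · rintro ⟨h1, h2⟩
    exact ⟨(mem_frontier_iff_of_chart hU hΩ hf h2).2 (mem_range_graphCurve.1 h1), h2⟩

lemma outerNormal_graphCurve (hU : IsOpen U)
    (hΩ : ∀ x ∈ U, (x ∈ Ω ↔ (e x) 1 < f ((e x) 0))) (hf : Differentiable ℝ f) {x : ℝ}
    (hx : graphCurve e f x ∈ U) : outerNormal Ω (graphCurve e f x) = graphNormal e f x :=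
  outerNormal_eq ((mem_frontier_iff_of_chart hU hΩ hf hx).2
    (mem_range_graphCurve.1 (mem_range_self x))) (isOuterNormal_graphNormal hU hΩ hf hx)

lemma bdMeasure_restrict_of_chart (hU : IsOpen U)
    (hΩ : ∀ x ∈ U, (x ∈ Ω ↔ (e x) 1 < f ((e x) 0))) (hf : ContDiff ℝ 1 f) :
    (bdMeasure Ω).restrict U =
      (Measure.map (graphCurve e f)
        (volume.withDensity fun x => ENNReal.ofReal (Real.sqrt (1 + deriv f x ^ 2)))).restrict U := by
  rw [bdMeasure, Measure.restrict_restrict hU.measurableSet, inter_comm,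
    frontier_inter_eq_of_chart hU hΩ (hf.differentiable one_ne_zero), inter_comm,
    ← Measure.restrict_restrict hU.measurableSet, hausdorffMeasure_restrict_range_graphCurve hf]

end Chart

/-! ### Arc length and normal under the global assumptions -/

section Admissible

variable {Ω : Set Plane}

lemma HasC21Boundary.exists_chart (h : HasC21Boundary Ω) {p : Plane} (hp : p ∈ frontier Ω) :
    ∃ (e : Plane ≃ₗᵢ[ℝ] Plane) (f : ℝ → ℝ) (U : Set Plane), ContDiff ℝ 1 f ∧ IsOpen U ∧ p ∈ U ∧
      ∀ x ∈ U, (x ∈ Ω ↔ (e x) 1 < f ((e x) 0)) := by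
  obtain ⟨e, f, hf, -, U, hU, hpU, hΩ⟩ := h p hp
  exact ⟨e, f, U, hf.of_le (by norm_num), hU, hpU, hΩ⟩

lemma norm_outerNormal (h : HasC21Boundary Ω) {p : Plane} (hp : p ∈ frontier Ω) :
    ‖outerNormal Ω p‖ = 1 := by
  obtain ⟨e, f, U, hf, hU, hpU, hΩ⟩ := h.exists_chart hp
  have hd := hf.differentiable one_ne_zero
  obtain ⟨x, rfl⟩ := mem_range_graphCurve.2 ((mem_frontier_iff_of_chart hU hΩ hd hpU).1 hp)
  rw [outerNormal_graphCurve hU hΩ hd hpU, norm_graphNormal]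

/-- Locally the measure is the length of a graph over a bounded interval. Local finiteness is what
puts test functions into `L²(∂Ω)`. -/
lemma isLocallyFiniteMeasure_bdMeasure (h : HasC21Boundary Ω) :
    IsLocallyFiniteMeasure (bdMeasure Ω) := by
  refine ⟨fun p => ?_⟩
  by_cases hp : p ∈ frontier Ω
  · obtain ⟨e, f, U, hf, hU, hpU, hΩ⟩ := h.exists_chart hp
    have hcd : Continuous (deriv f) := hf.continuous_deriv le_rfl
    -- The chart domain may be unbounded; the strip keeps the parameter in a compact interval.
    let W : Set Plane := {q | |(e q) 0 - (e p) 0| < 1}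
    have hW : IsOpen W := by
      apply isOpen_lt (by fun_prop) (by fun_prop)
    refine ⟨U ∩ W, inter_mem (hU.mem_nhds hpU) (hW.mem_nhds (by simp [W])), ?_⟩
    have hm : MeasurableSet (W ∩ U) := (hW.inter hU).measurableSet
    rw [inter_comm, ← Measure.restrict_apply hW.measurableSet, bdMeasure_restrict_of_chart hU hΩ hf,
      Measure.restrict_apply hW.measurableSet,
      (measurableEmbedding_graphCurve hf.continuous).map_apply]
    have hsub : graphCurve e f ⁻¹' (W ∩ U) ⊆ Icc ((e p) 0 - 1) ((e p) 0 + 1) := by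
      rintro x ⟨hx, -⟩
      have hx' : |(e (graphCurve e f x)) 0 - (e p) 0| < 1 := hx
      rw [apply_graphCurve_zero, abs_lt] at hx'
      constructor <;> linarith
    refine (measure_mono hsub).trans_lt ?_
    rw [withDensity_apply _ measurableSet_Icc]
    have : IntegrableOn (fun x => Real.sqrt (1 + deriv f x ^ 2))
        (Icc ((e p) 0 - 1) ((e p) 0 + 1)) := by
      apply ContinuousOn.integrableOn_compact isCompact_Icc
      fun_prop
    exact this.lintegral_lt_top
  · refine ⟨(frontier Ω)ᶜ, isClosed_frontier.isOpen_compl.mem_nhds hp, ?_⟩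
    rw [bdMeasure, Measure.restrict_apply isClosed_frontier.isOpen_compl.measurableSet,
      compl_inter_self, measure_empty]
    exact ENNReal.zero_lt_top

/-- A set of finite one-dimensional Hausdorff measure is null for the two-dimensional one, with
respect to which Lebesgue measure is absolutely continuous. This is what makes weak derivatives on
the closed set `Ωᶜ` unique. -/
lemma volume_frontier (h : HasC21Boundary Ω) : volume (frontier Ω) = 0 := by
  have := isLocallyFiniteMeasure_bdMeasure h
  refine measure_null_of_locally_null _ fun p _ => ?_
  obtain ⟨W, hW, hlt⟩ := (bdMeasure Ω).finiteAt_nhds p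
  refine ⟨W ∩ frontier Ω, inter_comm W _ ▸ inter_mem_nhdsWithin _ hW, ?_⟩
  have h1 : (μH[1] : Measure Plane) (W ∩ frontier Ω) ≠ ⊤ := by
    rw [bdMeasure, Measure.restrict_apply' isClosed_frontier.measurableSet] at hlt
    exact hlt.ne
  have h2 : (μH[(Module.finrank ℝ Plane : ℝ)] : Measure Plane) (W ∩ frontier Ω) = 0 := by
    refine ((Measure.hausdorffMeasure_zero_or_top ?_ _)).resolve_right h1
    simp
  exact Measure.absolutelyContinuous_isAddHaarMeasure _ _ h2

/-- The normal is recovered from the tubular map as `(s - Ψ(δ/2, s)) / (δ/2)`, so it inherits the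
continuity of `Ψ`. -/
lemma continuousOn_outerNormal (h : IsAdmissible Ω) :
    ContinuousOn (outerNormal Ω) (frontier Ω) := by
  obtain ⟨δ, hδ, C, hC, hT⟩ := h.tubularCoordinates
  have hc : ContinuousOn (fun p : Plane => tubular Ω (δ / 2, p)) (frontier Ω) := by
    apply hT.contDiffOn.continuousOn.comp (by fun_prop)
    intro p hp
    exact ⟨⟨by linarith, by linarith⟩, hp⟩
  have h2 : ContinuousOn (fun p : Plane => (δ / 2)⁻¹ • (p - tubular Ω (δ / 2, p))) (frontier Ω) :=
    continuousOn_const.fun_smul (continuousOn_id.fun_sub hc)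
  refine h2.congr fun p _ => ?_
  have : (δ / 2) ≠ 0 := by positivity
  simp only [tubular, sub_sub_cancel]
  rw [inv_smul_smul₀ this]

lemma aestronglyMeasurable_outerNormal (h : IsAdmissible Ω) :
    AEStronglyMeasurable (outerNormal Ω) (bdMeasure Ω) :=
  (continuousOn_outerNormal h).aestronglyMeasurable isClosed_frontier.measurableSet

end Admissible

/-! ### The divergence theorem -/

section Divergence

variable {E : Type*} [NormedAddCommGroup E] [NormedSpace ℝ E]

/-- The shear that maps the lower half-plane to the subgraph of `f`. -/
def shear {f : ℝ → ℝ} (hf : Continuous f) : ℝ × ℝ ≃ₜ ℝ × ℝ where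
  toFun q := (q.1, f q.1 + q.2)
  invFun q := (q.1, q.2 - f q.1)
  left_inv q := by simp
  right_inv q := by simp
  continuous_toFun := by fun_prop
  continuous_invFun := by fun_prop

lemma measurePreserving_shear {f : ℝ → ℝ} (hf : Continuous f) :
    MeasurePreserving (shear hf) volume volume := by
  refine (MeasurePreserving.id volume).skew_product (g := fun x y => f x + y) ?_ ?_
  · exact (by fun_prop : Continuous fun q : ℝ × ℝ => f q.1 + q.2).measurable
  · exact ae_of_all _ fun x => (measurePreserving_add_left volume (f x)).map_eq

lemma integral_halfPlane_fst {H : ℝ × ℝ → E} (hH : ContDiff ℝ 1 H) (hc : HasCompactSupport H) :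
    ∫ q in {q : ℝ × ℝ | q.2 < 0}, fderiv ℝ H q (1, 0) = 0 := by
  have hcont : Continuous fun q => fderiv ℝ H q (1, 0) :=
    (hH.continuous_fderiv one_ne_zero).clm_apply continuous_const
  have hs : {q : ℝ × ℝ | q.2 < 0} = univ ×ˢ Iio 0 := by
    ext q
    simp
  rw [hs, Measure.volume_eq_prod, ← Measure.prod_restrict, Measure.restrict_univ,
    integral_prod_symm _ (hcont.integrable_of_hasCompactSupport (hc.fderiv_apply ℝ _))]
  have : ∀ y : ℝ, ∫ x : ℝ, fderiv ℝ H (x, y) (1, 0) = 0 := by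
    intro y
    have hemb : IsClosedEmbedding fun x : ℝ => (x, y) :=
      Function.LeftInverse.isClosedEmbedding (f := Prod.fst) (fun _ => rfl) (by fun_prop)
        (by fun_prop)
    refine integral_eq_zero_of_hasDerivAt_of_integrable (f := fun x => H (x, y)) (fun x => ?_) ?_ ?_
    · have h1 : HasDerivAt (fun x : ℝ => (x, y)) ((1 : ℝ), (0 : ℝ)) x :=
        (hasDerivAt_id x).prodMk (hasDerivAt_const x y)
      exact ((hH.differentiable one_ne_zero _).hasFDerivAt).comp_hasDerivAt x h1
    · exact (hcont.comp (by fun_prop)).integrable_of_hasCompactSupport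
        ((hc.fderiv_apply ℝ _).comp_isClosedEmbedding hemb)
    · exact (hH.continuous.comp (by fun_prop)).integrable_of_hasCompactSupport
        (hc.comp_isClosedEmbedding hemb)
  simp_rw [this]
  simp

lemma integral_fderiv_eq_zero {g : Plane → E} (hg : ContDiff ℝ 1 g) (hc : HasCompactSupport g) (w : Plane) :
    ∫ p, fderiv ℝ g p w = 0 := by
  have hcont : Continuous fun p => fderiv ℝ g p w :=
    (hg.continuous_fderiv one_ne_zero).clm_apply continuous_const
  have := integral_smul_fderiv_eq_neg_fderiv_smul_of_integrable (μ := (volume : Measure Plane))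
    (f := fun _ => (1 : ℝ)) (g := g) (v := w) (by simp)
    (by simpa using hcont.integrable_of_hasCompactSupport (hc.fderiv_apply ℝ w))
    (by simpa using hg.continuous.integrable_of_hasCompactSupport hc) (by fun_prop)
    (fun x _ => hg.differentiable one_ne_zero x)
  simpa using this

variable [CompleteSpace E]

/-- The fundamental theorem of calculus on each vertical half-line. The weight `φ` depends on the
horizontal variable only; it is there for the coefficient `b - a f'(x)` produced by the shear, and
is never differentiated. -/
lemma integral_halfPlane_snd {H : ℝ × ℝ → E} (hH : ContDiff ℝ 1 H) (hc : HasCompactSupport H)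
    {φ : ℝ → ℝ} (hφ : Continuous φ) :
    ∫ q in {q : ℝ × ℝ | q.2 < 0}, φ q.1 • fderiv ℝ H q (0, 1) = ∫ x, φ x • H (x, 0) := by
  have hcont : Continuous fun q => fderiv ℝ H q (0, 1) :=
    (hH.continuous_fderiv one_ne_zero).clm_apply continuous_const
  have hs : {q : ℝ × ℝ | q.2 < 0} = univ ×ˢ Iio 0 := by
    ext q
    simp
  have hcont' : Continuous fun q : ℝ × ℝ => φ q.1 • fderiv ℝ H q (0, 1) :=
    (hφ.comp continuous_fst).smul hcont
  rw [hs, Measure.volume_eq_prod, ← Measure.prod_restrict, Measure.restrict_univ,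
    integral_prod _ (hcont'.integrable_of_hasCompactSupport
      ((hc.fderiv_apply ℝ _).smul_left (f := fun q : ℝ × ℝ => φ q.1)))]
  refine integral_congr_ae (ae_of_all _ fun x => ?_)
  simp only
  rw [integral_smul]
  congr 1
  have hemb : IsClosedEmbedding fun y : ℝ => (x, y) :=
    Function.LeftInverse.isClosedEmbedding (f := Prod.snd) (fun _ => rfl) (by fun_prop)
      (by fun_prop)
  have hd : ∀ y, fderiv ℝ H (x, y) (0, 1) = deriv (fun y => H (x, y)) y := by
    intro y
    have h1 : HasDerivAt (fun y : ℝ => (x, y)) ((0 : ℝ), (1 : ℝ)) y :=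
      (hasDerivAt_const y x).prodMk (hasDerivAt_id y)
    exact (((hH.differentiable one_ne_zero _).hasFDerivAt).comp_hasDerivAt y h1).deriv.symm
  simp_rw [hd]
  rw [← integral_Iic_eq_integral_Iio]
  exact HasCompactSupport.integral_Iic_deriv_eq (hH.comp (by fun_prop))
    (hc.comp_isClosedEmbedding hemb) 0

/-- The measure-preserving shear flattens the subgraph and turns the direction `(a, b)` into `(a, b
- a f')`. The horizontal part integrates to zero and the vertical part leaves the boundary term. -/
lemma integral_subgraph_fderiv {f : ℝ → ℝ} (hf : ContDiff ℝ 1 f) {G : ℝ × ℝ → E}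
    (hG : ContDiff ℝ 1 G) (hc : HasCompactSupport G) (a b : ℝ) :
    ∫ q in {q : ℝ × ℝ | q.2 < f q.1}, fderiv ℝ G q (a, b) =
      ∫ x, (b - a * deriv f x) • G (x, f x) := by
  have hfd := hf.differentiable one_ne_zero
  have hf'c : Continuous (deriv f) := hf.continuous_deriv le_rfl
  set S := shear hf.continuous with hS
  set H : ℝ × ℝ → E := fun q => G (q.1, f q.1 + q.2) with hHdef
  have hH : ContDiff ℝ 1 H :=
    hG.comp (contDiff_fst.prodMk ((hf.comp contDiff_fst).add contDiff_snd))
  have hHc : HasCompactSupport H := hc.comp_homeomorph S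
  have hchain : ∀ q : ℝ × ℝ, ∀ v : ℝ × ℝ, fderiv ℝ H q v =
      fderiv ℝ G (S q) (v.1, deriv f q.1 * v.1 + v.2) := by
    intro q v
    have h1 : HasFDerivAt (fun q : ℝ × ℝ => f q.1)
        ((deriv f q.1) • ContinuousLinearMap.fst ℝ ℝ ℝ) q :=
      (hfd q.1).hasDerivAt.comp_hasFDerivAt q hasFDerivAt_fst
    have h2 : HasFDerivAt (fun q : ℝ × ℝ => (q.1, f q.1 + q.2)) _ q :=
      hasFDerivAt_fst.prodMk (h1.add hasFDerivAt_snd)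
    have h3 : HasFDerivAt G (fderiv ℝ G (S q)) ((fun q : ℝ × ℝ => (q.1, f q.1 + q.2)) q) :=
      (hG.differentiable one_ne_zero _).hasFDerivAt
    have h4 := (h3.comp q h2).fderiv
    change fderiv ℝ H q = _ at h4
    rw [h4]
    simp
  have hdec : ∀ q : ℝ × ℝ, fderiv ℝ G (S q) (a, b) =
      a • fderiv ℝ H q (1, 0) + (b - a * deriv f q.1) • fderiv ℝ H q (0, 1) := by
    intro q
    rw [← map_smul, ← map_smul, ← map_add, hchain]
    congr 1
    ext <;> simp
    ring
  have hpre : S ⁻¹' {q : ℝ × ℝ | q.2 < f q.1} = {q : ℝ × ℝ | q.2 < 0} := by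
    ext q
    simp [hS, shear]
  have hcd : ∀ v : ℝ × ℝ, Continuous fun q => fderiv ℝ H q v := fun v =>
    (hH.continuous_fderiv one_ne_zero).clm_apply continuous_const
  rw [← (measurePreserving_shear hf.continuous).setIntegral_preimage_emb
    (shear hf.continuous).measurableEmbedding, ← hS, hpre]
  simp_rw [hdec]
  rw [integral_add, integral_smul, integral_halfPlane_fst hH hHc, smul_zero, zero_add,
    integral_halfPlane_snd hH hHc (φ := fun x => b - a * deriv f x) (by fun_prop)]
  · simp [hHdef]
  · exact (((hcd _).const_smul a).integrable_of_hasCompactSupport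
      ((hHc.fderiv_apply ℝ _).smul_left (f := fun _ => a))).integrableOn
  · have hφ : Continuous fun q : ℝ × ℝ => b - a * deriv f q.1 := by fun_prop
    exact ((hφ.smul (hcd _)).integrable_of_hasCompactSupport
      ((hHc.fderiv_apply ℝ _).smul_left (f := fun q : ℝ × ℝ => b - a * deriv f q.1))).integrableOn

/-- The coordinates `p ↦ ((e p)₀, (e p)₁)`. -/
def coordEquiv (e : Plane ≃ₗᵢ[ℝ] Plane) : Plane ≃ᵐ ℝ × ℝ :=
  e.toMeasurableEquiv.trans
    ((MeasurableEquiv.toLp 2 (Fin 2 → ℝ)).symm.trans MeasurableEquiv.finTwoArrow)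

lemma coordEquiv_apply (e : Plane ≃ₗᵢ[ℝ] Plane) (p : Plane) :
    coordEquiv e p = ((e p) 0, (e p) 1) := rfl

lemma measurePreserving_coordEquiv (e : Plane ≃ₗᵢ[ℝ] Plane) :
    MeasurePreserving (coordEquiv e) volume volume :=
  (volume_preserving_finTwoArrow ℝ).comp
    ((EuclideanSpace.volume_preserving_symm_measurableEquiv_toLp (Fin 2)).comp
      e.measurePreserving)

/-- The inverse coordinates `(x, y) ↦ x e₀ + y e₁`. -/
def ofCoord (e : Plane ≃ₗᵢ[ℝ] Plane) : ℝ × ℝ →L[ℝ] Plane :=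
  (ContinuousLinearMap.fst ℝ ℝ ℝ).smulRight (frame e 0) +
    (ContinuousLinearMap.snd ℝ ℝ ℝ).smulRight (frame e 1)

lemma ofCoord_apply (e : Plane ≃ₗᵢ[ℝ] Plane) (q : ℝ × ℝ) :
    ofCoord e q = q.1 • frame e 0 + q.2 • frame e 1 := rfl

lemma ofCoord_coordEquiv (e : Plane ≃ₗᵢ[ℝ] Plane) (p : Plane) :
    ofCoord e (coordEquiv e p) = p := (eq_combination e p).symm

lemma isClosedEmbedding_ofCoord (e : Plane ≃ₗᵢ[ℝ] Plane) : IsClosedEmbedding (ofCoord e) := by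
  have hker : Function.Injective (ofCoord e) := by
    intro q q' h
    have h0 : e (ofCoord e q) 0 = e (ofCoord e q') 0 := by rw [h]
    have h1 : e (ofCoord e q) 1 = e (ofCoord e q') 1 := by rw [h]
    rw [ofCoord_apply, ofCoord_apply, apply_combination_zero, apply_combination_zero] at h0
    rw [ofCoord_apply, ofCoord_apply, apply_combination_one, apply_combination_one] at h1
    exact Prod.ext h0 h1
  exact LinearMap.isClosedEmbedding_of_injective (f := (ofCoord e).toLinearMap)
    (LinearMap.ker_eq_bot.2 hker)

lemma integral_fderiv_of_subgraph (e : Plane ≃ₗᵢ[ℝ] Plane) {f : ℝ → ℝ} (hf : ContDiff ℝ 1 f)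
    {g : Plane → E} (hg : ContDiff ℝ 1 g) (hc : HasCompactSupport g) (w : Plane) :
    ∫ p in {p : Plane | (e p) 1 < f ((e p) 0)}, fderiv ℝ g p w =
      ∫ x, ((e w) 1 - (e w) 0 * deriv f x) • g (graphCurve e f x) := by
  have hG : ContDiff ℝ 1 fun q => g (ofCoord e q) := hg.comp (ofCoord e).contDiff
  have h := integral_subgraph_fderiv hf hG
    (hc.comp_isClosedEmbedding (isClosedEmbedding_ofCoord e)) ((e w) 0) ((e w) 1)
  rw [← (measurePreserving_coordEquiv e).setIntegral_preimage_emb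
    (coordEquiv e).measurableEmbedding] at h
  have hchain : ∀ p, fderiv ℝ (fun q => g (ofCoord e q)) (coordEquiv e p) ((e w) 0, (e w) 1) =
      fderiv ℝ g p w := by
    intro p
    have h1 : HasFDerivAt g (fderiv ℝ g p) (ofCoord e (coordEquiv e p)) := by
      rw [ofCoord_coordEquiv]
      exact (hg.differentiable one_ne_zero p).hasFDerivAt
    have h2 := (h1.comp (coordEquiv e p) (ofCoord e).hasFDerivAt).fderiv
    change fderiv ℝ (fun q => g (ofCoord e q)) (coordEquiv e p) = _ at h2
    rw [h2, ContinuousLinearMap.comp_apply, ← coordEquiv_apply, ofCoord_coordEquiv]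
  simp_rw [hchain] at h
  exact h

/-- The divergence theorem for functions supported in a chart. -/
lemma integral_fderiv_eq_of_chart {Ω U : Set Plane} {e : Plane ≃ₗᵢ[ℝ] Plane} {f : ℝ → ℝ}
    (hΩo : IsOpen Ω) (hU : IsOpen U) (hΩ : ∀ x ∈ U, (x ∈ Ω ↔ (e x) 1 < f ((e x) 0)))
    (hf : ContDiff ℝ 1 f) {g : Plane → E} (hg : ContDiff ℝ 1 g) (hc : HasCompactSupport g)
    (hgU : tsupport g ⊆ U) (w : Plane) :
    ∫ p in Ω, fderiv ℝ g p w =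
      ∫ p, (inner ℝ (outerNormal Ω p) w : ℝ) • g p ∂(bdMeasure Ω) := by
  have hd := hf.differentiable one_ne_zero
  have hfc := hf.continuous
  have hV : MeasurableSet {p : Plane | (e p) 1 < f ((e p) 0)} :=
    (isOpen_lt (by fun_prop) (by fun_prop)).measurableSet
  have hz : ∀ p ∉ U, g p = 0 := fun p hp => image_eq_zero_of_notMem_tsupport fun h => hp (hgU h)
  have hz' : ∀ p ∉ U, fderiv ℝ g p w = 0 := by
    intro p hp
    have : fderiv ℝ g p = 0 := by
      by_contra hne
      exact hp (hgU (support_fderiv_subset ℝ hne))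
    rw [this]
    rfl
  have hL : ∫ p in Ω, fderiv ℝ g p w =
      ∫ p in {p : Plane | (e p) 1 < f ((e p) 0)}, fderiv ℝ g p w := by
    rw [← integral_indicator hΩo.measurableSet, ← integral_indicator hV]
    congr 1
    ext p
    by_cases hp : p ∈ U
    · have hiff : p ∈ Ω ↔ p ∈ {p : Plane | (e p) 1 < f ((e p) 0)} := hΩ p hp
      by_cases hpΩ : p ∈ Ω
      · rw [indicator_of_mem hpΩ, indicator_of_mem (hiff.1 hpΩ)]
      · rw [indicator_of_notMem hpΩ, indicator_of_notMem (mt hiff.2 hpΩ)]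
    · have h0 : ∀ A : Set Plane, A.indicator (fun p => fderiv ℝ g p w) p = 0 := fun A =>
        indicator_apply_eq_zero.2 fun _ => hz' p hp
      rw [h0, h0]
  have hR : ∀ μ : Measure Plane, ∫ p, (inner ℝ (outerNormal Ω p) w : ℝ) • g p ∂μ =
      ∫ p, (inner ℝ (outerNormal Ω p) w : ℝ) • g p ∂(μ.restrict U) := by
    intro μ
    rw [setIntegral_eq_integral_of_forall_compl_eq_zero]
    intro p hp
    rw [hz p hp, smul_zero]
  have hm : Measurable fun x => ENNReal.ofReal (Real.sqrt (1 + deriv f x ^ 2)) := by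
    have := (hf.continuous_deriv le_rfl)
    exact (by fun_prop : Continuous fun x => Real.sqrt (1 + deriv f x ^ 2)).measurable.ennreal_ofReal
  -- Since `g` vanishes off `U`, one may restrict to `U`, exchange there the boundary measure for
  -- the length element of the graph, and remove the restriction again.
  rw [hL, integral_fderiv_of_subgraph e hf hg hc w, hR, bdMeasure_restrict_of_chart hU hΩ hf, ← hR,
    (measurableEmbedding_graphCurve hfc).integral_map,
    integral_withDensity_eq_integral_toReal_smul hm (ae_of_all _ fun x => ENNReal.ofReal_lt_top)]
  refine integral_congr_ae (ae_of_all _ fun x => ?_)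
  simp only
  by_cases hx : graphCurve e f x ∈ U
  -- The normalizing factor of the normal cancels the length density.
  · rw [outerNormal_graphCurve hU hΩ hd hx, real_inner_comm, inner_graphNormal,
      ENNReal.toReal_ofReal (Real.sqrt_nonneg _), smul_smul, ← mul_assoc]
    have : Real.sqrt (1 + deriv f x ^ 2) ≠ 0 := by positivity
    rw [mul_inv_cancel₀ this, one_mul, mul_comm (deriv f x)]
  · rw [hz _ hx]
    simp

/-- The divergence theorem on `Ω` for compactly supported `C¹` functions. -/
theorem integral_fderiv_eq_boundary {Ω : Set Plane} (hΩo : IsOpen Ω) (hΩ : HasC21Boundary Ω)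
    (hn : AEStronglyMeasurable (outerNormal Ω) (bdMeasure Ω))
    {g : Plane → E} (hg : ContDiff ℝ 1 g) (hc : HasCompactSupport g) (w : Plane) :
    ∫ p in Ω, fderiv ℝ g p w =
      ∫ p, (inner ℝ (outerNormal Ω p) w : ℝ) • g p ∂(bdMeasure Ω) := by
  have := isLocallyFiniteMeasure_bdMeasure hΩ
  have hint : ∀ g : Plane → E, ContDiff ℝ 1 g → HasCompactSupport g →
      Integrable (fun p => fderiv ℝ g p w) (volume.restrict Ω) ∧
      Integrable (fun p => (inner ℝ (outerNormal Ω p) w : ℝ) • g p) (bdMeasure Ω) := by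
    intro g hg hc
    refine ⟨((hg.continuous_fderiv one_ne_zero).clm_apply
      continuous_const).integrable_of_hasCompactSupport (hc.fderiv_apply ℝ w), ?_⟩
    refine (hg.continuous.integrable_of_hasCompactSupport hc).bdd_smul ‖w‖
      (hn.inner aestronglyMeasurable_const) ?_
    refine (ae_restrict_iff' isClosed_frontier.measurableSet).2 (ae_of_all _ fun p hp => ?_)
    refine (norm_inner_le_norm _ _).trans ?_
    rw [norm_outerNormal hΩ hp, one_mul]
  suffices h : ∃ V : Set Plane, IsOpen V ∧ tsupport g ⊆ V ∧ ∀ g : Plane → E, ContDiff ℝ 1 g →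
      HasCompactSupport g → tsupport g ⊆ V → ∫ p in Ω, fderiv ℝ g p w =
      ∫ p, (inner ℝ (outerNormal Ω p) w : ℝ) • g p ∂(bdMeasure Ω) by
    obtain ⟨V, -, hV, h⟩ := h
    exact h g hg hc hV
  -- Induction over the compact support replaces a partition of unity: the sets `K` with a
  -- neighbourhood `V` such that the formula holds for all functions supported in `V` are stable
  -- under unions.
  refine IsCompact.induction_on hc.isCompact (p := fun K => ∃ V : Set Plane, IsOpen V ∧ K ⊆ V ∧
    ∀ g : Plane → E, ContDiff ℝ 1 g → HasCompactSupport g → tsupport g ⊆ V →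
      ∫ p in Ω, fderiv ℝ g p w =
        ∫ p, (inner ℝ (outerNormal Ω p) w : ℝ) • g p ∂(bdMeasure Ω)) ?_ ?_ ?_ ?_
  · refine ⟨∅, isOpen_empty, Subset.rfl, fun g _ _ hs => ?_⟩
    have : g = 0 := by
      rw [← Function.support_eq_empty_iff]
      exact subset_empty_iff.1 ((subset_tsupport g).trans hs)
    subst this
    simp
  · rintro s t hst ⟨V, hV, htV, h⟩
    exact ⟨V, hV, hst.trans htV, h⟩
  · rintro s t ⟨V₁, hV₁, hs, h₁⟩ ⟨V₂, hV₂, ht, h₂⟩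
    refine ⟨V₁ ∪ V₂, hV₁.union hV₂, union_subset_union hs ht, fun g hg hc hsub => ?_⟩
    -- The cut-off is `0` near the complement of `V₂` and `1` near the part of the support outside
    -- `V₁`; hence `(1 - χ) g` lives in `V₁` and `χ g` in `V₂`.
    obtain ⟨χ, hχ0, hχ1, -⟩ := exists_contMDiffMap_zero_one_nhds_of_isClosed (n := 1) 𝓘(ℝ, Plane)
      (s := V₂ᶜ) (t := tsupport g \ V₁) hV₂.isClosed_compl
      ((isClosed_tsupport g).sdiff hV₁) (by
        rw [Set.disjoint_left]
        rintro x hx ⟨hx1, hx2⟩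
        exact (hsub hx1).elim hx2 hx)
    have hχ : ContDiff ℝ 1 χ := χ.contMDiff.contDiff
    have hg1 : ContDiff ℝ 1 fun p => (1 - χ p) • g p := (contDiff_const.sub hχ).smul hg
    have hg2 : ContDiff ℝ 1 fun p => χ p • g p := hχ.smul hg
    have hc1 : HasCompactSupport fun p => (1 - χ p) • g p := hc.smul_left
    have hc2 : HasCompactSupport fun p => χ p • g p := hc.smul_left
    have hs1 : tsupport (fun p => (1 - χ p) • g p) ⊆ V₁ := by
      intro x hx
      by_contra hx1
      have hxg : x ∈ tsupport g := tsupport_smul_subset_right _ _ hx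
      have hev := eventually_nhdsSet_iff_forall.1 hχ1 x ⟨hxg, hx1⟩
      refine notMem_tsupport_iff_eventuallyEq.2 ?_ hx
      filter_upwards [hev] with y hy
      simp [hy]
    have hs2 : tsupport (fun p => χ p • g p) ⊆ V₂ := by
      intro x hx
      by_contra hx1
      have hev := eventually_nhdsSet_iff_forall.1 hχ0 x hx1
      refine notMem_tsupport_iff_eventuallyEq.2 ?_ hx
      filter_upwards [hev] with y hy
      simp [hy]
    have e : g = fun p => (1 - χ p) • g p + χ p • g p := by
      ext p
      rw [← add_smul, sub_add_cancel, one_smul]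
    have ed : ∀ p, fderiv ℝ g p w =
        fderiv ℝ (fun p => (1 - χ p) • g p) p w + fderiv ℝ (fun p => χ p • g p) p w := by
      intro p
      rw [← add_apply, ← fderiv_fun_add (hg1.differentiable one_ne_zero p)
        (hg2.differentiable one_ne_zero p), ← e]
    have eb : ∀ p, (inner ℝ (outerNormal Ω p) w : ℝ) • g p =
        (inner ℝ (outerNormal Ω p) w : ℝ) • ((1 - χ p) • g p) +
        (inner ℝ (outerNormal Ω p) w : ℝ) • (χ p • g p) := by
      intro p
      rw [← smul_add, ← congrFun e p]
    simp_rw [ed, eb]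
    rw [integral_add (hint _ hg1 hc1).1 (hint _ hg2 hc2).1,
      integral_add (hint _ hg1 hc1).2 (hint _ hg2 hc2).2, h₁ _ hg1 hc1 hs1, h₂ _ hg2 hc2 hs2]
  · intro p _
    suffices h : ∃ V : Set Plane, IsOpen V ∧ p ∈ V ∧ ∀ g : Plane → E, ContDiff ℝ 1 g →
        HasCompactSupport g → tsupport g ⊆ V → ∫ p in Ω, fderiv ℝ g p w =
        ∫ p, (inner ℝ (outerNormal Ω p) w : ℝ) • g p ∂(bdMeasure Ω) by
      obtain ⟨V, hV, hpV, h⟩ := h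
      exact ⟨V, mem_nhdsWithin_of_mem_nhds (hV.mem_nhds hpV), V, hV, Subset.rfl, h⟩
    by_cases hp : p ∈ frontier Ω
    · obtain ⟨e, f, U, hf, hU, hpU, hch⟩ := hΩ.exists_chart hp
      exact ⟨U, hU, hpU, fun g hg hc hs => integral_fderiv_eq_of_chart hΩo hU hch hf hg hc hs w⟩
    · have hR : ∀ g : Plane → E, tsupport g ∩ frontier Ω = ∅ →
          ∫ p, (inner ℝ (outerNormal Ω p) w : ℝ) • g p ∂(bdMeasure Ω) = 0 := by
        intro g hg
        refine setIntegral_eq_zero_of_forall_eq_zero fun q hq => ?_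
        rw [image_eq_zero_of_notMem_tsupport fun h => (hg ▸ ⟨h, hq⟩ : q ∈ (∅ : Set Plane)),
          smul_zero]
      by_cases hpΩ : p ∈ Ω
      · refine ⟨Ω, hΩo, hpΩ, fun g hg hc hs => ?_⟩
        rw [hR g, setIntegral_eq_integral_of_forall_compl_eq_zero, integral_fderiv_eq_zero hg hc]
        · intro q hq
          have : fderiv ℝ g q = 0 := by
            by_contra hne
            exact hq (hs (support_fderiv_subset ℝ hne))
          rw [this]
          rfl
        · refine subset_empty_iff.1 ((inter_subset_inter_left _ hs).trans ?_)
          rw [hΩo.inter_frontier_eq]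
      · have hcl : p ∉ closure Ω := fun h => hp ⟨h, fun hi => hpΩ (interior_subset hi)⟩
        refine ⟨(closure Ω)ᶜ, isClosed_closure.isOpen_compl, hcl, fun g hg hc hs => ?_⟩
        rw [hR g]
        · refine setIntegral_eq_zero_of_forall_eq_zero fun q hq => ?_
          have : fderiv ℝ g q = 0 := by
            by_contra hne
            exact hs (support_fderiv_subset ℝ hne) (subset_closure hq)
          rw [this]
          rfl
        · refine subset_empty_iff.1 fun q hq => hs hq.1 (frontier_subset_closure hq.2)

end Divergence

/-! ### Trace inequality -/

/-- The linear map `ℝ × ℝ → ℝ × ℝ` with columns `a` and `b`. -/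
def columnsCLM (a b : ℝ × ℝ) : ℝ × ℝ →L[ℝ] ℝ × ℝ :=
  (Matrix.toLin (Module.Basis.finTwoProd ℝ) (Module.Basis.finTwoProd ℝ)
    !![a.1, b.1; a.2, b.2]).toContinuousLinearMap

lemma columnsCLM_apply (a b q : ℝ × ℝ) : columnsCLM a b q = q.1 • a + q.2 • b := by
  simp only [columnsCLM, LinearMap.coe_toContinuousLinearMap', Matrix.toLin_finTwoProd_apply]
  ext <;> simp <;> ring

lemma det_columnsCLM (a b : ℝ × ℝ) : (columnsCLM a b).det = a.1 * b.2 - a.2 * b.1 := by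
  rw [columnsCLM, ContinuousLinearMap.det, LinearMap.coe_toContinuousLinearMap,
    LinearMap.det_toLin, Matrix.det_fin_two_of]
  ring

lemma eq_smul_tangent {v n : Plane} (hn : ‖n‖ = 1) (h : inner ℝ v n = 0) :
    v = (v 1 * n 0 - v 0 * n 1) • !₂[-n 1, n 0] := by
  have h1 : v 0 * n 0 + v 1 * n 1 = 0 := by
    rw [PiLp.inner_apply, Fin.sum_univ_two] at h
    simpa [mul_comm] using h
  have h2 : n 0 ^ 2 + n 1 ^ 2 = 1 := by
    have := EuclideanSpace.norm_sq_eq n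
    rw [hn, Fin.sum_univ_two] at this
    simpa using this.symm
  ext j
  fin_cases j
  · simp
    linear_combination (-v 0) * h2 + (n 0) * h1
  · simp
    linear_combination (-v 1) * h2 + (n 1) * h1

lemma norm_tangent {n : Plane} (hn : ‖n‖ = 1) : ‖(!₂[-n 1, n 0] : Plane)‖ = 1 := by
  rw [EuclideanSpace.norm_eq, Fin.sum_univ_two] at hn ⊢
  simpa [add_comm] using hn

section Tube

variable {Ω U : Set Plane} {e : Plane ≃ₗᵢ[ℝ] Plane} {f : ℝ → ℝ} {δ C : ℝ}

/-- The tubular map in the coordinates of a chart. -/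
def tubeCoord (Ω : Set Plane) (e : Plane ≃ₗᵢ[ℝ] Plane) (f : ℝ → ℝ) (q : ℝ × ℝ) : ℝ × ℝ :=
  coordEquiv (LinearIsometryEquiv.refl ℝ Plane) (tubular Ω (q.1, graphCurve e f q.2))

/-- The velocity of the curve is orthogonal to the normal, hence `c` times the unit tangent with
`|c|` the length density. The determinant is therefore `c` times the tubular Jacobian, which is
bounded below by `C⁻¹` in absolute value. The derivative is taken within `S` because `Ψ` is
differentiable only within the tube `]-δ, δ[ × ∂Ω`. -/
lemma exists_hasFDerivWithinAt_tubeCoord (hT : HasTubularCoordinates Ω δ C) (hC : 0 < C)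
    (hU : IsOpen U) (hΩ : ∀ x ∈ U, (x ∈ Ω ↔ (e x) 1 < f ((e x) 0))) (hf : Differentiable ℝ f)
    {S : Set (ℝ × ℝ)} (hS : ∀ q ∈ S, q.1 ∈ Ioo (-δ) δ ∧ graphCurve e f q.2 ∈ U)
    {q : ℝ × ℝ} (hq : q ∈ S) : ∃ L : ℝ × ℝ →L[ℝ] ℝ × ℝ, HasFDerivWithinAt (tubeCoord Ω e f) L S q ∧
      Real.sqrt (1 + deriv f q.2 ^ 2) ≤ C * |L.det| := by
  have hfr : ∀ q ∈ S, graphCurve e f q.2 ∈ frontier Ω := fun q hq =>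
    (mem_frontier_iff_of_chart hU hΩ hf (hS q hq).2).2 (mem_range_graphCurve.1 (mem_range_self _))
  have hsrc : (q.1, graphCurve e f q.2) ∈ tubeSource Ω δ := ⟨(hS q hq).1, hfr q hq⟩
  have hmaps : MapsTo (fun q : ℝ × ℝ => (q.1, graphCurve e f q.2)) S (tubeSource Ω δ) :=
    fun q hq => ⟨(hS q hq).1, hfr q hq⟩
  set n := outerNormal Ω (graphCurve e f q.2) with hn
  have hng : n = graphNormal e f q.2 := outerNormal_graphCurve hU hΩ hf (hS q hq).2
  have hn1 : ‖n‖ = 1 := by rw [hng, norm_graphNormal]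
  set γ' := deriv (graphCurve e f) q.2 with hγ'
  have horth : inner ℝ γ' n = 0 := by
    have h0 : e (frame e 0 + deriv f q.2 • frame e 1) 0 = 1 := by
      simpa using apply_combination_zero e 1 (deriv f q.2)
    have h1 : e (frame e 0 + deriv f q.2 • frame e 1) 1 = deriv f q.2 := by
      simpa using apply_combination_one e 1 (deriv f q.2)
    rw [hng, inner_graphNormal, hγ', deriv_graphCurve hf, h0, h1]
    ring
  set c := γ' 1 * n 0 - γ' 0 * n 1 with hc
  have hγc : γ' = c • bdTangent Ω (graphCurve e f q.2) := eq_smul_tangent hn1 horth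
  have hcn : |c| = Real.sqrt (1 + deriv f q.2 ^ 2) := by
    rw [← norm_deriv_graphCurve (e := e) hf, ← hγ', hγc, norm_smul, bdTangent, norm_tangent hn1,
      mul_one, Real.norm_eq_abs]
  set D := fderivWithin ℝ (tubular Ω) (tubeSource Ω δ) (q.1, graphCurve e f q.2) with hD
  have hDd : HasFDerivWithinAt (tubular Ω) D (tubeSource Ω δ) (q.1, graphCurve e f q.2) :=
    (hT.contDiffOn.differentiableOn one_ne_zero _ hsrc).hasFDerivWithinAt
  have hcurve : HasFDerivAt (fun q : ℝ × ℝ => (q.1, graphCurve e f q.2))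
      ((ContinuousLinearMap.fst ℝ ℝ ℝ).prod
        ((ContinuousLinearMap.toSpanSingleton ℝ γ').comp (ContinuousLinearMap.snd ℝ ℝ ℝ))) q := by
    refine hasFDerivAt_fst.prodMk ?_
    have h1 : HasDerivAt (graphCurve e f) γ' q.2 :=
      (hasDerivAt_graphCurve (hf q.2).hasDerivAt).differentiableAt.hasDerivAt
    exact h1.hasFDerivAt.comp q hasFDerivAt_snd
  have hcomp := hDd.comp q (hcurve.hasFDerivWithinAt (s := S)) hmaps
  set P : Plane →L[ℝ] ℝ × ℝ := (EuclideanSpace.proj (𝕜 := ℝ) (0 : Fin 2)).prod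
    (EuclideanSpace.proj (𝕜 := ℝ) (1 : Fin 2)) with hP
  have hfin := P.hasFDerivAt.comp_hasFDerivWithinAt q hcomp
  set a := P (D (1, 0)) with ha
  set b := P (D (0, bdTangent Ω (graphCurve e f q.2))) with hb
  refine ⟨columnsCLM a (c • b), ?_, ?_⟩
  · refine (hfin.congr_fderiv ?_)
    apply ContinuousLinearMap.ext
    intro v
    rw [columnsCLM_apply, ha, hb, ← map_smul, ← map_smul, ← map_smul, ← map_smul, ← map_smul,
      ← map_smul, ← map_add, ← map_add, Prod.smul_mk, Prod.smul_mk, Prod.smul_mk, ← hγc]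
    simp
  · have hJ : a.1 * b.2 - a.2 * b.1 = tubularJacobian Ω δ (q.1, graphCurve e f q.2) := rfl
    have hlt := hT.lt_jacobian _ hsrc
    have h1 : 1 ≤ C * |tubularJacobian Ω δ (q.1, graphCurve e f q.2)| := by
      rw [inv_lt_iff_one_lt_mul₀ hC] at hlt
      rw [mul_comm]
      exact hlt.le
    have hdet : (columnsCLM a (c • b)).det =
        c * tubularJacobian Ω δ (q.1, graphCurve e f q.2) := by
      rw [det_columnsCLM, ← hJ, Prod.smul_fst, Prod.smul_snd, smul_eq_mul, smul_eq_mul]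
      ring
    rw [hdet, abs_mul, hcn]
    have := mul_le_mul_of_nonneg_left h1 (Real.sqrt_nonneg (1 + deriv f q.2 ^ 2))
    linarith

lemma injOn_tubular (hT : HasTubularCoordinates Ω δ C) : InjOn (tubular Ω) (tubeSource Ω δ) := by
  obtain ⟨Φ, -, h⟩ := hT.exists_inverse
  exact h.injOn

/-- Change of variables: the length density is at most `C` times the determinant, and the map is
injective since `Ψ` is. Allowing every measurable `A` in the chart makes this an inequality of
measures, which can be glued. -/
lemma lintegral_tube_le_of_chart (hT : HasTubularCoordinates Ω δ C) (hC : 0 < C)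
    (hU : IsOpen U) (hΩ : ∀ x ∈ U, (x ∈ Ω ↔ (e x) 1 < f ((e x) 0))) (hf : ContDiff ℝ 1 f)
    {F : Plane → ℝ≥0∞} (hF : Continuous F) {A : Set Plane} (hA : MeasurableSet A) (hAU : A ⊆ U) :
    ∫⁻ p in A, (∫⁻ t in Ioo 0 δ, F (tubular Ω (t, p))) ∂(bdMeasure Ω) ≤
      ENNReal.ofReal C * ∫⁻ x in tubular Ω '' (Ioo 0 δ ×ˢ (A ∩ frontier Ω)), F x := by
  have hd := hf.differentiable one_ne_zero
  have hfc := hf.continuous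
  have hf'c : Continuous (deriv f) := hf.continuous_deriv le_rfl
  have hγm : MeasurableEmbedding (graphCurve e f) := measurableEmbedding_graphCurve hfc
  have hγc : Continuous (graphCurve e f) := (contDiff_graphCurve hf).continuous
  set ρ : ℝ → ℝ≥0∞ := fun x => ENNReal.ofReal (Real.sqrt (1 + deriv f x ^ 2)) with hρ
  have hρc : Continuous ρ := by
    apply ENNReal.continuous_ofReal.comp
    fun_prop
  set B := graphCurve e f ⁻¹' A with hB
  have hBm : MeasurableSet B := hγm.measurable hA
  have hBf : ∀ x ∈ B, graphCurve e f x ∈ frontier Ω := fun x hx =>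
    (mem_frontier_iff_of_chart hU hΩ hd (hAU hx)).2 (mem_range_graphCurve.1 (mem_range_self _))
  have hSm : MeasurableSet (Ioo 0 δ ×ˢ B) := measurableSet_Ioo.prod hBm
  have hS : ∀ q ∈ Ioo 0 δ ×ˢ B, q.1 ∈ Ioo (-δ) δ ∧ graphCurve e f q.2 ∈ U := by
    rintro q ⟨h1, h2⟩
    exact ⟨⟨by linarith [h1.1, h1.2], h1.2⟩, hAU h2⟩
  have hmaps : MapsTo (fun q : ℝ × ℝ => (q.1, graphCurve e f q.2)) (Ioo 0 δ ×ˢ B)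
      (tubeSource Ω δ) := fun q hq => ⟨(hS q hq).1, hBf _ hq.2⟩
  have hrestr : (bdMeasure Ω).restrict A =
      Measure.map (graphCurve e f) ((volume.restrict B).withDensity ρ) := by
    have : (bdMeasure Ω).restrict A = ((bdMeasure Ω).restrict U).restrict A := by
      rw [Measure.restrict_restrict (μ := bdMeasure Ω) (t := U) hA, inter_eq_left.2 hAU]
    rw [this, bdMeasure_restrict_of_chart hU hΩ hf, Measure.restrict_restrict hA,
      inter_eq_left.2 hAU, hγm.restrict_map, restrict_withDensity hBm]
  have hmeas : AEMeasurable (fun q : ℝ × ℝ => ρ q.2 * F (tubular Ω (q.1, graphCurve e f q.2)))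
      ((volume.restrict (Ioo 0 δ)).prod (volume.restrict B)) := by
    refine (hρc.comp continuous_snd).measurable.aemeasurable.mul ?_
    rw [Measure.prod_restrict]
    exact (hF.comp_continuousOn
      (hT.contDiffOn.continuousOn.comp (by fun_prop) hmaps)).aemeasurable hSm
  choose! L hL hdet using fun q (hq : q ∈ Ioo 0 δ ×ˢ B) =>
    exists_hasFDerivWithinAt_tubeCoord hT hC hU hΩ hd hS hq
  have hinj : InjOn (tubeCoord Ω e f) (Ioo 0 δ ×ˢ B) := by
    intro q hq q' hq' h
    have h1 := injOn_tubular hT (hmaps hq) (hmaps hq') ((coordEquiv _).injective h)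
    rw [Prod.mk.injEq] at h1
    exact Prod.ext h1.1 (graphCurve_injective h1.2)
  rw [hrestr, hγm.lintegral_map, lintegral_withDensity_eq_lintegral_mul_non_measurable _
    hρc.measurable (ae_of_all _ fun x => ENNReal.ofReal_lt_top)]
  calc ∫⁻ x in B, (ρ * fun x => ∫⁻ t in Ioo 0 δ, F (tubular Ω (t, graphCurve e f x))) x
      = ∫⁻ x in B, ∫⁻ t in Ioo 0 δ, ρ x * F (tubular Ω (t, graphCurve e f x)) := by
        refine lintegral_congr fun x => ?_
        rw [Pi.mul_apply, lintegral_const_mul' _ _ ENNReal.ofReal_ne_top]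
    _ = ∫⁻ q in Ioo 0 δ ×ˢ B, ρ q.2 * F (tubular Ω (q.1, graphCurve e f q.2)) := by
        rw [Measure.volume_eq_prod, ← Measure.prod_restrict, lintegral_prod_symm _ hmeas]
    _ ≤ ∫⁻ q in Ioo 0 δ ×ˢ B, ENNReal.ofReal C * (ENNReal.ofReal |(L q).det| *
          F ((coordEquiv (LinearIsometryEquiv.refl ℝ Plane)).symm (tubeCoord Ω e f q))) := by
        refine setLIntegral_mono' hSm fun q hq => ?_
        rw [tubeCoord, MeasurableEquiv.symm_apply_apply, ← mul_assoc,
          ← ENNReal.ofReal_mul hC.le]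
        gcongr
        exact ENNReal.ofReal_le_ofReal (hdet q hq)
    _ = ENNReal.ofReal C * ∫⁻ y in tubeCoord Ω e f '' (Ioo 0 δ ×ˢ B),
          F ((coordEquiv (LinearIsometryEquiv.refl ℝ Plane)).symm y) := by
        rw [lintegral_const_mul' _ _ ENNReal.ofReal_ne_top,
          lintegral_image_eq_lintegral_abs_det_fderiv_mul volume hSm hL hinj]
    _ ≤ _ := by
        gcongr
        rw [← (measurePreserving_coordEquiv
          (LinearIsometryEquiv.refl ℝ Plane)).setLIntegral_comp_preimage_emb
          (coordEquiv _).measurableEmbedding]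
        simp only [MeasurableEquiv.symm_apply_apply]
        refine lintegral_mono_set ?_
        rintro x ⟨q, hq, hx⟩
        refine ⟨(q.1, graphCurve e f q.2), ⟨hq.1, hq.2, hBf _ hq.2⟩, ?_⟩
        exact (coordEquiv _).injective hx

/-- Integrals over the tube, in tubular coordinates, are controlled by integrals over the plane. -/
lemma lintegral_tube_le (hΩ : HasC21Boundary Ω) (hT : HasTubularCoordinates Ω δ C) (hC : 0 < C)
    {F : Plane → ℝ≥0∞} (hF : Continuous F) :
    ∫⁻ p, (∫⁻ t in Ioo 0 δ, F (tubular Ω (t, p))) ∂(bdMeasure Ω) ≤ ENNReal.ofReal C * ∫⁻ x, F x := by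
  obtain ⟨Φ, hΦ, hinv⟩ := hT.exists_inverse
  set R := tubular Ω '' tubeSource Ω δ with hR
  have hRm : MeasurableSet R := hT.isOpen_range.measurableSet
  have hΦm : AEMeasurable (fun x => (Φ x).2) ((volume.withDensity F).restrict R) :=
    (continuous_snd.comp_continuousOn hΦ.continuousOn).aemeasurable hRm
  -- The measure `F dx` on the tube is pushed to the boundary by the foot-point map. The claim
  -- becomes an inequality of measures, which may be checked chart by chart.
  set κ : Measure Plane := ENNReal.ofReal C •
    Measure.map (fun x => (Φ x).2) ((volume.withDensity F).restrict R) with hκ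
  have hle : (bdMeasure Ω).withDensity (fun p => ∫⁻ t in Ioo 0 δ, F (tubular Ω (t, p))) ≤ κ := by
    refine measure_le_of_forall_nhds fun p => ?_
    by_cases hp : p ∈ frontier Ω
    · obtain ⟨e, f, U, hf, hU, hpU, hch⟩ := hΩ.exists_chart hp
      refine ⟨U, hU, hpU, fun A hA hAU => ?_⟩
      rw [withDensity_apply _ hA]
      refine (lintegral_tube_le_of_chart hT hC hU hch hf hF hA hAU).trans ?_
      rw [hκ, Measure.smul_apply, smul_eq_mul, Measure.map_apply_of_aemeasurable hΦm hA]
      gcongr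
      refine le_trans (lintegral_mono_set ?_) ((withDensity_apply_le F _).trans
        (Measure.le_restrict_apply _ _))
      rintro _ ⟨q, ⟨hq1, hq2⟩, rfl⟩
      have hq : q ∈ tubeSource Ω δ := ⟨⟨by linarith [hq1.1, hq1.2], hq1.2⟩, hq2.2⟩
      refine ⟨?_, mem_image_of_mem _ hq⟩
      rw [mem_preimage, hinv hq]
      exact hq2.1
    · refine ⟨(frontier Ω)ᶜ, isClosed_frontier.isOpen_compl, hp, fun A hA hAU => ?_⟩
      have h0 : bdMeasure Ω A = 0 := by
        rw [bdMeasure, Measure.restrict_apply hA, (disjoint_compl_left.mono_left hAU).inter_eq,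
          measure_empty]
      rw [withDensity_absolutelyContinuous _ _ h0]
      exact zero_le
  have := hle univ
  rw [withDensity_apply _ MeasurableSet.univ, Measure.restrict_univ, hκ, Measure.smul_apply,
    smul_eq_mul, Measure.map_apply_of_aemeasurable hΦm MeasurableSet.univ, preimage_univ] at this
  refine this.trans ?_
  gcongr
  refine (Measure.restrict_apply_le _ _).trans ?_
  rw [withDensity_apply _ MeasurableSet.univ, Measure.restrict_univ]

lemma norm_fderiv_apply_sq_le {φ : Plane → Spinor} (x v : Plane) (hv : ‖v‖ = 1) :
    ‖fderiv ℝ φ x v‖ ^ 2 ≤ ‖fderiv ℝ φ x (EuclideanSpace.single 0 1)‖ ^ 2 +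
      ‖fderiv ℝ φ x (EuclideanSpace.single 1 1)‖ ^ 2 := by
  have hdec : v = v 0 • EuclideanSpace.single 0 1 + v 1 • EuclideanSpace.single 1 1 := by
    ext j
    fin_cases j <;> simp
  have h2 : v 0 ^ 2 + v 1 ^ 2 = 1 := by
    have := EuclideanSpace.norm_sq_eq v
    rw [hv, Fin.sum_univ_two] at this
    simpa using this.symm
  set a := fderiv ℝ φ x (EuclideanSpace.single 0 1)
  set b := fderiv ℝ φ x (EuclideanSpace.single 1 1)
  have h3 : ‖fderiv ℝ φ x v‖ ≤ |v 0| * ‖a‖ + |v 1| * ‖b‖ := by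
    rw [hdec, map_add, map_smul, map_smul]
    refine (norm_add_le _ _).trans ?_
    rw [norm_smul, norm_smul, ← hdec, Real.norm_eq_abs, Real.norm_eq_abs]
  calc ‖fderiv ℝ φ x v‖ ^ 2 ≤ (|v 0| * ‖a‖ + |v 1| * ‖b‖) ^ 2 := by gcongr
    _ ≤ (|v 0| ^ 2 + |v 1| ^ 2) * (‖a‖ ^ 2 + ‖b‖ ^ 2) := by
        nlinarith [sq_nonneg (|v 0| * ‖b‖ - |v 1| * ‖a‖)]
    _ = ‖a‖ ^ 2 + ‖b‖ ^ 2 := by rw [sq_abs, sq_abs, h2, one_mul]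

/-- The value of a smooth function at the end of a segment of length `δ` is controlled by the
energy along the segment. -/
lemma norm_sq_le_integral_segment {φ : Plane → Spinor} (hφ : ContDiff ℝ 1 φ) (hδ : 0 < δ)
    (p n : Plane) (hn : ‖n‖ = 1) :
    ‖φ p‖ ^ 2 ≤ ∫ t in (0 : ℝ)..δ, ((δ⁻¹ + 1) * ‖φ (p - t • n)‖ ^ 2 +
      (‖fderiv ℝ φ (p - t • n) (EuclideanSpace.single 0 1)‖ ^ 2 +
        ‖fderiv ℝ φ (p - t • n) (EuclideanSpace.single 1 1)‖ ^ 2)) := by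
  have hφc := hφ.continuous
  have hd : ∀ v, Continuous fun t : ℝ => fderiv ℝ φ (p - t • n) v := fun v =>
    ((hφ.continuous_fderiv one_ne_zero).comp (by fun_prop)).clm_apply continuous_const
  have hu : ∀ t : ℝ, HasDerivAt (fun t : ℝ => φ (p - t • n)) (fderiv ℝ φ (p - t • n) (-n)) t := by
    intro t
    have h1 : HasDerivAt (fun t : ℝ => p - t • n) (-n) t := by
      simpa using ((hasDerivAt_id t).smul_const n).const_sub p
    exact (hφ.differentiable one_ne_zero _).hasFDerivAt.comp_hasDerivAt t h1
  -- The weight `1 - t/δ` is `1` at `p` and `0` at the far end, so only the value at `p` survives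
  -- integration; its slope costs the factor `δ⁻¹`.
  have hk : ∀ t : ℝ, HasDerivAt (fun t : ℝ => (1 - t * δ⁻¹) * ‖φ (p - t • n)‖ ^ 2)
      (-δ⁻¹ * ‖φ (p - t • n)‖ ^ 2 + (1 - t * δ⁻¹) *
        (2 * inner ℝ (φ (p - t • n)) (fderiv ℝ φ (p - t • n) (-n)))) t := by
    intro t
    have h1 : HasDerivAt (fun t : ℝ => 1 - t * δ⁻¹) (-δ⁻¹) t := by
      simpa using ((hasDerivAt_id t).mul_const δ⁻¹).const_sub 1
    exact h1.mul (hu t).norm_sq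
  have hcont : Continuous fun t : ℝ => -δ⁻¹ * ‖φ (p - t • n)‖ ^ 2 + (1 - t * δ⁻¹) *
        (2 * inner ℝ (φ (p - t • n)) (fderiv ℝ φ (p - t • n) (-n))) := by
    have := hd (-n)
    fun_prop
  have hftc := intervalIntegral.integral_eq_sub_of_hasDerivAt (fun t _ => hk t)
    (hcont.intervalIntegrable 0 δ)
  have hδ1 : δ * δ⁻¹ = 1 := mul_inv_cancel₀ hδ.ne'
  simp only [hδ1, sub_self, zero_mul, zero_sub, sub_zero, zero_smul, one_mul] at hftc
  rw [← neg_eq_iff_eq_neg, ← intervalIntegral.integral_neg] at hftc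
  rw [← hftc]
  have h0 := hd (EuclideanSpace.single 0 1)
  have h1 := hd (EuclideanSpace.single 1 1)
  refine intervalIntegral.integral_mono_on hδ.le (hcont.neg.intervalIntegrable 0 δ)
    (Continuous.intervalIntegrable (by fun_prop) 0 δ) fun t ht => ?_
  have hn' : ‖-n‖ = 1 := by rw [norm_neg, hn]
  have hb := norm_fderiv_apply_sq_le (φ := φ) (p - t • n) (-n) hn'
  have hin := abs_real_inner_le_norm (φ (p - t • n)) (fderiv ℝ φ (p - t • n) (-n))
  have hs0 : 0 ≤ 1 - t * δ⁻¹ := by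
    rw [← div_eq_mul_inv, sub_nonneg, div_le_one hδ]
    exact ht.2
  have hs1 : 1 - t * δ⁻¹ ≤ 1 := by
    have : 0 ≤ t * δ⁻¹ := mul_nonneg ht.1 (by positivity)
    linarith
  set A := ‖φ (p - t • n)‖
  set D := ‖fderiv ℝ φ (p - t • n) (-n)‖
  set I : ℝ := inner ℝ (φ (p - t • n)) (fderiv ℝ φ (p - t • n) (-n))
  have h2 : -((1 - t * δ⁻¹) * (2 * I)) ≤ A ^ 2 + D ^ 2 := by
    have h3 : -(2 * I) ≤ A ^ 2 + D ^ 2 := by nlinarith [neg_abs_le I, sq_nonneg (A - D)]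
    have h4 : 0 ≤ A ^ 2 + D ^ 2 := by positivity
    nlinarith
  linarith

/-- The trace inequality for smooth functions. -/
theorem exists_lintegral_boundary_le (hΩ : IsAdmissible Ω) :
    ∃ K : ℝ≥0∞, K ≠ ⊤ ∧ ∀ φ : Plane → Spinor, ContDiff ℝ 1 φ →
      ∫⁻ p, ‖φ p‖ₑ ^ 2 ∂(bdMeasure Ω) ≤ K * ((∫⁻ x, ‖φ x‖ₑ ^ 2) +
        ((∫⁻ x, ‖fderiv ℝ φ x (EuclideanSpace.single 0 1)‖ₑ ^ 2) +
          ∫⁻ x, ‖fderiv ℝ φ x (EuclideanSpace.single 1 1)‖ₑ ^ 2)) := by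
  obtain ⟨δ, hδ, C, hC, hT⟩ := hΩ.tubularCoordinates
  -- `C` is the price of the change of variables and `δ⁻¹ + 1` that of the segment estimate; the
  -- derivative terms, which need only the coefficient `1`, receive the same factor.
  refine ⟨ENNReal.ofReal C * ENNReal.ofReal (δ⁻¹ + 1),
    ENNReal.mul_ne_top ENNReal.ofReal_ne_top ENNReal.ofReal_ne_top, fun φ hφ => ?_⟩
  have hφc := hφ.continuous
  have hd : ∀ v, Continuous fun x => fderiv ℝ φ x v := fun v =>
    (hφ.continuous_fderiv one_ne_zero).clm_apply continuous_const
  have h0 := hd (EuclideanSpace.single 0 1)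
  have h1 := hd (EuclideanSpace.single 1 1)
  set Fr : Plane → ℝ := fun x => (δ⁻¹ + 1) * ‖φ x‖ ^ 2 +
    (‖fderiv ℝ φ x (EuclideanSpace.single 0 1)‖ ^ 2 +
      ‖fderiv ℝ φ x (EuclideanSpace.single 1 1)‖ ^ 2) with hFr
  have hFrc : Continuous Fr := by fun_prop
  have hFr0 : ∀ x, 0 ≤ Fr x := fun x => by positivity
  have hsq : ∀ v : Spinor, ‖v‖ₑ ^ 2 = ENNReal.ofReal (‖v‖ ^ 2) := by
    intro v
    rw [ENNReal.ofReal_pow (norm_nonneg _), ofReal_norm]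
  calc ∫⁻ p, ‖φ p‖ₑ ^ 2 ∂(bdMeasure Ω)
      ≤ ∫⁻ p, (∫⁻ t in Ioo 0 δ, ENNReal.ofReal (Fr (tubular Ω (t, p)))) ∂(bdMeasure Ω) := by
        refine setLIntegral_mono' isClosed_frontier.measurableSet fun p hp => ?_
        have hn := norm_outerNormal hΩ.boundary hp
        have hcont : Continuous fun t : ℝ => Fr (tubular Ω (t, p)) := by
          change Continuous fun t : ℝ => Fr (p - t • outerNormal Ω p)
          generalize outerNormal Ω p = n
          fun_prop
        rw [hsq, restrict_Ioo_eq_restrict_Ioc, ← ofReal_integral_eq_lintegral_ofReal]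
        · rw [← intervalIntegral.integral_of_le hδ.le]
          apply ENNReal.ofReal_le_ofReal
          have := norm_sq_le_integral_segment hφ hδ p _ hn
          simpa only [hFr, tubular] using this
        · exact (hcont.intervalIntegrable 0 δ).1
        · exact ae_of_all _ fun t => hFr0 _
    _ ≤ ENNReal.ofReal C * ∫⁻ x, ENNReal.ofReal (Fr x) :=
        lintegral_tube_le hΩ.boundary hT hC (ENNReal.continuous_ofReal.comp hFrc)
    _ ≤ _ := by
        rw [mul_assoc]
        gcongr
        have hm : Measurable fun x => ‖φ x‖ₑ ^ 2 := hφc.enorm.measurable.pow_const 2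
        have hm0 : Measurable fun x => ‖fderiv ℝ φ x (EuclideanSpace.single 0 1)‖ₑ ^ 2 :=
          h0.enorm.measurable.pow_const 2
        have hm1 : Measurable fun x => ‖fderiv ℝ φ x (EuclideanSpace.single 1 1)‖ₑ ^ 2 :=
          h1.enorm.measurable.pow_const 2
        rw [← lintegral_add_left hm0, ← lintegral_add_left hm, ← lintegral_const_mul' _ _
          ENNReal.ofReal_ne_top]
        refine lintegral_mono fun x => ?_
        have hone : (0 : ℝ) ≤ δ⁻¹ := by positivity
        rw [hsq, hsq, hsq, ← ENNReal.ofReal_add (by positivity) (by positivity),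
          ← ENNReal.ofReal_add (by positivity) (by positivity), ← ENNReal.ofReal_mul (by positivity)]
        apply ENNReal.ofReal_le_ofReal
        have : 0 ≤ δ⁻¹ * (‖fderiv ℝ φ x (EuclideanSpace.single 0 1)‖ ^ 2 +
          ‖fderiv ℝ φ x (EuclideanSpace.single 1 1)‖ ^ 2) := by positivity
        simp only [hFr]
        linarith

end Tube

/-! ### Test functions -/

/-- The space `C_c^∞(ℝ², ℂ²)`. -/
def testSpace : Submodule ℂ (Plane → Spinor) where
  carrier := {φ | ContDiff ℝ ∞ φ ∧ HasCompactSupport φ}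
  zero_mem' := ⟨contDiff_const, HasCompactSupport.zero⟩
  add_mem' h h' := ⟨h.1.add h'.1, h.2.add h'.2⟩
  smul_mem' c _ h := ⟨h.1.const_smul c, h.2.smul_left (f := fun _ => c)⟩

namespace testSpace

lemma contDiff (φ : testSpace) : ContDiff ℝ ∞ (φ : Plane → Spinor) := φ.2.1

lemma hasCompactSupport (φ : testSpace) : HasCompactSupport (φ : Plane → Spinor) := φ.2.2

lemma differentiable (φ : testSpace) : Differentiable ℝ (φ : Plane → Spinor) :=
  (contDiff φ).differentiable (by simp)

lemma continuous (φ : testSpace) : Continuous (φ : Plane → Spinor) := (contDiff φ).continuous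

lemma memLp (φ : testSpace) (μ : Measure Plane) [IsFiniteMeasureOnCompacts μ] :
    MemLp (φ : Plane → Spinor) 2 μ :=
  (continuous φ).memLp_of_hasCompactSupport (hasCompactSupport φ)

/-- The partial derivative `∂_j`. -/
def pd (j : Fin 2) : testSpace →ₗ[ℂ] testSpace where
  toFun φ := ⟨fun x => fderiv ℝ (φ : Plane → Spinor) x (EuclideanSpace.single j 1),
    ((contDiff φ).fderiv_right (m := ∞) (by simp)).clm_apply contDiff_const,
    (hasCompactSupport φ).fderiv_apply (𝕜 := ℝ) _⟩
  map_add' φ η := by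
    ext1
    funext x
    change fderiv ℝ ((φ : Plane → Spinor) + (η : Plane → Spinor)) x _ = _
    rw [fderiv_add ((differentiable φ) x) ((differentiable η) x)]
    rfl
  map_smul' c φ := by
    ext1
    funext x
    change fderiv ℝ (c • (φ : Plane → Spinor)) x _ = _
    rw [fderiv_const_smul ((differentiable φ) x)]
    rfl

/-- A linear map acting on the values of a test function. -/
def mapVal (M : Spinor →L[ℂ] Spinor) : testSpace →ₗ[ℂ] testSpace where
  toFun φ := ⟨fun x => M ((φ : Plane → Spinor) x),
    (M.restrictScalars ℝ).contDiff.comp (contDiff φ),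
    (hasCompactSupport φ).comp_left (map_zero M)⟩
  map_add' φ η := by
    ext1
    funext x
    exact map_add M _ _
  map_smul' c φ := by
    ext1
    funext x
    exact map_smul M _ _

lemma mapVal_apply (M : Spinor →L[ℂ] Spinor) (φ : testSpace) (x : Plane) :
    (mapVal M φ : Plane → Spinor) x = M ((φ : Plane → Spinor) x) := rfl

lemma pd_mapVal (j : Fin 2) (M : Spinor →L[ℂ] Spinor) (φ : testSpace) :
    pd j (mapVal M φ) = mapVal M (pd j φ) := by
  ext1
  funext x
  change fderiv ℝ ((M.restrictScalars ℝ) ∘ (φ : Plane → Spinor)) x _ = _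
  rw [fderiv_comp _ (M.restrictScalars ℝ).differentiableAt ((differentiable φ) x),
    ContinuousLinearMap.fderiv]
  rfl

lemma pd_comm (j k : Fin 2) (φ : testSpace) : pd j (pd k φ) = pd k (pd j φ) := by
  have hd : Differentiable ℝ (fderiv ℝ (φ : Plane → Spinor)) :=
    ((contDiff φ).fderiv_right (m := ∞) (by simp)).differentiable (by simp)
  ext1
  funext x
  have key : ∀ v w : Plane, fderiv ℝ (fun y => fderiv ℝ (φ : Plane → Spinor) y v) x w =
      fderiv ℝ (fderiv ℝ (φ : Plane → Spinor)) x w v := by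
    intro v w
    rw [fderiv_clm_apply (hd x) (differentiableAt_const v)]
    simp
  change fderiv ℝ (fun y => fderiv ℝ (φ : Plane → Spinor) y _) x _ =
    fderiv ℝ (fun y => fderiv ℝ (φ : Plane → Spinor) y _) x _
  rw [key, key]
  exact second_derivative_symmetric (fun y => ((differentiable φ) y).hasFDerivAt)
    (hd x).hasFDerivAt _ _

/-- The test function `χ c` with a real smooth function `χ` and a spinor `c`. -/
def tensor (χ : Plane → ℝ) (hχ : ContDiff ℝ ∞ χ) (hc : HasCompactSupport χ) (c : Spinor) :
    testSpace :=
  ⟨fun x => χ x • c, hχ.smul contDiff_const, hc.smul_right⟩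

lemma pd_tensor (j : Fin 2) (χ : Plane → ℝ) (hχ : ContDiff ℝ ∞ χ) (hc : HasCompactSupport χ)
    (c : Spinor) (x : Plane) : (pd j (tensor χ hχ hc c) : Plane → Spinor) x =
      fderiv ℝ χ x (EuclideanSpace.single j 1) • c := by
  change fderiv ℝ (fun x => χ x • c) x _ = _
  rw [fderiv_smul_const (hχ.differentiable (by simp) x)]
  rfl

/-- The class in `L²(μ)` of a test function. -/
def toL2 (μ : Measure Plane) [IsFiniteMeasureOnCompacts μ] : testSpace →ₗ[ℂ] Lp Spinor 2 μ where
  toFun φ := (memLp φ μ).toLp _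
  map_add' _ _ := rfl
  map_smul' _ _ := rfl

variable {μ : Measure Plane} [IsFiniteMeasureOnCompacts μ]

lemma coeFn_toL2 (φ : testSpace) : (toL2 μ φ : Plane → Spinor) =ᵐ[μ] φ :=
  MemLp.coeFn_toLp (memLp φ μ)

lemma tendsto_toL2_iff (φ : ℕ → testSpace) (u : Lp Spinor 2 μ) :
    Tendsto (fun n => toL2 μ (φ n)) atTop (𝓝 u) ↔
      Tendsto (fun n => eLpNorm (fun x => (φ n : Plane → Spinor) x - u x) 2 μ) atTop (𝓝 0) := by
  have := Lp.tendsto_Lp_iff_tendsto_eLpNorm'' (fi := atTop) (fun n => (φ n : Plane → Spinor))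
    (fun n => memLp (φ n) μ) u (Lp.memLp u)
  rw [Lp.toLp_coeFn] at this
  exact this

lemma inner_toL2_left (φ : testSpace) (u : Lp Spinor 2 μ) :
    inner ℂ (toL2 μ φ) u = ∫ x, inner ℂ ((φ : Plane → Spinor) x) (u x) ∂μ := by
  rw [L2.inner_def]
  refine integral_congr_ae ?_
  filter_upwards [coeFn_toL2 (μ := μ) φ] with x hx
  rw [hx]

lemma inner_toL2_toL2 (φ η : testSpace) :
    inner ℂ (toL2 μ φ) (toL2 μ η) =
      ∫ x, inner ℂ ((φ : Plane → Spinor) x) ((η : Plane → Spinor) x) ∂μ := by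
  rw [inner_toL2_left]
  refine integral_congr_ae ?_
  filter_upwards [coeFn_toL2 (μ := μ) η] with x hx
  rw [hx]

lemma integrable_smul_Lp (u : Lp Spinor 2 μ) {χ : Plane → ℝ} (hχ : Continuous χ)
    (hc : HasCompactSupport χ) : Integrable (fun x => χ x • u x) μ :=
  memLp_one_iff_integrable.mp
    (MemLp.smul (p := 2) (q := 2) (r := 1) (Lp.memLp u) (hχ.memLp_of_hasCompactSupport hc))

lemma inner_tensor_left (χ : Plane → ℝ) (hχ : ContDiff ℝ ∞ χ) (hc : HasCompactSupport χ)
    (c : Spinor) (u : Lp Spinor 2 μ) :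
    inner ℂ (toL2 μ (tensor χ hχ hc c)) u = inner ℂ c (∫ x, χ x • u x ∂μ) := by
  rw [inner_toL2_left, ← integral_inner (integrable_smul_Lp u hχ.continuous hc)]
  refine integral_congr_ae (ae_of_all _ fun x => ?_)
  simp only [tensor]
  rw [inner_smul_left_eq_smul, inner_smul_right_eq_smul]

lemma inner_pd_tensor_left (j : Fin 2) (χ : Plane → ℝ) (hχ : ContDiff ℝ ∞ χ)
    (hc : HasCompactSupport χ) (c : Spinor) (u : Lp Spinor 2 μ) :
    inner ℂ (toL2 μ (pd j (tensor χ hχ hc c))) u =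
      inner ℂ c (∫ x, fderiv ℝ χ x (EuclideanSpace.single j 1) • u x ∂μ) := by
  rw [inner_toL2_left, ← integral_inner (integrable_smul_Lp u
    ((hχ.continuous_fderiv (by simp)).clm_apply continuous_const) (hc.fderiv_apply (𝕜 := ℝ) _))]
  refine integral_congr_ae (ae_of_all _ fun x => ?_)
  simp only [pd_tensor]
  rw [inner_smul_left_eq_smul, inner_smul_right_eq_smul]

/-- An `L²` function which is orthogonal to all test functions vanishes. -/
lemma eq_zero_of_inner_eq_zero [IsLocallyFiniteMeasure μ] {u : Lp Spinor 2 μ}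
    (h : ∀ φ : testSpace, inner ℂ (toL2 μ φ) u = 0) : u = 0 := by
  rw [Lp.eq_zero_iff_ae_eq_zero]
  refine ae_eq_zero_of_integral_contDiff_smul_eq_zero
    ((Lp.memLp u).locallyIntegrable (by norm_num)) fun χ hχ hc => ?_
  refine ext_inner_left ℂ fun c => ?_
  rw [← inner_tensor_left χ hχ hc, h, inner_zero_right]

end testSpace

open testSpace

/-! ### Weak derivatives -/

/-- Pairing with constant spinors `c` turns a vector-valued integral identity into one between `L²`
scalar products, which is visibly stable under limits. -/
lemma hasWeakPartial_iff {O : Set Plane} {j : Fin 2} {u v : L2 O} :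
    HasWeakPartial O j u v ↔ ∀ (χ : Plane → ℝ) (hχ : ContDiff ℝ ∞ χ) (hc : HasCompactSupport χ),
      tsupport χ ⊆ interior O → ∀ c : Spinor,
        inner ℂ (toL2 _ (pd j (tensor χ hχ hc c))) u = -inner ℂ (toL2 _ (tensor χ hχ hc c)) v := by
  constructor
  · intro h χ hχ hc hs c
    rw [inner_pd_tensor_left, inner_tensor_left, h χ hχ hc hs, inner_neg_right]
  · intro h χ hχ hc hs
    refine ext_inner_left ℂ fun c => ?_
    rw [inner_neg_right, ← inner_pd_tensor_left j χ hχ hc, ← inner_tensor_left χ hχ hc,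
      h χ hχ hc hs]

lemma HasWeakPartial.of_tendsto {O : Set Plane} {j : Fin 2} {u v : L2 O} {un vn : ℕ → L2 O}
    (h : ∀ n, HasWeakPartial O j (un n) (vn n)) (hu : Tendsto un atTop (𝓝 u))
    (hv : Tendsto vn atTop (𝓝 v)) : HasWeakPartial O j u v := by
  rw [hasWeakPartial_iff]
  intro χ hχ hc hs c
  refine tendsto_nhds_unique (tendsto_const_nhds.inner hu) ?_
  refine ((tendsto_const_nhds.inner hv).neg).congr fun n => ?_
  exact (hasWeakPartial_iff.1 (h n) χ hχ hc hs c).symm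

/-- Test functions see only the interior of `O`, so the difference vanishes there; the rest of `O`
lies in the null set `frontier O`. -/
lemma HasWeakPartial.unique {O : Set Plane} (hO : MeasurableSet O) (hf : volume (frontier O) = 0)
    {j : Fin 2} {u v v' : L2 O} (h : HasWeakPartial O j u v) (h' : HasWeakPartial O j u v') :
    v = v' := by
  have hd := h.add (h'.smul (-1))
  rw [neg_one_smul, neg_one_smul, ← sub_eq_add_neg, ← sub_eq_add_neg, sub_self] at hd
  rw [← sub_eq_zero, Lp.eq_zero_iff_ae_eq_zero]
  have hae := isOpen_interior.ae_eq_zero_of_integral_contDiff_smul_eq_zero (U := interior O)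
    (μ := (volume : Measure Plane).restrict O) (f := (v - v' : L2 O))
    (((Lp.memLp (v - v')).locallyIntegrable (by norm_num)).locallyIntegrableOn _)
    fun χ hχ hc hs => by
      have h1 := hd χ hχ hc hs
      have h0 : ∫ x in O, (fderiv ℝ χ x (EuclideanSpace.single j 1)) • (0 : L2 O) x = 0 := by
        refine integral_eq_zero_of_ae ?_
        filter_upwards [Lp.coeFn_zero Spinor 2 ((volume : Measure Plane).restrict O)] with x hx
        rw [hx]
        simp
      rw [h0] at h1
      exact neg_eq_zero.1 h1.symm
  have hint : ∀ᵐ x ∂((volume : Measure Plane).restrict O), x ∈ interior O := by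
    rw [ae_restrict_iff' hO]
    have : ∀ᵐ x ∂(volume : Measure Plane), x ∉ frontier O := measure_eq_zero_iff_ae_notMem.1 hf
    filter_upwards [this] with x hx hxO
    by_contra hi
    exact hx ⟨subset_closure hxO, hi⟩
  filter_upwards [hae, hint] with x h1 h2
  exact h1 h2

/-! ### Restriction and gluing -/

lemma coeFn_restr (O : Set Plane) (u : L2 univ) :
    (restr O u : Plane → Spinor) =ᵐ[(volume : Measure Plane).restrict O] u :=
  MemLp.coeFn_toLp _

lemma restr_toL2 (O : Set Plane) (φ : testSpace) :
    restr O (toL2 (volume.restrict univ) φ) = toL2 (volume.restrict O) φ := by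
  apply Lp.ext
  refine (coeFn_restr O _).trans ?_
  have h := (coeFn_toL2 (μ := volume.restrict univ) φ).filter_mono
    (ae_mono (Measure.restrict_mono (subset_univ O) le_rfl))
  refine h.trans ?_
  exact (coeFn_toL2 φ).symm

lemma tendsto_restr (O : Set Plane) {un : ℕ → L2 univ} {u : L2 univ}
    (h : Tendsto un atTop (𝓝 u)) : Tendsto (fun n => restr O (un n)) atTop (𝓝 (restr O u)) := by
  rw [Lp.tendsto_Lp_iff_tendsto_eLpNorm'] at h ⊢
  refine tendsto_of_tendsto_of_tendsto_of_le_of_le tendsto_const_nhds h (fun _ => zero_le)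
    fun n => ?_
  have e : (restr O (un n) : Plane → Spinor) - (restr O u : Plane → Spinor)
      =ᵐ[(volume : Measure Plane).restrict O] (un n : Plane → Spinor) - (u : Plane → Spinor) :=
    (coeFn_restr O _).sub (coeFn_restr O _)
  simp only
  rw [eLpNorm_congr_ae e]
  exact eLpNorm_mono_measure _ (Measure.restrict_mono (subset_univ O) le_rfl)

lemma HasWeakPartial.restr {O : Set Plane} {j : Fin 2} {u v : L2 univ}
    (h : HasWeakPartial univ j u v) :
    HasWeakPartial O j (restr O u) (restr O v) := by
  intro χ hχ hc hs
  have key : ∀ (η : Plane → ℝ) (w : L2 univ), Function.support η ⊆ O →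
      ∫ x in O, η x • (InfiniteMass.restr O w) x = ∫ x in univ, η x • w x := by
    intro η w hη
    rw [integral_congr_ae (g := fun x => η x • w x)]
    · have : ∀ W : Plane → Spinor, ∫ x in O, η x • W x = ∫ x in univ, η x • W x := by
        intro W
        rw [Measure.restrict_univ, setIntegral_eq_integral_of_forall_compl_eq_zero]
        intro x hx
        rw [Function.notMem_support.1 fun hx' => hx (hη hx'), zero_smul]
      exact this w
    · filter_upwards [coeFn_restr O w] with x hx
      rw [hx]
  have hs' : tsupport χ ⊆ O := hs.trans interior_subset
  rw [key _ _ ((subset_tsupport χ).trans hs'), key _ _ ?_, h χ hχ hc (by simp)]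
  intro x hx
  refine hs' (support_fderiv_subset ℝ (Function.mem_support.2 fun h0 => hx ?_))
  simp [h0]

lemma inner_eq_add_restr {Ω : Set Plane} (hΩ : MeasurableSet Ω) (u v : L2 univ) :
    inner ℂ u v = inner ℂ (restr Ω u) (restr Ω v) + inner ℂ (restr Ωᶜ u) (restr Ωᶜ v) := by
  have key : ∀ O : Set Plane, inner ℂ (restr O u) (restr O v) = ∫ x in O, inner ℂ (u x) (v x) := by
    intro O
    rw [L2.inner_def]
    refine integral_congr_ae ?_
    filter_upwards [coeFn_restr O u, coeFn_restr O v] with x h1 h2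
    rw [h1, h2]
  have hadd : ∀ F : Plane → ℂ, Integrable F (volume.restrict univ) →
      ∫ x in univ, F x = (∫ x in Ω, F x) + ∫ x in Ωᶜ, F x := by
    intro F hF
    rw [Measure.restrict_univ] at hF ⊢
    exact (integral_add_compl hΩ hF).symm
  rw [key, key, L2.inner_def, hadd _ (L2.integrable_inner (𝕜 := ℂ) u v)]

lemma restr_glue {Ω : Set Plane} (hΩ : IsOpen Ω) (h : L2 Ω) (k : L2 Ωᶜ) :
    restr Ω (glue hΩ h k) = h := by
  classical
  apply Lp.ext
  have hg : (glue hΩ h k : Plane → Spinor) =ᵐ[(volume : Measure Plane).restrict univ]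
      Ω.piecewise (h : Plane → Spinor) (k : Plane → Spinor) := by
    convert! MemLp.coeFn_toLp (memLp_glue hΩ h k) using 1
  refine (coeFn_restr Ω _).trans ?_
  have hg' := hg.filter_mono (ae_mono (Measure.restrict_mono (subset_univ Ω) le_rfl))
  refine hg'.trans ?_
  filter_upwards [ae_restrict_mem hΩ.measurableSet] with x hx
  rw [piecewise_eq_of_mem _ _ _ hx]

lemma restr_compl_glue {Ω : Set Plane} (hΩ : IsOpen Ω) (h : L2 Ω) (k : L2 Ωᶜ) :
    restr Ωᶜ (glue hΩ h k) = k := by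
  classical
  apply Lp.ext
  have hg : (glue hΩ h k : Plane → Spinor) =ᵐ[(volume : Measure Plane).restrict univ]
      Ω.piecewise (h : Plane → Spinor) (k : Plane → Spinor) := by
    convert! MemLp.coeFn_toLp (memLp_glue hΩ h k) using 1
  refine (coeFn_restr Ωᶜ _).trans ?_
  have hg' := hg.filter_mono (ae_mono (Measure.restrict_mono (subset_univ Ωᶜ) le_rfl))
  refine hg'.trans ?_
  filter_upwards [ae_restrict_mem hΩ.measurableSet.compl] with x hx
  rw [piecewise_eq_of_notMem _ _ _ hx]

/-! ### Green's formula and uniqueness of traces -/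

lemma inner_act_left (M : Matrix (Fin 2) (Fin 2) ℂ) (a b : Spinor) :
    inner ℂ (act M a) b = inner ℂ a (act M.conjTranspose b) := by
  have : act M.conjTranspose = ContinuousLinearMap.adjoint (act M) := by
    rw [← ContinuousLinearMap.star_eq_adjoint]
    exact map_star (Matrix.toEuclideanCLM (n := Fin 2) (𝕜 := ℂ)) M
  rw [this, ContinuousLinearMap.adjoint_inner_right]

lemma norm_outerNormal_le (Ω : Set Plane) (p : Plane) : ‖outerNormal Ω p‖ ≤ 1 := by
  rw [outerNormal]
  split_ifs with h
  · exact h.2.choose_spec.1.le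
  · simp

lemma memLp_normal {Ω : Set Plane} (hΩ : IsAdmissible Ω) (j : Fin 2) :
    MemLp (fun p => ((outerNormal Ω p j : ℝ) : ℂ)) ⊤ (bdMeasure Ω) := by
  have hc : Continuous fun v : Plane => ((v j : ℝ) : ℂ) := by fun_prop
  refine memLp_top_of_bound (hc.comp_aestronglyMeasurable (aestronglyMeasurable_outerNormal hΩ)) 1
    (ae_of_all _ fun p => ?_)
  rw [Complex.norm_real]
  exact (PiLp.norm_apply_le _ _).trans (norm_outerNormal_le Ω p)

/-- Multiplication by the component `n_j` of the normal on `L²(∂Ω)`. -/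
def normalMul {Ω : Set Plane} (hΩ : IsAdmissible Ω) (j : Fin 2) : L2bd Ω →L[ℂ] L2bd Ω :=
  (ContinuousLinearMap.lsmul ℂ ℂ : ℂ →L[ℂ] Spinor →L[ℂ] Spinor).holderL (bdMeasure Ω) ⊤ 2 2
    ((memLp_normal hΩ j).toLp _)

lemma coeFn_normalMul {Ω : Set Plane} (hΩ : IsAdmissible Ω) (j : Fin 2) (τ : L2bd Ω) :
    (normalMul hΩ j τ : Plane → Spinor) =ᵐ[bdMeasure Ω]
      fun p => ((outerNormal Ω p j : ℝ) : ℂ) • τ p := by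
  refine (ContinuousLinearMap.coeFn_holder (r := 2) (ContinuousLinearMap.lsmul ℂ ℂ :
    ℂ →L[ℂ] Spinor →L[ℂ] Spinor) ((memLp_normal hΩ j).toLp _) τ).trans ?_
  filter_upwards [(memLp_normal hΩ j).coeFn_toLp] with p hp
  rw [hp]
  rfl

lemma contDiff_inner (φ η : testSpace) :
    ContDiff ℝ 1 fun x => inner ℂ ((φ : Plane → Spinor) x) ((η : Plane → Spinor) x) :=
  ((contDiff φ).inner ℂ (contDiff η)).of_le (by simp)

lemma hasCompactSupport_inner (φ η : testSpace) :
    HasCompactSupport fun x => inner ℂ ((φ : Plane → Spinor) x) ((η : Plane → Spinor) x) := by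
  refine (hasCompactSupport η).mono fun x hx => ?_
  contrapose! hx
  rw [Function.notMem_support] at hx ⊢
  rw [hx, inner_zero_right]

lemma inner_pd_add_inner_pd {μ : Measure Plane} [IsFiniteMeasureOnCompacts μ] (j : Fin 2)
    (φ η : testSpace) :
    inner ℂ (toL2 μ (pd j φ)) (toL2 μ η) + inner ℂ (toL2 μ φ) (toL2 μ (pd j η)) =
      ∫ x, fderiv ℝ (fun x => inner ℂ ((φ : Plane → Spinor) x) ((η : Plane → Spinor) x)) x
        (EuclideanSpace.single j 1) ∂μ := by
  have hint : ∀ φ η : testSpace, Integrable (fun x => inner ℂ ((φ : Plane → Spinor) x)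
      ((η : Plane → Spinor) x)) μ := by
    intro φ η
    refine (L2.integrable_inner (𝕜 := ℂ) (toL2 μ φ) (toL2 μ η)).congr ?_
    filter_upwards [coeFn_toL2 (μ := μ) φ, coeFn_toL2 (μ := μ) η] with x h1 h2
    rw [h1, h2]
  rw [inner_toL2_toL2, inner_toL2_toL2, ← integral_add (hint _ _) (hint _ _)]
  refine integral_congr_ae (ae_of_all _ fun x => ?_)
  simp only
  rw [fderiv_inner_apply ℂ (differentiable φ x) (differentiable η x), add_comm]
  rfl

/-- `u` is the limit in `H¹(O)`, with derivatives converging to `d`, of test functions whose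
boundary values converge to `τ`. -/
def HasTraceData (Ω O : Set Plane) [IsLocallyFiniteMeasure (bdMeasure Ω)] (u : L2 O)
    (d : Fin 2 → L2 O) (τ : L2bd Ω) : Prop :=
  ∃ φ : ℕ → testSpace, Tendsto (fun n => toL2 (volume.restrict O) (φ n)) atTop (𝓝 u) ∧
    (∀ j, Tendsto (fun n => toL2 (volume.restrict O) (pd j (φ n))) atTop (𝓝 (d j))) ∧
    Tendsto (fun n => toL2 (bdMeasure Ω) (φ n)) atTop (𝓝 τ)

section Trace

variable {Ω O : Set Plane}

/-- The divergence theorem on `O`, with boundary term multiplied by the sign `s`. -/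
def SatisfiesDivergence (Ω O : Set Plane) (s : ℂ) : Prop :=
  ∀ g : Plane → ℂ, ContDiff ℝ 1 g → HasCompactSupport g → ∀ w : Plane,
    ∫ p in O, fderiv ℝ g p w = s * ∫ p, (inner ℝ (outerNormal Ω p) w : ℝ) • g p ∂(bdMeasure Ω)

lemma satisfiesDivergence_self (hΩ : IsAdmissible Ω) : SatisfiesDivergence Ω Ω 1 := by
  intro g hg hc w
  rw [one_mul]
  exact integral_fderiv_eq_boundary hΩ.isOpen hΩ.boundary (aestronglyMeasurable_outerNormal hΩ)
    hg hc w

/-- The integral of a derivative over the whole plane is zero, so the complement carries the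
opposite boundary term. -/
lemma satisfiesDivergence_compl (hΩ : IsAdmissible Ω) : SatisfiesDivergence Ω Ωᶜ (-1) := by
  intro g hg hc w
  have h1 := satisfiesDivergence_self hΩ g hg hc w
  have hi : Integrable (fun p => fderiv ℝ g p w) (volume : Measure Plane) :=
    ((hg.continuous_fderiv one_ne_zero).clm_apply
      continuous_const).integrable_of_hasCompactSupport (hc.fderiv_apply ℝ w)
  have h2 := integral_add_compl hΩ.isOpen.measurableSet hi
  rw [integral_fderiv_eq_zero hg hc, h1] at h2
  linear_combination h2

variable [IsLocallyFiniteMeasure (bdMeasure Ω)]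

/-- Convergence of representatives becomes convergence in the Hilbert spaces, and the approximation
data is separated from the weak derivatives. -/
lemma hasTrace_iff {u : L2 O} {τ : L2bd Ω} :
    HasTrace Ω O u τ ↔ ∃ d, (∀ j, HasWeakPartial O j u (d j)) ∧ HasTraceData Ω O u d τ := by
  constructor
  · rintro ⟨d, hd, φ, hφ, h1, h2, h3⟩
    refine ⟨d, hd, fun n => ⟨φ n, hφ n⟩, ?_, fun j => ?_, ?_⟩
    · exact (tendsto_toL2_iff _ _).2 h1
    · exact (tendsto_toL2_iff _ _).2 (h2 j)
    · exact (tendsto_toL2_iff _ _).2 h3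
  · rintro ⟨d, hd, φ, h1, h2, h3⟩
    refine ⟨d, hd, fun n => (φ n : Plane → Spinor),
      fun n => ⟨contDiff (φ n), hasCompactSupport (φ n)⟩, ?_, fun j => ?_, ?_⟩
    · exact (tendsto_toL2_iff φ u).1 h1
    · exact (tendsto_toL2_iff (fun n => pd j (φ n)) (d j)).1 (h2 j)
    · exact (tendsto_toL2_iff φ τ).1 h3

lemma hasTraceData_toL2 (φ : testSpace) :
    HasTraceData Ω O (toL2 (volume.restrict O) φ) (fun j => toL2 (volume.restrict O) (pd j φ))
      (toL2 (bdMeasure Ω) φ) := by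
  refine ⟨fun _ => φ, ?_, fun j => ?_, ?_⟩ <;> exact tendsto_const_nhds

lemma toL2_mapVal {μ : Measure Plane} [IsFiniteMeasureOnCompacts μ] (M : Spinor →L[ℂ] Spinor)
    (φ : testSpace) : toL2 μ (mapVal M φ) = M.compLpL 2 μ (toL2 μ φ) := by
  apply Lp.ext
  filter_upwards [coeFn_toL2 (μ := μ) (mapVal M φ), coeFn_toL2 (μ := μ) φ,
    ContinuousLinearMap.coeFn_compLpL M (toL2 μ φ)] with x h1 h2 h3
  rw [h1, h3, h2, mapVal_apply]

lemma tendsto_toL2_mapVal {μ : Measure Plane} [IsFiniteMeasureOnCompacts μ]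
    (M : Spinor →L[ℂ] Spinor) {φ : ℕ → testSpace} {u : Lp Spinor 2 μ}
    (h : Tendsto (fun n => toL2 μ (φ n)) atTop (𝓝 u)) :
    Tendsto (fun n => toL2 μ (mapVal M (φ n))) atTop (𝓝 (M.compLpL 2 μ u)) := by
  simp_rw [toL2_mapVal]
  have hc : Continuous (M.compLpL 2 μ) := (M.compLpL 2 μ).continuous
  exact (hc.tendsto u).comp h

lemma HasTraceData.map {u : L2 O} {d : Fin 2 → L2 O} {τ : L2bd Ω} (h : HasTraceData Ω O u d τ)
    (M : Spinor →L[ℂ] Spinor) :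
    HasTraceData Ω O (M.compLpL 2 (volume.restrict O) u)
      (fun j => M.compLpL 2 (volume.restrict O) (d j)) (M.compLpL 2 (bdMeasure Ω) τ) := by
  obtain ⟨φ, h1, h2, h3⟩ := h
  refine ⟨fun n => mapVal M (φ n), tendsto_toL2_mapVal M h1, fun j => ?_,
    tendsto_toL2_mapVal M h3⟩
  simp_rw [pd_mapVal]
  exact tendsto_toL2_mapVal M (h2 j)

lemma green_toL2 (hΩ : IsAdmissible Ω) {s : ℂ} (hO : SatisfiesDivergence Ω O s) (j : Fin 2)
    (φ η : testSpace) :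
    inner ℂ (toL2 (volume.restrict O) (pd j φ)) (toL2 (volume.restrict O) η) +
      inner ℂ (toL2 (volume.restrict O) φ) (toL2 (volume.restrict O) (pd j η)) =
      s * inner ℂ (toL2 (bdMeasure Ω) φ) (normalMul hΩ j (toL2 (bdMeasure Ω) η)) := by
  rw [inner_pd_add_inner_pd, hO _ (contDiff_inner φ η) (hasCompactSupport_inner φ η),
    inner_toL2_left]
  congr 1
  refine integral_congr_ae ?_
  filter_upwards [coeFn_normalMul hΩ j (toL2 (bdMeasure Ω) η),
    coeFn_toL2 (μ := bdMeasure Ω) η] with p h1 h2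
  rw [h1, h2, inner_smul_right, EuclideanSpace.inner_single_right]
  simp

/-- Green's formula. -/
lemma HasTraceData.green (hΩ : IsAdmissible Ω) {s : ℂ} (hO : SatisfiesDivergence Ω O s)
    {u v : L2 O} {d e : Fin 2 → L2 O} {τ ρ : L2bd Ω} (hv : HasTraceData Ω O v e ρ)
    (hu : HasTraceData Ω O u d τ) (j : Fin 2) :
    inner ℂ (e j) u + inner ℂ v (d j) = s * inner ℂ ρ (normalMul hΩ j τ) := by
  obtain ⟨φ, h1, h2, h3⟩ := hv
  obtain ⟨η, k1, k2, k3⟩ := hu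
  refine tendsto_nhds_unique (((h2 j).inner k1).add (h1.inner (k2 j))) ?_
  have := (h3.inner (((normalMul hΩ j).continuous.tendsto _).comp k3)).const_mul s
  exact this.congr fun n => (green_toL2 hΩ hO j (φ n) (η n)).symm

/-- A function has at most one trace. -/
lemma HasTraceData.unique (hΩ : IsAdmissible Ω) {s : ℂ} (hs : s ≠ 0)
    (hO : SatisfiesDivergence Ω O s) {u : L2 O} {d : Fin 2 → L2 O} {τ τ' : L2bd Ω}
    (h : HasTraceData Ω O u d τ) (h' : HasTraceData Ω O u d τ') : τ = τ' := by
  -- In Green's formula with a test function the interior terms are the same for both traces, so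
  -- `n_j (τ - τ')` is orthogonal to all test functions on the boundary.
  have hz : ∀ j, normalMul hΩ j (τ - τ') = 0 := by
    intro j
    refine eq_zero_of_inner_eq_zero fun φ => ?_
    have h1 := (hasTraceData_toL2 φ).green hΩ hO h j
    have h2 := (hasTraceData_toL2 φ).green hΩ hO h' j
    rw [h1] at h2
    rw [map_sub, inner_sub_right, mul_left_cancel₀ hs h2, sub_self]
  rw [← sub_eq_zero, Lp.eq_zero_iff_ae_eq_zero]
  have h0 := coeFn_normalMul hΩ 0 (τ - τ')
  have h1 := coeFn_normalMul hΩ 1 (τ - τ')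
  rw [hz] at h0 h1
  filter_upwards [h0, h1, Lp.coeFn_zero Spinor 2 (bdMeasure Ω),
    ae_restrict_mem isClosed_frontier.measurableSet] with p k0 k1 k2 hp
  rw [k2] at k0 k1
  -- A nonzero value would force both components of the unit normal to vanish.
  by_contra hne
  have n0 : outerNormal Ω p 0 = 0 :=
    Complex.ofReal_eq_zero.1 ((smul_eq_zero.1 k0.symm).resolve_right hne)
  have n1 : outerNormal Ω p 1 = 0 :=
    Complex.ofReal_eq_zero.1 ((smul_eq_zero.1 k1.symm).resolve_right hne)
  have hn := norm_outerNormal hΩ.boundary hp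
  rw [EuclideanSpace.norm_eq, Fin.sum_univ_two, n0, n1] at hn
  simp at hn

lemma HasTrace.unique (hΩ : IsAdmissible Ω) {s : ℂ} (hs : s ≠ 0)
    (hO : SatisfiesDivergence Ω O s) (hOm : MeasurableSet O) (hf : volume (frontier O) = 0)
    {u : L2 O} {τ τ' : L2bd Ω} (h : HasTrace Ω O u τ) (h' : HasTrace Ω O u τ') : τ = τ' := by
  obtain ⟨d, hd, hτ⟩ := hasTrace_iff.1 h
  obtain ⟨d', hd', hτ'⟩ := hasTrace_iff.1 h'
  obtain rfl : d = d' := funext fun j => (hd j).unique hOm hf (hd' j)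
  exact hτ.unique hΩ hs hO hτ'

end Trace

lemma HasTraceData.restr {Ω : Set Plane} [IsLocallyFiniteMeasure (bdMeasure Ω)] (O : Set Plane)
    {u : L2 univ} {d : Fin 2 → L2 univ} {τ : L2bd Ω} (h : HasTraceData Ω univ u d τ) :
    HasTraceData Ω O (restr O u) (fun j => InfiniteMass.restr O (d j)) τ := by
  obtain ⟨φ, h1, h2, h3⟩ := h
  refine ⟨φ, (tendsto_restr O h1).congr fun n => restr_toL2 O _,
    fun j => (tendsto_restr O (h2 j)).congr fun n => restr_toL2 O _, h3⟩

/-- The boundary values of an `H¹`-convergent sequence of test functions converge. -/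
lemma exists_tendsto_boundary {Ω : Set Plane} [IsLocallyFiniteMeasure (bdMeasure Ω)]
    (hΩ : IsAdmissible Ω) {φ : ℕ → testSpace} {u : L2 univ} {d : Fin 2 → L2 univ}
    (h : Tendsto (fun n => toL2 (volume.restrict univ) (φ n)) atTop (𝓝 u))
    (hd : ∀ j, Tendsto (fun n => toL2 (volume.restrict univ) (pd j (φ n))) atTop (𝓝 (d j))) :
    ∃ τ, Tendsto (fun n => toL2 (bdMeasure Ω) (φ n)) atTop (𝓝 τ) := by
  obtain ⟨K, hK, hbd⟩ := exists_lintegral_boundary_le hΩ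
  have hnorm : ∀ (μ : Measure Plane) [IsFiniteMeasureOnCompacts μ] (φ : testSpace),
      ENNReal.ofReal (‖toL2 μ φ‖ ^ 2) = ∫⁻ x, ‖(φ : Plane → Spinor) x‖ₑ ^ 2 ∂μ := by
    intro μ _ φ
    have h1 := eLpNorm_nnreal_pow_eq_lintegral (μ := μ) (f := (φ : Plane → Spinor)) (p := 2)
      two_ne_zero
    have h2 : ∀ a : ℝ≥0∞, a ^ ((2 : ℝ≥0) : ℝ) = a ^ 2 := fun a => by
      rw [← ENNReal.rpow_natCast]
      norm_num
    simp_rw [h2] at h1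
    rw [← h1, ENNReal.ofReal_pow (norm_nonneg _), ofReal_norm, Lp.enorm_def]
    congr 1
    exact eLpNorm_congr_ae (coeFn_toL2 φ)
  -- The trace inequality in Hilbert space norms; applied to differences it makes the boundary
  -- values a Cauchy sequence.
  have hineq : ∀ φ : testSpace, ‖toL2 (bdMeasure Ω) φ‖ ^ 2 ≤ K.toReal *
      (‖toL2 (volume.restrict univ) φ‖ ^ 2 + (‖toL2 (volume.restrict univ) (pd 0 φ)‖ ^ 2 +
        ‖toL2 (volume.restrict univ) (pd 1 φ)‖ ^ 2)) := by
    intro φ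
    have h1 := hbd φ ((contDiff φ).of_le (by simp))
    rw [← ENNReal.ofReal_le_ofReal_iff (by positivity), ENNReal.ofReal_mul ENNReal.toReal_nonneg,
      ENNReal.ofReal_toReal hK, ENNReal.ofReal_add (by positivity) (by positivity),
      ENNReal.ofReal_add (by positivity) (by positivity), hnorm, hnorm, hnorm, hnorm]
    simp only [Measure.restrict_univ]
    exact h1
  have hcauchy : CauchySeq fun n => toL2 (bdMeasure Ω) (φ n) := by
    have hdiff : ∀ {F : ℕ → L2 univ} {v : L2 univ}, Tendsto F atTop (𝓝 v) →
        Tendsto (fun q : ℕ × ℕ => ‖F q.1 - F q.2‖ ^ 2) atTop (𝓝 0) := by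
      intro F v hF
      have h1 : Tendsto (fun q : ℕ × ℕ => F q.1 - F q.2) atTop (𝓝 (v - v)) := by
        rw [← prod_atTop_atTop_eq]
        exact (hF.comp tendsto_fst).sub (hF.comp tendsto_snd)
      simpa using h1.norm.pow 2
    have hlim : Tendsto (fun q : ℕ × ℕ => ‖toL2 (bdMeasure Ω) (φ q.1) -
        toL2 (bdMeasure Ω) (φ q.2)‖ ^ 2) atTop (𝓝 0) := by
      have hR := (((hdiff h).add ((hdiff (hd 0)).add (hdiff (hd 1)))).const_mul K.toReal)
      rw [add_zero, add_zero, mul_zero] at hR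
      refine squeeze_zero (fun q => by positivity) (fun q => ?_) hR
      have := hineq (φ q.1 - φ q.2)
      simpa only [map_sub] using this
    rw [cauchySeq_iff_tendsto_dist_atTop_0]
    have hs := (Real.continuous_sqrt.tendsto 0).comp hlim
    rw [Real.sqrt_zero] at hs
    refine hs.congr fun q => ?_
    rw [Function.comp_apply, Real.sqrt_sq (norm_nonneg _), dist_eq_norm]
  exact cauchySeq_tendsto_of_complete hcauchy

/-! ### A Liouville theorem for the Dirac operator -/

/-- The matrices `σ₁, σ₂`, indexed by the coordinates. -/
def pauli (j : Fin 2) : Matrix (Fin 2) (Fin 2) ℂ := ![sigma1, sigma2] j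

lemma conjTranspose_pauli (j : Fin 2) : (pauli j).conjTranspose = pauli j := by
  fin_cases j <;> ext a b <;> fin_cases a <;> fin_cases b <;> simp [pauli, sigma1, sigma2]

lemma conjTranspose_sigma3 : sigma3.conjTranspose = sigma3 := by
  ext a b
  fin_cases a <;> fin_cases b <;> simp [sigma3]

lemma act_act (M N : Matrix (Fin 2) (Fin 2) ℂ) (a : Spinor) :
    act M (act N a) = act (M * N) a := by
  simp [act]

lemma act_one (a : Spinor) : act 1 a = a := by
  simp [act]

lemma act_add (M N : Matrix (Fin 2) (Fin 2) ℂ) (a : Spinor) :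
    act (M + N) a = act M a + act N a := by
  simp [act]

lemma act_sub (M N : Matrix (Fin 2) (Fin 2) ℂ) (a : Spinor) :
    act (M - N) a = act M a - act N a := by
  simp [act]

lemma act_smul (c : ℂ) (M : Matrix (Fin 2) (Fin 2) ℂ) (a : Spinor) :
    act (c • M) a = c • act M a := by
  simp [act]

lemma pauli_mul_self (j : Fin 2) : pauli j * pauli j = 1 := by
  fin_cases j <;> ext a b <;> fin_cases a <;> fin_cases b <;>
    simp [pauli, sigma1, sigma2, Matrix.mul_apply]

lemma pauli_anticomm : pauli 0 * pauli 1 = -(pauli 1 * pauli 0) := by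
  ext a b
  fin_cases a <;> fin_cases b <;> simp [pauli, sigma1, sigma2, Matrix.mul_apply]

lemma inner_pauli_left (j : Fin 2) (a b : Spinor) :
    inner ℂ (act (pauli j) a) b = inner ℂ a (act (pauli j) b) := by
  rw [inner_act_left, conjTranspose_pauli]

lemma norm_pauli (j : Fin 2) (a : Spinor) : ‖act (pauli j) a‖ = ‖a‖ := by
  have h : inner ℂ (act (pauli j) a) (act (pauli j) a) = inner ℂ a a := by
    rw [inner_pauli_left, act_act, pauli_mul_self, act_one]
  rw [inner_self_eq_norm_sq_to_K, inner_self_eq_norm_sq_to_K] at h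
  have h' : ‖act (pauli j) a‖ ^ 2 = ‖a‖ ^ 2 := by exact_mod_cast h
  exact (pow_left_inj₀ (norm_nonneg _) (norm_nonneg _) two_ne_zero).1 h'

/-- The integrable weight `(1 + |x|² / 16)⁻²`. -/
def weight (x : Plane) : ℝ := ((1 + ‖x‖ ^ 2 / 16) ^ 2)⁻¹

lemma weight_pos (x : Plane) : 0 < weight x := by
  unfold weight
  positivity

lemma contDiff_weight : ContDiff ℝ 1 weight := by
  have h : ContDiff ℝ 1 fun x : Plane => (1 + ‖x‖ ^ 2 / 16) ^ 2 :=
    (contDiff_const.add ((contDiff_norm_sq ℝ).div_const 16)).pow 2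
  exact h.inv fun x => by positivity

lemma fderiv_weight (x v : Plane) :
    fderiv ℝ weight x v = -(inner ℝ x v / 4) * (1 + ‖x‖ ^ 2 / 16)⁻¹ * weight x := by
  have h0 : HasFDerivAt (fun x : Plane => ‖x‖ ^ 2) (2 • innerSL ℝ x) x :=
    (hasStrictFDerivAt_norm_sq x).hasFDerivAt
  have h1 : HasFDerivAt (fun x : Plane => 1 + ‖x‖ ^ 2 / 16) ((16 : ℝ)⁻¹ • (2 • innerSL ℝ x)) x := by
    have := (h0.const_mul (16 : ℝ)⁻¹).const_add 1
    refine this.congr_of_eventuallyEq (Eventually.of_forall fun y => ?_)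
    simp only
    ring
  have hp : (1 + ‖x‖ ^ 2 / 16 : ℝ) ≠ 0 := by positivity
  have h2 := (hasDerivAt_inv (pow_ne_zero 2 hp)).comp_hasFDerivAt x (h1.pow 2)
  have h3 : fderiv ℝ weight x = _ := h2.fderiv
  rw [h3]
  simp only [weight, smul_apply, innerSL_apply_apply, nsmul_eq_mul, smul_eq_mul,
    Nat.cast_ofNat]
  field_simp
  ring

/-- The scale `16` gives the constant `1/2`, by `(|x|/4 - 1)² ≥ 0`. Two coordinates then contribute
a total of `1`, strictly below the `2` it has to compete with in `eq_zero_of_dirac_eq`. -/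
lemma abs_fderiv_weight_le (x : Plane) (j : Fin 2) :
    |fderiv ℝ weight x (EuclideanSpace.single j 1)| ≤ weight x / 2 := by
  have hw := weight_pos x
  rw [fderiv_weight, abs_mul, abs_of_pos hw, abs_mul, abs_neg]
  have h1 : |(inner ℝ x (EuclideanSpace.single j (1 : ℝ)) : ℝ)| ≤ ‖x‖ := by
    refine (abs_real_inner_le_norm _ _).trans ?_
    simp
  have hp : (0 : ℝ) < 1 + ‖x‖ ^ 2 / 16 := by positivity
  rw [abs_of_pos (inv_pos.2 hp), abs_div, abs_of_pos (by norm_num : (0 : ℝ) < 4)]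
  have h2 : |(inner ℝ x (EuclideanSpace.single j (1 : ℝ)) : ℝ)| / 4 * (1 + ‖x‖ ^ 2 / 16)⁻¹ ≤ 1 / 2 := by
    rw [← div_eq_mul_inv, div_le_iff₀ hp]
    nlinarith [sq_nonneg (‖x‖ / 4 - 1)]
  nlinarith

lemma integrable_weight : Integrable weight := by
  have h := integrable_rpow_neg_one_add_norm_sq (E := Plane) (μ := volume) (r := 4)
    (by rw [finrank_euclideanSpace_fin]; norm_num)
  have h' := h.comp_smul (R := (4 : ℝ)⁻¹) (by norm_num)
  refine h'.congr (ae_of_all _ fun x => ?_)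
  have hp : (0 : ℝ) < 1 + ‖x‖ ^ 2 / 16 := by positivity
  simp only [weight, norm_smul, Real.norm_eq_abs]
  rw [show (-4 / 2 : ℝ) = -((2 : ℕ) : ℝ) by norm_num, Real.rpow_neg (by positivity),
    Real.rpow_natCast]
  rw [abs_of_pos (by norm_num : (0 : ℝ) < 4⁻¹)]
  ring

/-- A bounded solution of `(σ₁ ∂₁ + σ₂ ∂₂) w = ε w`, `ε = ±1`, with bounded derivatives vanishes. -/
lemma eq_zero_of_dirac_eq {w : Plane → Spinor} (hw : ContDiff ℝ 1 w) {C : ℝ}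
    (hb : ∀ x, ‖w x‖ ≤ C) (hb' : ∀ x j, ‖fderiv ℝ w x (EuclideanSpace.single j 1)‖ ≤ C)
    {ε : ℝ} (hε : |ε| = 1)
    (h : ∀ x, ∑ j, act (pauli j) (fderiv ℝ w x (EuclideanSpace.single j 1)) = (ε : ℂ) • w x) :
    w = 0 := by
  have hC : 0 ≤ C := (norm_nonneg _).trans (hb 0)
  have hdw : Differentiable ℝ w := hw.differentiable one_ne_zero
  have hσ : ∀ j, ContDiff ℝ 1 fun x => act (pauli j) (w x) := fun j =>
    ((act (pauli j)).restrictScalars ℝ).contDiff.comp hw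
  have hdσ : ∀ j x v, fderiv ℝ (fun x => act (pauli j) (w x)) x v =
      act (pauli j) (fderiv ℝ w x v) := by
    intro j x v
    have := ((act (pauli j)).restrictScalars ℝ).hasFDerivAt.comp x (hdw x).hasFDerivAt
    have h2 : fderiv ℝ (fun x => act (pauli j) (w x)) x = _ := this.fderiv
    rw [h2]
    rfl
  -- The current `⟨w, σ_j w⟩` has divergence `2ε|w|²`, since `σ_j` is hermitian and `ε` real, while
  -- each component is bounded by `|w|²`. The equation is tested by integrating this divergence
  -- against the weight.
  have hF : ∀ j, ContDiff ℝ 1 fun x => inner ℂ (w x) (act (pauli j) (w x)) := fun j =>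
    hw.inner ℂ (hσ j)
  have hdF : ∀ j x, fderiv ℝ (fun x => inner ℂ (w x) (act (pauli j) (w x))) x
      (EuclideanSpace.single j 1) =
      inner ℂ (w x) (act (pauli j) (fderiv ℝ w x (EuclideanSpace.single j 1))) +
      inner ℂ (act (pauli j) (fderiv ℝ w x (EuclideanSpace.single j 1))) (w x) := by
    intro j x
    rw [fderiv_inner_apply ℂ (hdw x) ((hσ j).differentiable one_ne_zero x), hdσ, inner_pauli_left]
  have hFb : ∀ j x, ‖(inner ℂ (w x) (act (pauli j) (w x)) : ℂ)‖ ≤ ‖w x‖ ^ 2 := by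
    intro j x
    refine (norm_inner_le_norm _ _).trans ?_
    rw [norm_pauli, sq]
  have hwt := integrable_weight
  have hdF_cont : ∀ j, Continuous fun x => fderiv ℝ (fun x => inner ℂ (w x) (act (pauli j) (w x))) x
      (EuclideanSpace.single j 1) := fun j =>
    ((hF j).continuous_fderiv one_ne_zero).clm_apply continuous_const
  have hdwt_cont : ∀ j : Fin 2, Continuous fun x => fderiv ℝ weight x (EuclideanSpace.single j 1) :=
    fun j => (contDiff_weight.continuous_fderiv one_ne_zero).clm_apply continuous_const
  have hdom : ∀ (G : Plane → ℂ) (K : ℝ), Continuous G → (∀ x, ‖G x‖ ≤ K * weight x) →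
      Integrable G volume := fun G K hG hK =>
    (hwt.const_mul K).mono' hG.aestronglyMeasurable (ae_of_all _ hK)
  have hwsq : ∀ x, ‖w x‖ ^ 2 ≤ C ^ 2 := fun x => pow_le_pow_left₀ (norm_nonneg _) (hb x) 2
  have i1 : ∀ j : Fin 2, Integrable (fun x => (fderiv ℝ weight x (EuclideanSpace.single j 1)) •
      (inner ℂ (w x) (act (pauli j) (w x)) : ℂ)) volume := by
    intro j
    refine hdom _ (C ^ 2) ((hdwt_cont j).smul (hF j).continuous) fun x => ?_
    rw [norm_smul, mul_comm]
    have h1 := abs_fderiv_weight_le x j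
    have h2 := weight_pos x
    exact mul_le_mul ((hFb j x).trans (hwsq x)) (by rw [Real.norm_eq_abs]; linarith)
      (norm_nonneg _) (by positivity)
  have i2 : ∀ j : Fin 2, Integrable (fun x => weight x •
      (fderiv ℝ (fun x => inner ℂ (w x) (act (pauli j) (w x))) x (EuclideanSpace.single j 1) : ℂ))
      volume := by
    intro j
    refine hdom _ (C ^ 2 + C ^ 2) (contDiff_weight.continuous.smul (hdF_cont j)) fun x => ?_
    rw [norm_smul, mul_comm, Real.norm_eq_abs, abs_of_pos (weight_pos x)]
    refine mul_le_mul_of_nonneg_right ?_ (weight_pos x).le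
    rw [hdF]
    refine (norm_add_le _ _).trans (add_le_add ?_ ?_)
    · refine (norm_inner_le_norm _ _).trans ?_
      rw [norm_pauli, sq]
      exact mul_le_mul (hb x) (hb' x j) (norm_nonneg _) hC
    · refine (norm_inner_le_norm _ _).trans ?_
      rw [norm_pauli, sq]
      exact mul_le_mul (hb' x j) (hb x) (norm_nonneg _) hC
  have i3 : ∀ j : Fin 2, Integrable (fun x => weight x •
      (inner ℂ (w x) (act (pauli j) (w x)) : ℂ)) volume := by
    intro j
    refine hdom _ (C ^ 2) (contDiff_weight.continuous.smul (hF j).continuous) fun x => ?_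
    rw [norm_smul, mul_comm, Real.norm_eq_abs, abs_of_pos (weight_pos x)]
    exact mul_le_mul_of_nonneg_right ((hFb j x).trans (hwsq x)) (weight_pos x).le
  have i4 : Integrable (fun x => weight x * ‖w x‖ ^ 2) volume := by
    refine (hwt.const_mul (C ^ 2)).mono'
      (contDiff_weight.continuous.mul (hw.continuous.norm.pow 2)).aestronglyMeasurable
      (ae_of_all _ fun x => ?_)
    have h2 := weight_pos x
    rw [Real.norm_eq_abs, abs_of_nonneg (by positivity), mul_comm]
    exact mul_le_mul_of_nonneg_right (hwsq x) h2.le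
  have key : ∀ j : Fin 2, ∫ x, weight x • (fderiv ℝ (fun x => inner ℂ (w x) (act (pauli j) (w x))) x
      (EuclideanSpace.single j 1) : ℂ) = -∫ x, (fderiv ℝ weight x (EuclideanSpace.single j 1)) •
      (inner ℂ (w x) (act (pauli j) (w x)) : ℂ) := fun j =>
    integral_smul_fderiv_eq_neg_fderiv_smul_of_integrable (i1 j) (i2 j) (i3 j)
      (fun x _ => contDiff_weight.differentiable one_ne_zero x)
      (fun x _ => (hF j).differentiable one_ne_zero x)
  have hsum : ∀ x, ∑ j : Fin 2, weight x • (fderiv ℝ (fun x => inner ℂ (w x) (act (pauli j) (w x))) x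
      (EuclideanSpace.single j 1) : ℂ) = ((2 * ε * (weight x * ‖w x‖ ^ 2) : ℝ) : ℂ) := by
    intro x
    simp_rw [hdF]
    rw [← Finset.smul_sum, Finset.sum_add_distrib, ← inner_sum, ← sum_inner, h x, inner_smul_left,
      inner_smul_right, inner_self_eq_norm_sq_to_K, Complex.real_smul]
    push_cast
    simp
    ring
  have htot : ((2 * ε * ∫ x, weight x * ‖w x‖ ^ 2 : ℝ) : ℂ) =
      -∑ j : Fin 2, ∫ x, (fderiv ℝ weight x (EuclideanSpace.single j 1)) •
      (inner ℂ (w x) (act (pauli j) (w x)) : ℂ) := by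
    rw [← integral_const_mul, ← integral_complex_ofReal, ← Finset.sum_neg_distrib]
    simp_rw [← key, ← hsum]
    exact integral_finsetSum _ fun j _ => i2 j
  -- After integration by parts each coordinate costs at most half of the weighted integral of
  -- `|w|²`. Thus twice this integral is at most the integral itself, which must vanish.
  have hle : 2 * ∫ x, weight x * ‖w x‖ ^ 2 ≤ ∫ x, weight x * ‖w x‖ ^ 2 := by
    have hI : 0 ≤ ∫ x, weight x * ‖w x‖ ^ 2 :=
      integral_nonneg fun x => mul_nonneg (weight_pos x).le (by positivity)
    have hn := congrArg norm htot
    rw [Complex.norm_real, Real.norm_eq_abs, abs_mul, abs_mul, hε, abs_of_nonneg hI, norm_neg] at hn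
    rw [mul_one, abs_two] at hn
    rw [hn]
    have hj : ∀ j : Fin 2, ‖∫ x, (fderiv ℝ weight x (EuclideanSpace.single j 1)) •
        (inner ℂ (w x) (act (pauli j) (w x)) : ℂ)‖ ≤ ∫ x, weight x * ‖w x‖ ^ 2 / 2 := by
      intro j
      refine norm_integral_le_of_norm_le (i4.div_const 2) (ae_of_all _ fun x => ?_)
      rw [norm_smul, Real.norm_eq_abs]
      have h1 := abs_fderiv_weight_le x j
      have := mul_le_mul h1 (hFb j x) (norm_nonneg _) (by have := weight_pos x; positivity)
      linarith
    refine (norm_sum_le _ _).trans ?_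
    rw [Fin.sum_univ_two]
    refine (add_le_add (hj 0) (hj 1)).trans ?_
    rw [integral_div]
    linarith
  have h0 : ∫ x, weight x * ‖w x‖ ^ 2 = 0 :=
    le_antisymm (by linarith) (integral_nonneg fun x => mul_nonneg (weight_pos x).le (by positivity))
  rw [integral_eq_zero_iff_of_nonneg (fun x => mul_nonneg (weight_pos x).le (by positivity)) i4]
    at h0
  replace h0 := (Continuous.ae_eq_iff_eq volume
    (contDiff_weight.continuous.mul (hw.continuous.norm.pow 2)) continuous_zero).1 h0
  funext x
  have hx := congrFun h0 x
  simpa [(weight_pos x).ne'] using hx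

/-! ### Regularity on the whole plane -/

/-- The Dirac operator `-i (σ₁ ∂₁ + σ₂ ∂₂)` on test functions. -/
def diracOp : testSpace →ₗ[ℂ] testSpace :=
  (-Complex.I) • ∑ j, mapVal (act (pauli j)) ∘ₗ pd j

lemma diracOp_apply (φ : testSpace) :
    diracOp φ = (-Complex.I) • (mapVal (act (pauli 0)) (pd 0 φ) +
      mapVal (act (pauli 1)) (pd 1 φ)) := by
  simp [diracOp, Fin.sum_univ_two]

lemma mapVal_pauli_mapVal_pauli (j : Fin 2) (φ : testSpace) :
    mapVal (act (pauli j)) (mapVal (act (pauli j)) φ) = φ := by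
  ext1
  funext x
  rw [mapVal_apply, mapVal_apply, act_act, pauli_mul_self, act_one]

lemma mapVal_pauli_anticomm (φ : testSpace) :
    mapVal (act (pauli 0)) (mapVal (act (pauli 1)) φ) =
      -mapVal (act (pauli 1)) (mapVal (act (pauli 0)) φ) := by
  ext1
  funext x
  change act (pauli 0) (act (pauli 1) _) = -act (pauli 1) (act (pauli 0) _)
  rw [act_act, act_act, pauli_anticomm, ← neg_one_smul ℂ, act_smul, neg_one_smul]

/-- The square of the Dirac operator is `-Δ`. -/
lemma diracOp_diracOp (φ : testSpace) :
    diracOp (diracOp φ) = -(pd 0 (pd 0 φ) + pd 1 (pd 1 φ)) := by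
  rw [diracOp_apply, diracOp_apply φ]
  simp only [map_smul, map_add, pd_mapVal, mapVal_pauli_mapVal_pauli, mapVal_pauli_anticomm,
    pd_comm 1 0]
  rw [← smul_add, smul_smul, neg_mul_neg, Complex.I_mul_I, neg_one_smul]
  abel_nf

lemma inner_pd_left (j : Fin 2) (φ η : testSpace) :
    inner ℂ (toL2 (volume.restrict univ) (pd j φ)) (toL2 (volume.restrict univ) η) =
      -inner ℂ (toL2 (volume.restrict univ) φ) (toL2 (volume.restrict univ) (pd j η)) := by
  rw [eq_neg_iff_add_eq_zero, inner_pd_add_inner_pd, Measure.restrict_univ]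
  exact integral_fderiv_eq_zero (contDiff_inner φ η) (hasCompactSupport_inner φ η) _

lemma inner_mapVal_pauli_left {μ : Measure Plane} [IsFiniteMeasureOnCompacts μ] (j : Fin 2)
    (φ η : testSpace) : inner ℂ (toL2 μ (mapVal (act (pauli j)) φ)) (toL2 μ η) =
      inner ℂ (toL2 μ φ) (toL2 μ (mapVal (act (pauli j)) η)) := by
  rw [inner_toL2_toL2, inner_toL2_toL2]
  simp_rw [mapVal_apply, inner_pauli_left]

lemma inner_diracOp_left (φ η : testSpace) :
    inner ℂ (toL2 (volume.restrict univ) (diracOp φ)) (toL2 (volume.restrict univ) η) =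
      inner ℂ (toL2 (volume.restrict univ) φ) (toL2 (volume.restrict univ) (diracOp η)) := by
  simp only [diracOp_apply, map_smul, map_add, inner_smul_left, inner_smul_right, inner_add_left,
    inner_add_right, inner_mapVal_pauli_left, inner_pd_left, pd_mapVal]
  simp only [map_neg, Complex.conj_I]
  ring

/-- Symmetry and `T² = -Δ`: `‖Tφ‖² = ⟨φ, T²φ⟩`, followed by integration by parts. Thus `Tφ` alone
controls all first derivatives. -/
lemma norm_sq_diracOp (φ : testSpace) :
    ‖toL2 (volume.restrict univ) (diracOp φ)‖ ^ 2 =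
      ‖toL2 (volume.restrict univ) (pd 0 φ)‖ ^ 2 + ‖toL2 (volume.restrict univ) (pd 1 φ)‖ ^ 2 := by
  have h := inner_diracOp_left φ (diracOp φ)
  rw [diracOp_diracOp, map_neg, map_add, inner_neg_right, inner_add_right, neg_add,
    ← inner_pd_left, ← inner_pd_left] at h
  simp only [inner_self_eq_norm_sq_to_K] at h
  exact_mod_cast h

lemma norm_pd_le (j : Fin 2) (φ : testSpace) :
    ‖toL2 (volume.restrict univ) (pd j φ)‖ ≤ ‖toL2 (volume.restrict univ) (diracOp φ)‖ := by
  have h := norm_sq_diracOp φ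
  refine le_of_sq_le_sq ?_ (norm_nonneg _)
  fin_cases j <;> simp only [Fin.zero_eta, Fin.mk_one] <;> rw [h] <;> nlinarith [norm_nonneg
    (toL2 (volume.restrict univ) (pd 0 φ)), norm_nonneg (toL2 (volume.restrict univ) (pd 1 φ))]

/-- The cross terms cancel because `T` is symmetric and `i` is imaginary. -/
lemma norm_sq_diracOp_add_I (φ : testSpace) :
    ‖toL2 (volume.restrict univ) (diracOp φ + Complex.I • φ)‖ ^ 2 =
      ‖toL2 (volume.restrict univ) (diracOp φ)‖ ^ 2 + ‖toL2 (volume.restrict univ) φ‖ ^ 2 := by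
  have h1 : ∀ a : L2 univ, ((‖a‖ ^ 2 : ℝ) : ℂ) = inner ℂ a a := fun a => by
    rw [inner_self_eq_norm_sq_to_K]
    simp
  apply Complex.ofReal_injective
  rw [Complex.ofReal_add, h1, h1, h1, map_add, map_smul, inner_add_left, inner_add_right,
    inner_add_right, inner_smul_left, inner_smul_right, inner_smul_left, inner_smul_right,
    inner_diracOp_left φ φ]
  simp only [Complex.conj_I]
  linear_combination (-(inner ℂ (toL2 (volume.restrict univ) φ) (toL2 (volume.restrict univ) φ))) *
    Complex.I_mul_I

lemma memLp_volume (v : L2 univ) : MemLp (v : Plane → Spinor) 2 (volume : Measure Plane) :=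
  (Lp.memLp v).mono_measure (by rw [Measure.restrict_univ])

/-! ### Mollification of `L²` functions -/

section Convolution

variable {v : Plane → Spinor} {χ : Plane → ℝ}

/-- Convolutions of `L²` functions with test functions are bounded. -/
lemma exists_norm_integral_le (hv : MemLp v 2 volume) (hχ : Continuous χ)
    (hc : HasCompactSupport χ) : ∃ C, ∀ x, ‖∫ t, χ (x - t) • v t‖ ≤ C := by
  have hv2 : Integrable (fun t => ‖v t‖ ^ 2) volume := by
    exact_mod_cast hv.integrable_norm_pow two_ne_zero
  have hχ2 : Continuous fun t => χ t ^ 2 := hχ.pow 2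
  have hc2 : HasCompactSupport fun t => χ t ^ 2 :=
    hc.comp_left (g := fun a : ℝ => a ^ 2) (by norm_num)
  have hi : Integrable (fun t => χ t ^ 2) volume := hχ2.integrable_of_hasCompactSupport hc2
  refine ⟨((∫ t, χ t ^ 2) + ∫ t, ‖v t‖ ^ 2) / 2, fun x => ?_⟩
  have hx : Integrable (fun t => χ (x - t) ^ 2) volume := hi.comp_sub_left x
  have hsum : ∫ t, (χ (x - t) ^ 2 + ‖v t‖ ^ 2) / 2 = ((∫ t, χ t ^ 2) + ∫ t, ‖v t‖ ^ 2) / 2 := by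
    rw [integral_div, integral_add hx hv2, integral_sub_left_eq_self (fun t => χ t ^ 2) volume x]
  rw [← hsum]
  refine norm_integral_le_of_norm_le ((hx.add hv2).div_const 2) (ae_of_all _ fun t => ?_)
  rw [norm_smul, Real.norm_eq_abs, ← sq_abs (χ (x - t))]
  nlinarith [sq_nonneg (|χ (x - t)| - ‖v t‖)]

lemma integral_smul_eq_convolution : (fun x => ∫ t, χ (x - t) • v t) =
    convolution χ v (ContinuousLinearMap.lsmul ℝ ℝ : ℝ →L[ℝ] Spinor →L[ℝ] Spinor) volume := by
  funext x
  rw [convolution_eq_swap]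
  rfl

lemma fderiv_integral_smul (hv : MemLp v 2 volume) (hχ : ContDiff ℝ ∞ χ)
    (hc : HasCompactSupport χ) (x e : Plane) :
    fderiv ℝ (fun x => ∫ t, χ (x - t) • v t) x e = ∫ t, fderiv ℝ χ (x - t) e • v t := by
  have hvl : LocallyIntegrable v volume := hv.locallyIntegrable (by norm_num)
  have hex := ((hc.fderiv (𝕜 := ℝ)).convolutionExists_left (ContinuousLinearMap.precompL Plane
    (ContinuousLinearMap.lsmul ℝ ℝ : ℝ →L[ℝ] Spinor →L[ℝ] Spinor))
    (hχ.continuous_fderiv (by simp)) hvl x).integrable_swap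
  rw [integral_smul_eq_convolution,
    (hc.hasFDerivAt_convolution_left _ (hχ.of_le (by simp)) hvl x).fderiv,
    convolution_eq_swap, ContinuousLinearMap.integral_apply hex]
  rfl

lemma contDiff_integral_smul (hv : MemLp v 2 volume) (hχ : ContDiff ℝ ∞ χ)
    (hc : HasCompactSupport χ) : ContDiff ℝ 1 fun x => ∫ t, χ (x - t) • v t := by
  rw [integral_smul_eq_convolution]
  exact hc.contDiff_convolution_left (n := 1) _ (hχ.of_le (by simp))
    (hv.locallyIntegrable (by norm_num))

end Convolution

/-- The Pauli matrices are hermitian and constant, so they move onto the other factor; the weak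
equation thereby becomes a pointwise one for the mollified function. -/
lemma toL2_diracOp_tensor_inner (χ : Plane → ℝ) (hχ : ContDiff ℝ ∞ χ) (hc : HasCompactSupport χ)
    (c : Spinor) (v : L2 univ) :
    inner ℂ (toL2 (volume.restrict univ) (diracOp (tensor χ hχ hc c))) v =
      Complex.I * inner ℂ c (∑ j, act (pauli j)
        (∫ x, fderiv ℝ χ x (EuclideanSpace.single j 1) • v x)) := by
  have h : ∀ j, mapVal (act (pauli j)) (pd j (tensor χ hχ hc c)) =
      pd j (tensor χ hχ hc (act (pauli j) c)) := by
    intro j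
    ext1
    funext x
    rw [mapVal_apply, pd_tensor, pd_tensor]
    exact ((act (pauli j)).restrictScalars ℝ).map_smul _ _
  rw [diracOp_apply, map_smul, map_add, inner_smul_left, inner_add_left, h, h,
    inner_pd_tensor_left, inner_pd_tensor_left, Fin.sum_univ_two, inner_add_right,
    inner_pauli_left, inner_pauli_left, setIntegral_univ, setIntegral_univ]
  simp

/-- The Dirac operator on the plane has no `L²` eigenfunctions with eigenvalue `± i`. -/
lemma eq_zero_of_inner_diracOp {v : L2 univ} {ε : ℝ} (hε : |ε| = 1)
    (h : ∀ φ, inner ℂ (toL2 (volume.restrict univ) (diracOp φ)) v =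
      ε * Complex.I * inner ℂ (toL2 (volume.restrict univ) φ) v) : v = 0 := by
  have hv := memLp_volume v
  have key : ∀ (χ : Plane → ℝ), ContDiff ℝ ∞ χ → HasCompactSupport χ →
      ∀ x, ∫ t, χ (x - t) • v t = 0 := by
    intro χ hχ hc
    have hpar : ∀ j : Fin 2, ∃ C, ∀ x,
        ‖∫ t, fderiv ℝ χ (x - t) (EuclideanSpace.single j 1) • v t‖ ≤ C := fun j =>
      exists_norm_integral_le (χ := fun x => fderiv ℝ χ x (EuclideanSpace.single j 1)) hv
        ((hχ.continuous_fderiv (by simp)).clm_apply continuous_const) (hc.fderiv_apply (𝕜 := ℝ) _)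
    obtain ⟨C, hC⟩ := exists_norm_integral_le hv hχ.continuous hc
    choose C' hC' using hpar
    have hD := fderiv_integral_smul hv hχ hc
    -- The mollification of `v` is bounded with bounded derivatives, so the Liouville theorem
    -- applies. The sign is `-ε` because the test function is `t ↦ χ(x - t)`, whose derivative in
    -- `t` is minus that of `χ`.
    refine congrFun (eq_zero_of_dirac_eq (contDiff_integral_smul hv hχ hc)
      (C := max C (max (C' 0) (C' 1))) (fun x => (hC x).trans (le_max_left _ _)) (fun x j => ?_)
      (ε := -ε) (by rwa [abs_neg]) fun x => ?_)
    · rw [hD]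
      refine (hC' j x).trans ((?_ : C' j ≤ _).trans (le_max_right _ _))
      fin_cases j
      exacts [le_max_left _ _, le_max_right _ _]
    · have hχ' : ContDiff ℝ ∞ fun t => χ (x - t) := hχ.comp (contDiff_const.sub contDiff_id)
      have hc' : HasCompactSupport fun t => χ (x - t) :=
        hc.comp_homeomorph (Homeomorph.subLeft x)
      have hfd : ∀ t e, fderiv ℝ (fun t => χ (x - t)) t e = -fderiv ℝ χ (x - t) e := by
        intro t e
        have h1 := (hχ.differentiable (by simp) (x - t)).hasFDerivAt.comp t
          ((hasFDerivAt_id t).const_sub x)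
        have h2 : fderiv ℝ (fun t => χ (x - t)) t = _ := h1.fderiv
        rw [h2]
        simp
      refine ext_inner_left ℂ fun c => ?_
      have hx := h (tensor _ hχ' hc' c)
      rw [toL2_diracOp_tensor_inner, inner_tensor_left, setIntegral_univ] at hx
      simp_rw [hfd, neg_smul, integral_neg, map_neg, Finset.sum_neg_distrib, inner_neg_right] at hx
      simp_rw [hD]
      rw [inner_smul_right]
      apply mul_left_cancel₀ Complex.I_ne_zero
      push_cast
      linear_combination -hx
  refine eq_zero_of_inner_eq_zero fun φ => ?_
  have h0 : ∀ᵐ x ∂(volume : Measure Plane), v x = 0 := by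
    refine ae_eq_zero_of_integral_contDiff_smul_eq_zero (hv.locallyIntegrable (by norm_num))
      fun χ hχ hc => ?_
    -- Mollifying with the reflected kernel and evaluating at `0` gives back `∫ χ v`.
    have := key (fun t => χ (-t)) (hχ.comp contDiff_neg)
      (hc.comp_homeomorph (Homeomorph.neg Plane)) 0
    simpa using this
  rw [inner_toL2_left, setIntegral_univ]
  refine integral_eq_zero_of_ae ?_
  filter_upwards [h0] with x hx
  rw [hx, inner_zero_right]
  rfl

lemma exists_tendsto_of_norm_le {A B : testSpace →ₗ[ℂ] L2 univ} (h : ∀ φ, ‖A φ‖ ≤ ‖B φ‖)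
    {φ : ℕ → testSpace} {w : L2 univ} (hB : Tendsto (fun n => B (φ n)) atTop (𝓝 w)) :
    ∃ u, Tendsto (fun n => A (φ n)) atTop (𝓝 u) := by
  refine cauchySeq_tendsto_of_complete ?_
  rw [cauchySeq_iff_tendsto_dist_atTop_0]
  have hd := cauchySeq_iff_tendsto_dist_atTop_0.1 hB.cauchySeq
  refine squeeze_zero (fun _ => dist_nonneg) (fun n => ?_) hd
  rw [dist_eq_norm, dist_eq_norm, ← map_sub, ← map_sub]
  exact h _

/-- A vector orthogonal to the range of `T + i` on test functions is a weak `L²` eigenfunction of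
`T` with eigenvalue `i`, hence zero. -/
lemma exists_tendsto_diracOp_add_I (w : L2 univ) : ∃ φ : ℕ → testSpace,
    Tendsto (fun n => toL2 (volume.restrict univ) (diracOp (φ n) + Complex.I • φ n)) atTop
      (𝓝 w) := by
  let A : testSpace →ₗ[ℂ] L2 univ :=
    toL2 (volume.restrict univ) ∘ₗ (diracOp + Complex.I • LinearMap.id)
  have hA : (LinearMap.range A).topologicalClosure = ⊤ := by
    rw [Submodule.topologicalClosure_eq_top_iff, Submodule.eq_bot_iff]
    intro v hv
    refine eq_zero_of_inner_diracOp (ε := 1) abs_one fun φ => ?_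
    have h := hv (A φ) ⟨φ, rfl⟩
    have hAφ : A φ = toL2 (volume.restrict univ) (diracOp φ) +
        Complex.I • toL2 (volume.restrict univ) φ := by
      simp [A]
    rw [hAφ, inner_add_left, inner_smul_left, Complex.conj_I] at h
    push_cast
    linear_combination h
  have hw : w ∈ closure (LinearMap.range A : Set (L2 univ)) := by
    rw [← Submodule.topologicalClosure_coe, hA]
    trivial
  obtain ⟨x, hx, hlim⟩ := mem_closure_iff_seq_limit.1 hw
  choose φ hφ using hx
  refine ⟨φ, hlim.congr fun n => ?_⟩
  rw [← hφ n]
  rfl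

/-- If `Tψ = θ` weakly on the plane, then `ψ` is a limit of test functions in `H¹`. -/
lemma exists_tendsto_of_inner_diracOp {ψ θ : L2 univ}
    (h : ∀ φ, inner ℂ ψ (toL2 (volume.restrict univ) (diracOp φ)) =
      inner ℂ θ (toL2 (volume.restrict univ) φ)) :
    ∃ (φ : ℕ → testSpace) (d : Fin 2 → L2 univ),
      Tendsto (fun n => toL2 (volume.restrict univ) (φ n)) atTop (𝓝 ψ) ∧
      (∀ j, Tendsto (fun n => toL2 (volume.restrict univ) (pd j (φ n))) atTop (𝓝 (d j))) ∧
      Tendsto (fun n => toL2 (volume.restrict univ) (diracOp (φ n))) atTop (𝓝 θ) := by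
  -- The sequence is chosen so that `(T + i)φ_n` tends to the expected `(T + i)ψ`. The energy
  -- identities then make `φ_n`, its derivatives and `Tφ_n` Cauchy; it remains to identify the
  -- limits.
  obtain ⟨φ, hφ⟩ := exists_tendsto_diracOp_add_I (θ + Complex.I • ψ)
  have hle1 : ∀ φ, ‖toL2 (volume.restrict univ) φ‖ ≤
      ‖toL2 (volume.restrict univ) (diracOp φ + Complex.I • φ)‖ := fun φ =>
    le_of_sq_le_sq (by rw [norm_sq_diracOp_add_I]; exact le_add_of_nonneg_left (sq_nonneg _))
      (norm_nonneg _)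
  have hle2 : ∀ φ, ‖toL2 (volume.restrict univ) (diracOp φ)‖ ≤
      ‖toL2 (volume.restrict univ) (diracOp φ + Complex.I • φ)‖ := fun φ =>
    le_of_sq_le_sq (by rw [norm_sq_diracOp_add_I]; exact le_add_of_nonneg_right (sq_nonneg _))
      (norm_nonneg _)
  let B : testSpace →ₗ[ℂ] L2 univ :=
    toL2 (volume.restrict univ) ∘ₗ (diracOp + Complex.I • LinearMap.id)
  have hB : Tendsto (fun n => B (φ n)) atTop (𝓝 (θ + Complex.I • ψ)) := hφ
  obtain ⟨ψ', hψ'⟩ := exists_tendsto_of_norm_le (A := toL2 (volume.restrict univ)) (B := B) hle1 hB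
  obtain ⟨θ', hθ'⟩ := exists_tendsto_of_norm_le (A := toL2 (volume.restrict univ) ∘ₗ diracOp)
    (B := B) hle2 hB
  have hd : ∀ j : Fin 2, ∃ d, Tendsto (fun n => toL2 (volume.restrict univ) (pd j (φ n))) atTop
      (𝓝 d) := fun j =>
    exists_tendsto_of_norm_le (A := toL2 (volume.restrict univ) ∘ₗ pd j) (B := B)
      (fun η => (norm_pd_le j η).trans (hle2 η)) hB
  choose d hd using hd
  have hsum : θ' + Complex.I • ψ' = θ + Complex.I • ψ := by
    refine tendsto_nhds_unique ((hθ'.add (hψ'.const_smul Complex.I)).congr fun n => ?_) hφ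
    rw [map_add, map_smul]
    rfl
  have hsymm : ∀ η, inner ℂ ψ' (toL2 (volume.restrict univ) (diracOp η)) =
      inner ℂ θ' (toL2 (volume.restrict univ) η) := fun η =>
    tendsto_nhds_unique (hψ'.inner tendsto_const_nhds)
      ((hθ'.inner tendsto_const_nhds).congr fun n => inner_diracOp_left _ _)
  have hdiff : θ - θ' = -(Complex.I • (ψ - ψ')) := by
    rw [smul_sub, neg_sub, sub_eq_sub_iff_add_eq_add, ← hsum, add_comm]
  -- The difference satisfies `T(ψ - ψ') = -i(ψ - ψ')` weakly, so it vanishes.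
  have hz : ψ - ψ' = 0 := by
    refine eq_zero_of_inner_diracOp (ε := -1) (by simp) fun η => ?_
    have h1 : inner ℂ (ψ - ψ') (toL2 (volume.restrict univ) (diracOp η)) =
        inner ℂ (θ - θ') (toL2 (volume.restrict univ) η) := by
      rw [inner_sub_left, inner_sub_left, h, hsymm]
    rw [hdiff, inner_neg_left, inner_smul_left, Complex.conj_I] at h1
    have h2 := congrArg (starRingEnd ℂ) h1
    rw [inner_conj_symm, map_neg, map_mul, inner_conj_symm, map_neg, Complex.conj_I] at h2
    rw [h2]
    push_cast
    ring
  rw [hz, smul_zero, neg_zero, sub_eq_zero] at hdiff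
  rw [sub_eq_zero] at hz
  subst hz hdiff
  exact ⟨φ, d, hψ', hd, hθ'⟩

lemma hasWeakPartial_toL2 (j : Fin 2) (φ : testSpace) :
    HasWeakPartial univ j (toL2 (volume.restrict univ) φ) (toL2 (volume.restrict univ) (pd j φ)) :=
  hasWeakPartial_iff.2 fun _ _ _ _ _ => inner_pd_left j _ _

/-- The value of `-i (σ₁ ∂₁ + σ₂ ∂₂)` in terms of the partial derivatives `d`. -/
def diracVal {μ : Measure Plane} (d : Fin 2 → Lp Spinor 2 μ) : Lp Spinor 2 μ :=
  (-Complex.I) • ((act (pauli 0)).compLpL 2 μ (d 0) + (act (pauli 1)).compLpL 2 μ (d 1))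

lemma coeFn_diracVal {μ : Measure Plane} (d : Fin 2 → Lp Spinor 2 μ) :
    (diracVal d : Plane → Spinor) =ᵐ[μ]
      fun x => (-Complex.I) • (act sigma1 (d 0 x) + act sigma2 (d 1 x)) := by
  filter_upwards [Lp.coeFn_smul (-Complex.I) ((act (pauli 0)).compLpL 2 μ (d 0) +
    (act (pauli 1)).compLpL 2 μ (d 1)), Lp.coeFn_add ((act (pauli 0)).compLpL 2 μ (d 0))
    ((act (pauli 1)).compLpL 2 μ (d 1)), ContinuousLinearMap.coeFn_compLpL (act (pauli 0)) (d 0),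
    ContinuousLinearMap.coeFn_compLpL (act (pauli 1)) (d 1)] with x h1 h2 h3 h4
  rw [diracVal, h1, Pi.smul_apply, h2, Pi.add_apply, h3, h4]
  rfl

lemma toL2_diracOp {μ : Measure Plane} [IsFiniteMeasureOnCompacts μ] (φ : testSpace) :
    toL2 μ (diracOp φ) = diracVal fun j => toL2 μ (pd j φ) := by
  rw [diracOp_apply, map_smul, map_add, toL2_mapVal, toL2_mapVal]
  rfl

lemma tendsto_diracVal {μ : Measure Plane} {dn : ℕ → Fin 2 → Lp Spinor 2 μ}
    {d : Fin 2 → Lp Spinor 2 μ} (h : ∀ j, Tendsto (fun n => dn n j) atTop (𝓝 (d j))) :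
    Tendsto (fun n => diracVal (dn n)) atTop (𝓝 (diracVal d)) :=
  ((((((act (pauli 0)).compLpL 2 μ).continuous.tendsto _).comp (h 0)).add
    ((((act (pauli 1)).compLpL 2 μ).continuous.tendsto _).comp (h 1))).const_smul _)

lemma restr_diracVal (O : Set Plane) (d : Fin 2 → L2 univ) :
    restr O (diracVal d) = diracVal fun j => restr O (d j) := by
  apply Lp.ext
  have h := (coeFn_diracVal d).filter_mono
    (ae_mono (Measure.restrict_mono (subset_univ O) (le_refl volume)))
  filter_upwards [h, coeFn_restr O (diracVal d), coeFn_restr O (d 0), coeFn_restr O (d 1),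
    coeFn_diracVal fun j => restr O (d j)] with x h1 h2 h3 h4 h5
  rw [h2, h1, h5, h3, h4]

/-- A weak solution of `Tψ = θ` on the plane has a trace on `∂Ω`. -/
lemma exists_hasTraceData {Ω : Set Plane} [IsLocallyFiniteMeasure (bdMeasure Ω)]
    (hΩ : IsAdmissible Ω) {ψ θ : L2 univ}
    (h : ∀ φ, inner ℂ ψ (toL2 (volume.restrict univ) (diracOp φ)) =
      inner ℂ θ (toL2 (volume.restrict univ) φ)) :
    ∃ d ρ, (∀ j, HasWeakPartial univ j ψ (d j)) ∧ HasTraceData Ω univ ψ d ρ ∧ θ = diracVal d := by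
  obtain ⟨φ, d, h1, h2, h3⟩ := exists_tendsto_of_inner_diracOp h
  obtain ⟨ρ, hρ⟩ := exists_tendsto_boundary hΩ h1 h2
  refine ⟨d, ρ, fun j => HasWeakPartial.of_tendsto (fun n => hasWeakPartial_toL2 j (φ n)) h1 (h2 j),
    ⟨φ, h1, h2, hρ⟩, tendsto_nhds_unique h3 ?_⟩
  simp_rw [toL2_diracOp]
  exact tendsto_diracVal h2

/-! ### The graphs of the Dirac operators -/

section Graph

variable {O : Set Plane} {M : Plane → ℝ} {D : Submodule ℂ (L2 O)}

/-- The graph only provides some family of weak derivatives; by uniqueness any known family computes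
the operator. -/
lemma ae_eq_of_mem_diracGraph (hO : MeasurableSet O) (hf : volume (frontier O) = 0)
    {q : L2 O × L2 O} (hq : q ∈ diracGraph O M D) {d : Fin 2 → L2 O}
    (hd : ∀ j, HasWeakPartial O j q.1 (d j)) :
    (q.2 : Plane → Spinor) =ᵐ[volume.restrict O]
      fun x => diracVal d x + ((M x : ℝ) : ℂ) • act sigma3 (q.1 x) := by
  obtain ⟨-, d', hd', h⟩ := hq
  obtain rfl : d' = d := funext fun j => (hd' j).unique hO hf (hd j)
  filter_upwards [h, coeFn_diracVal d'] with x h1 h2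
  rw [h1, h2]

lemma diracGraph_snd_eq_zero (hO : MeasurableSet O) (hf : volume (frontier O) = 0)
    (q : L2 O × L2 O) (hq : q ∈ diracGraph O M D) (h0 : q.1 = 0) : q.2 = 0 := by
  have h := ae_eq_of_mem_diracGraph hO hf hq (d := 0) fun j => by
    rw [h0]
    exact HasWeakPartial.zero O j
  have hz : diracVal (0 : Fin 2 → L2 O) = 0 := by simp [diracVal]
  rw [Lp.eq_zero_iff_ae_eq_zero]
  filter_upwards [h, Lp.coeFn_zero Spinor 2 (volume.restrict O)] with x h1 h2
  rw [h1, h0, hz, h2]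
  simp

/-- Single-valuedness is what makes the partial map built from the graph have that graph again. -/
lemma graph_dirac (hO : MeasurableSet O) (hf : volume (frontier O) = 0) :
    (dirac O M D).graph = diracGraph O M D :=
  Submodule.toLinearPMap_graph_eq _ fun q hq h0 => diracGraph_snd_eq_zero hO hf q hq h0

lemma opResolvent_mem_diracGraph (hO : MeasurableSet O) (hf : volume (frontier O) = 0) {z : ℂ}
    (hz : z ∈ opResolventSet (dirac O M D)) (g : L2 O) :
    (opResolvent (dirac O M D) z g, g + z • opResolvent (dirac O M D) z g) ∈
      diracGraph O M D := by
  obtain ⟨u, hu, hg⟩ := (opResolvent_spec hz).1 g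
  have h := (dirac O M D).mem_graph u
  rw [graph_dirac hO hf] at h
  rw [← hu]
  convert h using 2
  rw [← hg, sub_add_cancel]

lemma opResolvent_apply_of_mem_diracGraph (hO : MeasurableSet O) (hf : volume (frontier O) = 0)
    {z : ℂ} (hz : z ∈ opResolventSet (dirac O M D)) {u w : L2 O} (h : (u, w) ∈ diracGraph O M D) :
    opResolvent (dirac O M D) z (w - z • u) = u := by
  rw [← graph_dirac hO hf, LinearPMap.mem_graph_iff] at h
  obtain ⟨y, hy, hw⟩ := h
  simp only at hy hw
  rw [← hy, ← hw]
  exact (opResolvent_spec hz).2 y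

end Graph

/-! ### The mass term -/

lemma restr_add (O : Set Plane) (u v : L2 univ) : restr O (u + v) = restr O u + restr O v := by
  apply Lp.ext
  have h := (Lp.coeFn_add u v).filter_mono
    (ae_mono (Measure.restrict_mono (subset_univ O) (le_refl volume)))
  filter_upwards [h, coeFn_restr O (u + v), coeFn_restr O u, coeFn_restr O v,
    Lp.coeFn_add (restr O u) (restr O v)] with x h1 h2 h3 h4 h5
  rw [h2, h1, h5, Pi.add_apply, Pi.add_apply, h3, h4]

lemma restr_smul (O : Set Plane) (c : ℂ) (u : L2 univ) : restr O (c • u) = c • restr O u := by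
  apply Lp.ext
  have h := (Lp.coeFn_smul c u).filter_mono
    (ae_mono (Measure.restrict_mono (subset_univ O) (le_refl volume)))
  filter_upwards [h, coeFn_restr O (c • u), coeFn_restr O u,
    Lp.coeFn_smul c (restr O u)] with x h1 h2 h3 h4
  rw [h2, h1, h4, Pi.smul_apply, Pi.smul_apply, h3]

/-- Multiplication by `σ₃` on `L²`. -/
abbrev sigma3Val (μ : Measure Plane) : Lp Spinor 2 μ →L[ℂ] Lp Spinor 2 μ :=
  (act sigma3).compLpL 2 μ

lemma inner_compLpL_act_left {μ : Measure Plane} {A : Matrix (Fin 2) (Fin 2) ℂ}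
    (hA : A.conjTranspose = A) (u v : Lp Spinor 2 μ) :
    inner ℂ ((act A).compLpL 2 μ u) v = inner ℂ u ((act A).compLpL 2 μ v) := by
  rw [L2.inner_def, L2.inner_def]
  refine integral_congr_ae ?_
  filter_upwards [ContinuousLinearMap.coeFn_compLpL (act A) u,
    ContinuousLinearMap.coeFn_compLpL (act A) v] with x h1 h2
  rw [h1, h2, inner_act_left, hA]

/-- The mass term `m 1_{ℝ² ∖ Ω} σ₃ v`. -/
def massTerm {Ω : Set Plane} (hΩ : IsOpen Ω) (m : ℝ) (v : L2 univ) : L2 univ :=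
  glue hΩ 0 ((m : ℂ) • sigma3Val _ (restr Ωᶜ v))

section Mass

variable {Ω : Set Plane} (hΩ : IsOpen Ω)

lemma coeFn_massTerm (m : ℝ) (v : L2 univ) :
    (massTerm hΩ m v : Plane → Spinor) =ᵐ[volume.restrict univ]
      fun x => ((Ωᶜ.indicator (fun _ => m) x : ℝ) : ℂ) • act sigma3 (v x) := by
  have hR : ∀ O : Set Plane, (restr O (massTerm hΩ m v) : Plane → Spinor) =ᵐ[volume.restrict O]
      massTerm hΩ m v := fun O => coeFn_restr O _
  have h1 := hR Ω
  have h2 := hR Ωᶜ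
  rw [massTerm, restr_glue] at h1
  rw [massTerm, restr_compl_glue] at h2
  refine ae_restrict_of_ae (ae_of_ae_restrict_of_ae_restrict_compl Ω ?_ ?_)
  · filter_upwards [h1, Lp.coeFn_zero Spinor 2 (volume.restrict Ω),
      ae_restrict_mem hΩ.measurableSet] with x k1 k2 hx
    rw [massTerm, ← k1, k2, indicator_of_notMem (notMem_compl_iff.2 hx)]
    simp
  · filter_upwards [h2, Lp.coeFn_smul (m : ℂ) (sigma3Val (volume.restrict Ωᶜ) (restr Ωᶜ v)),
      ContinuousLinearMap.coeFn_compLpL (act sigma3) (restr Ωᶜ v), coeFn_restr Ωᶜ v,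
      ae_restrict_mem hΩ.measurableSet.compl] with x k1 k2 k3 k4 hx
    rw [massTerm, ← k1, k2, indicator_of_mem hx, Pi.smul_apply, k3, k4]

lemma inner_massTerm_left (m : ℝ) (u v : L2 univ) :
    inner ℂ (massTerm hΩ m u) v = inner ℂ u (massTerm hΩ m v) := by
  rw [inner_eq_add_restr hΩ.measurableSet, inner_eq_add_restr hΩ.measurableSet u, massTerm, massTerm,
    restr_glue, restr_glue, restr_compl_glue, restr_compl_glue, inner_zero_left, inner_zero_right,
    inner_smul_left, inner_smul_right, inner_compLpL_act_left conjTranspose_sigma3,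
    Complex.conj_ofReal]

lemma toL2_mem_diracGraph (m : ℝ) (φ : testSpace) :
    (toL2 (volume.restrict univ) φ,
      toL2 (volume.restrict univ) (diracOp φ) + massTerm hΩ m (toL2 (volume.restrict univ) φ)) ∈
      diracGraph univ (Ωᶜ.indicator fun _ => m) (H1 univ) := by
  have hd := fun j => hasWeakPartial_toL2 j φ
  refine ⟨⟨_, hd⟩, _, hd, ?_⟩
  filter_upwards [Lp.coeFn_add (toL2 (volume.restrict univ) (diracOp φ))
    (massTerm hΩ m (toL2 (volume.restrict univ) φ)),
    coeFn_massTerm hΩ m (toL2 (volume.restrict univ) φ),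
    coeFn_diracVal fun j => toL2 (volume.restrict univ) (pd j φ)] with x h1 h2 h3
  rw [h1, Pi.add_apply, h2, toL2_diracOp, h3]

/-- The equation satisfied by the adjoint resolvent. -/
lemma inner_adjoint_opResolvent {m : ℝ} {z : ℂ} (hz : z ∈ opResolventSet (Hm Ω m)) (f : L2 univ)
    (φ : testSpace) :
    inner ℂ (ContinuousLinearMap.adjoint (opResolvent (Hm Ω m) z) f)
        (toL2 (volume.restrict univ) (diracOp φ)) =
      inner ℂ (f + (-1 : ℂ) • massTerm hΩ m
        (ContinuousLinearMap.adjoint (opResolvent (Hm Ω m) z) f) +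
        (starRingEnd ℂ) z • ContinuousLinearMap.adjoint (opResolvent (Hm Ω m) z) f)
        (toL2 (volume.restrict univ) φ) := by
  -- Test functions lie in the domain of `H_m`, so `R_m (H_m - z) φ = φ`. Pairing with `f` gives the
  -- weak equation without appealing to self-adjointness of `H_m`.
  have h := opResolvent_apply_of_mem_diracGraph MeasurableSet.univ (by simp) hz
    (toL2_mem_diracGraph hΩ m φ)
  have h2 := ContinuousLinearMap.adjoint_inner_left (opResolvent (Hm Ω m) z)
    (toL2 (volume.restrict univ) (diracOp φ) + massTerm hΩ m (toL2 (volume.restrict univ) φ) -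
      z • toL2 (volume.restrict univ) φ) f
  rw [Hm] at h2 ⊢
  rw [h, inner_sub_right, inner_add_right, inner_smul_right] at h2
  rw [inner_add_left, inner_add_left, inner_smul_left, inner_smul_left, inner_massTerm_left,
    Complex.conj_conj]
  simp only [map_neg, map_one]
  linear_combination h2

end Mass

/-! ### Integration by parts for the Dirac operator -/

section Green

variable {Ω O : Set Plane} [IsLocallyFiniteMeasure (bdMeasure Ω)]

/-- Green's formula in direction `j`, with `σ_j v` in place of `v`, summed over `j`: a constant
hermitian matrix respects the approximation and crosses the scalar product. The boundary term is the
operator `-i(σ·n)` applied to `τ`. -/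
lemma HasTraceData.green_dirac (hΩ : IsAdmissible Ω) {s : ℂ} (hO : SatisfiesDivergence Ω O s)
    {u v : L2 O} {d e : Fin 2 → L2 O} {τ ρ : L2bd Ω} (hv : HasTraceData Ω O v d ρ)
    (hu : HasTraceData Ω O u e τ) :
    inner ℂ v (diracVal e) - inner ℂ (diracVal d) u =
      s * inner ℂ ρ (diracVal fun j => normalMul hΩ j τ) := by
  have h := fun j => (hv.map (act (pauli j))).green hΩ hO hu j
  simp only [inner_compLpL_act_left (conjTranspose_pauli _)] at h
  simp only [diracVal, inner_smul_left, inner_smul_right, inner_add_left, inner_add_right,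
    inner_compLpL_act_left (conjTranspose_pauli _), map_neg, Complex.conj_I]
  linear_combination (-Complex.I) * (h 0 + h 1)

/-- The resolvent identity on one of the two sides of the boundary. -/
lemma HasTraceData.inner_resolvent (hΩ : IsAdmissible Ω) {s : ℂ} (hO : SatisfiesDivergence Ω O s)
    {u v k F : L2 O} {d e : Fin 2 → L2 O} {τ ρ : L2bd Ω} (hv : HasTraceData Ω O v d ρ)
    (hu : HasTraceData Ω O u e τ) {m : ℝ} {z : ℂ}
    (hud : k + z • u = diracVal e + (m : ℂ) • sigma3Val _ u)
    (hvd : F + (-(m : ℂ)) • sigma3Val _ v + (starRingEnd ℂ) z • v = diracVal d) :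
    inner ℂ v k = inner ℂ F u + s * inner ℂ ρ (diracVal fun j => normalMul hΩ j τ) := by
  have h := hv.green_dirac hΩ hO hu
  have h1 := congrArg (fun w => inner ℂ v w) hud
  have h2 := congrArg (fun w => inner ℂ w u) hvd
  simp only [inner_add_left, inner_add_right, inner_smul_left, inner_smul_right,
    inner_compLpL_act_left conjTranspose_sigma3, Complex.conj_conj, map_neg,
    Complex.conj_ofReal] at h1 h2
  -- The terms in `z` cancel against those in its conjugate on the left, and the mass terms cancel
  -- because `σ₃` is hermitian and `m` real.
  linear_combination h + h1 - h2

end Green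

/-! ### The boundary terms -/

section Boundary

variable {Ω : Set Plane}

/-- `σ₃² = 1` gives `-i(σ·n) = σ₃ B`. -/
lemma coeFn_diracVal_normalMul (hΩ : IsAdmissible Ω) (τ : L2bd Ω) :
    (diracVal (fun j => normalMul hΩ j τ) : Plane → Spinor) =ᵐ[bdMeasure Ω] fun p =>
      act sigma3 (act (boundaryMatrix Ω p) (τ p)) := by
  filter_upwards [coeFn_diracVal (fun j => normalMul hΩ j τ), coeFn_normalMul hΩ 0 τ,
    coeFn_normalMul hΩ 1 τ] with p h1 h2 h3
  rw [h1, h2, h3, act_act, boundaryMatrix, mul_smul_comm, ← mul_assoc]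
  have h3 : sigma3 * sigma3 = 1 := by
    ext a b
    fin_cases a <;> fin_cases b <;> simp [sigma3, Matrix.mul_apply]
  rw [h3, one_mul, act_smul, act_add, act_smul, act_smul, map_smul, map_smul]

lemma conjTranspose_boundaryMatrix (p : Plane) :
    (boundaryMatrix Ω p).conjTranspose = boundaryMatrix Ω p := by
  ext a b
  fin_cases a <;> fin_cases b <;>
    simp [boundaryMatrix, sigma1, sigma2, sigma3] <;> ring

lemma boundaryMatrix_mul_sigma3 (p : Plane) :
    boundaryMatrix Ω p * sigma3 = -(sigma3 * boundaryMatrix Ω p) := by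
  ext a b
  fin_cases a <;> fin_cases b <;>
    simp [boundaryMatrix, sigma1, sigma2, sigma3, Matrix.mul_apply]

lemma Pminus_apply (p : Plane) (a : Spinor) :
    Pminus Ω p a = (1 / 2 : ℂ) • (a - act (boundaryMatrix Ω p) a) := by
  rw [Pminus, act_smul, act_sub, act_one]

lemma Pplus_apply (p : Plane) (a : Spinor) :
    Pplus Ω p a = (1 / 2 : ℂ) • (a + act (boundaryMatrix Ω p) a) := by
  rw [Pplus, act_smul, act_add, act_one]

lemma inner_boundaryMatrix_sigma3 (p : Plane) (a b : Spinor) :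
    inner ℂ (act (boundaryMatrix Ω p) a) (act sigma3 b) =
      -inner ℂ a (act sigma3 (act (boundaryMatrix Ω p) b)) := by
  rw [inner_act_left, conjTranspose_boundaryMatrix, act_act, boundaryMatrix_mul_sigma3, act_act,
    ← neg_one_smul ℂ, act_smul, inner_smul_right]
  ring

/-- Here `B b = b`. Since `B` is hermitian and anticommutes with `σ₃`, both halves of the projection
contribute the same amount. -/
lemma inner_Pminus_sigma3 (p : Plane) (a b : Spinor) (hb : Pminus Ω p b = 0) :
    inner ℂ (Pminus Ω p a) (act sigma3 b) =
      inner ℂ a (act sigma3 (act (boundaryMatrix Ω p) b)) := by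
  rw [Pminus_apply, smul_eq_zero_iff_right (by norm_num), sub_eq_zero] at hb
  rw [Pminus_apply, inner_smul_left, inner_sub_left, inner_boundaryMatrix_sigma3, ← hb]
  simp only [one_div, map_inv₀, Complex.conj_ofNat]
  ring

/-- Now `B b = -b`, whence the sign; it compensates the reversed normal on the complement. -/
lemma inner_Pplus_sigma3 (p : Plane) (a b : Spinor) (hb : Pplus Ω p b = 0) :
    inner ℂ (Pplus Ω p a) (act sigma3 b) =
      -inner ℂ a (act sigma3 (act (boundaryMatrix Ω p) b)) := by
  rw [Pplus_apply, smul_eq_zero_iff_right (by norm_num), add_eq_zero_iff_eq_neg] at hb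
  have hb' : act (boundaryMatrix Ω p) b = -b := by rw [← neg_eq_iff_eq_neg.2 hb]
  rw [Pplus_apply, inner_smul_left, inner_add_left, inner_boundaryMatrix_sigma3, hb', map_neg,
    inner_neg_right]
  simp only [one_div, map_inv₀, Complex.conj_ofNat]
  ring

lemma bdInner_Pminus (hΩ : IsAdmissible Ω) (ρ τ : L2bd Ω)
    (hτ : ∀ᵐ p ∂(bdMeasure Ω), Pminus Ω p (τ p) = 0) :
    bdInner Ω (fun p => Pminus Ω p (ρ p)) (fun p => act sigma3 (τ p)) =
      inner ℂ ρ (diracVal fun j => normalMul hΩ j τ) := by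
  rw [bdInner, L2.inner_def]
  refine integral_congr_ae ?_
  filter_upwards [hτ, coeFn_diracVal_normalMul hΩ τ] with p h1 h2
  rw [h2, inner_Pminus_sigma3 p _ _ h1]

lemma bdInner_Pplus (hΩ : IsAdmissible Ω) (ρ τ : L2bd Ω)
    (hτ : ∀ᵐ p ∂(bdMeasure Ω), Pplus Ω p (τ p) = 0) :
    bdInner Ω (fun p => Pplus Ω p (ρ p)) (fun p => act sigma3 (τ p)) =
      -inner ℂ ρ (diracVal fun j => normalMul hΩ j τ) := by
  rw [bdInner, L2.inner_def, ← integral_neg]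
  refine integral_congr_ae ?_
  filter_upwards [hτ, coeFn_diracVal_normalMul hΩ τ] with p h1 h2
  rw [h2, inner_Pplus_sigma3 p _ _ h1]

/-- The trace `bdTrace` is the unique one. -/
lemma HasTrace.bdTrace_eq {O : Set Plane} {u : L2 O} {τ : L2bd Ω} (h : HasTrace Ω O u τ)
    (hu : ∀ τ', HasTrace Ω O u τ' → τ' = τ) : bdTrace Ω O u = τ := by
  have hex : ∃ τ, HasTrace Ω O u τ := ⟨τ, h⟩
  rw [bdTrace, dif_pos hex]
  exact hu _ hex.choose_spec

/-- An element of the domain of a Dirac operator with boundary conditions and constant mass. -/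
lemma exists_hasTraceData_of_mem_diracGraph {O : Set Plane} [IsLocallyFiniteMeasure (bdMeasure Ω)]
    (hO : MeasurableSet O) (hf : volume (frontier O) = 0) {m : ℝ}
    {P : Plane → Spinor →L[ℂ] Spinor} {u w : L2 O}
    (h : (u, w) ∈ diracGraph O (fun _ => m) (bcDomain Ω O P)) :
    ∃ τ e, HasTrace Ω O u τ ∧ HasTraceData Ω O u e τ ∧ (∀ᵐ p ∂(bdMeasure Ω), P p (τ p) = 0) ∧
      w = diracVal e + (m : ℂ) • sigma3Val _ u := by
  obtain ⟨-, τ, hτ, hP⟩ := h.1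
  obtain ⟨e, he, hdata⟩ := hasTrace_iff.1 hτ
  refine ⟨τ, e, hτ, hdata, hP, Lp.ext ?_⟩
  filter_upwards [ae_eq_of_mem_diracGraph hO hf h he,
    Lp.coeFn_add (diracVal e) ((m : ℂ) • sigma3Val _ u), Lp.coeFn_smul (m : ℂ) (sigma3Val _ u),
    ContinuousLinearMap.coeFn_compLpL (act sigma3) u] with x h1 h2 h3 h4
  rw [h2, Pi.add_apply, h3, Pi.smul_apply, h4]
  exact h1

end Boundary

end

end InfiniteMass

theorem lemma2p1 (Ω : Set Plane) (hΩ : IsAdmissible Ω) (m : ℝ) (hm : 0 < m) (z : ℂ)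
    (hz : z ∈ opResolventSet (Hm Ω m)) (hzΩ : z ∈ opResolventSet (HOmega Ω))
    (hzc : z ∈ opResolventSet (HCompl Ω m))
    (f g : L2 univ) (h : L2 Ω) (k : L2 Ωᶜ) (hg : g = glue hΩ.isOpen h k)
    (ψ : L2 univ) (hψ : ψ = ContinuousLinearMap.adjoint (opResolvent (Hm Ω m) z) f) :
    -- the four boundary traces occurring below exist and are unique
    (∃! τ, HasTrace Ω Ω (restr Ω ψ) τ) ∧
    (∃! τ, HasTrace Ω Ωᶜ (restr Ωᶜ ψ) τ) ∧
    (∃! τ, HasTrace Ω Ω (opResolvent (HOmega Ω) z h) τ) ∧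
    (∃! τ, HasTrace Ω Ωᶜ (opResolvent (HCompl Ω m) z k) τ) ∧
    -- the identity
    inner ℂ f (opResolvent (Hm Ω m) z g) =
      inner ℂ f
        (glue hΩ.isOpen (opResolvent (HOmega Ω) z h) (opResolvent (HCompl Ω m) z k))
      + bdInner Ω (fun p => Pminus Ω p (bdTrace Ω Ω (restr Ω ψ) p))
          (fun p => act sigma3 (bdTrace Ω Ω (opResolvent (HOmega Ω) z h) p))
      + bdInner Ω (fun p => Pplus Ω p (bdTrace Ω Ωᶜ (restr Ωᶜ ψ) p))
          (fun p => act sigma3 (bdTrace Ω Ωᶜ (opResolvent (HCompl Ω m) z k) p)) := by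
  have := isLocallyFiniteMeasure_bdMeasure hΩ.boundary
  have hO := hΩ.isOpen.measurableSet
  have hfr := volume_frontier hΩ.boundary
  have hfr' : volume (frontier Ωᶜ) = 0 := by rwa [frontier_compl]
  have uniq : ∀ {u : L2 Ω} {τ : L2bd Ω}, HasTrace Ω Ω u τ → ∀ τ', HasTrace Ω Ω u τ' → τ' = τ :=
    fun h1 _ h2 => h2.unique hΩ one_ne_zero (satisfiesDivergence_self hΩ) hO hfr h1
  have uniq' : ∀ {u : L2 Ωᶜ} {τ : L2bd Ω}, HasTrace Ω Ωᶜ u τ → ∀ τ', HasTrace Ω Ωᶜ u τ' → τ' = τ :=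
    fun h1 _ h2 => h2.unique hΩ (neg_ne_zero.2 one_ne_zero) (satisfiesDivergence_compl hΩ)
      hO.compl hfr' h1
  obtain ⟨d, ρ, hd, hρ, hθ⟩ := exists_hasTraceData hΩ (inner_adjoint_opResolvent hΩ.isOpen hz f)
  rw [← hψ] at hd hρ hθ
  -- A single sequence on the plane approximates `ψ` on both sides, so both traces equal `ρ`.
  have hψΩ : HasTrace Ω Ω (restr Ω ψ) ρ :=
    hasTrace_iff.2 ⟨_, fun j => (hd j).restr, hρ.restr Ω⟩
  have hψc : HasTrace Ω Ωᶜ (restr Ωᶜ ψ) ρ :=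
    hasTrace_iff.2 ⟨_, fun j => (hd j).restr, hρ.restr Ωᶜ⟩
  obtain ⟨τ, e, hτ, hτe, hPτ, hue⟩ := exists_hasTraceData_of_mem_diracGraph hO hfr
    (opResolvent_mem_diracGraph hO hfr hzΩ h)
  obtain ⟨τ', e', hτ', hτe', hPτ', hue'⟩ := exists_hasTraceData_of_mem_diracGraph hO.compl hfr'
    (opResolvent_mem_diracGraph hO.compl hfr' hzc k)
  refine ⟨⟨ρ, hψΩ, uniq hψΩ⟩, ⟨ρ, hψc, uniq' hψc⟩, ⟨τ, hτ, uniq hτ⟩, ⟨τ', hτ', uniq' hτ'⟩, ?_⟩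
  rw [hψΩ.bdTrace_eq (uniq hψΩ), hψc.bdTrace_eq (uniq' hψc)]
  rw [HasTrace.bdTrace_eq (u := opResolvent (HOmega Ω) z h) hτ (uniq hτ),
    HasTrace.bdTrace_eq (u := opResolvent (HCompl Ω m) z k) hτ' (uniq' hτ'),
    bdInner_Pminus hΩ _ _ hPτ, bdInner_Pplus hΩ _ _ hPτ',
    ← ContinuousLinearMap.adjoint_inner_left, ← hψ, inner_eq_add_restr hO, hg, restr_glue,
    restr_compl_glue, inner_eq_add_restr hO f, restr_glue, restr_compl_glue]
  -- The adjoint equation `Tψ = f - m 1_{Ωᶜ} σ₃ ψ + z̄ ψ`, restricted to either side.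
  have hr : ∀ O, restr O f + (-1 : ℂ) • restr O (massTerm hΩ.isOpen m ψ) +
      (starRingEnd ℂ) z • restr O ψ = diracVal fun j => restr O (d j) := by
    intro O
    rw [← restr_diracVal, ← hθ, restr_add, restr_add, restr_smul, restr_smul]
  -- On `Ω` the mass term restricts to zero, in agreement with the mass `0` of `HOmega`.
  have h1 := (hρ.restr Ω).inner_resolvent hΩ (satisfiesDivergence_self hΩ) hτe hue
    (F := restr Ω f) (by
      rw [← hr, massTerm, restr_glue]
      simp)
  have h2 := (hρ.restr Ωᶜ).inner_resolvent hΩ (satisfiesDivergence_compl hΩ) hτe' hue'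
    (F := restr Ωᶜ f) (by
      rw [← hr, massTerm, restr_compl_glue, smul_smul, neg_one_mul])
  rw [h1, h2]
  unfold HOmega HCompl
  ring
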